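/- Let $k$ be an algebraically closed field of characteristic $0$ (e.g. $k=\mathbb{C}$) and $G$ a connected affine algebraic group over $k$ (e.g. a simple or reductive one) with Lie algebra $\mathfrak{g}$. Let $\operatorname{Out}(G)=\operatorname{Aut}(G)/\operatorname{Inn}(G)$ act on $G$, and hence on $\mathfrak{g}$, through a splitting $\operatorname{Out}(G)\to\operatorname{Aut}(G)$. Let $(x_i)$ be a basis of $\mathfrak{g}$ and let $r=\sum r^{ij}x_i\otimes x_j\in(\mathfrak{g}\otimes\mathfrak{g})^{\operatorname{Out}(G)}$ be an $\operatorname{Out}(G)$-invariant classical $r$-matrix, i.e. $[r_{12},r_{13}]+[r_{12},r_{23}]+[r_{13},r_{23}]=0$ and the symmetric part of $r$ is $\mathfrak{g}$-invariant. Let $\Sigma$ be a compact connected oriented surface with non-empty boundary and let $\rho\colon\pi_1(\Sigma)\to\operatorname{Out}(G)$ be a homomorphism. Let $\mathcal{M}^\circ_\rho(\Sigma)$ be the affine variety of maps $\varphi\colon\pi_1(\Sigma)\to G$ with $\varphi(\gamma\gamma')=\varphi(\gamma)\,\rho(\gamma).\varphi(\gamma')$, on which $G$ acts by $(h.\varphi)(\gamma)=h\,\varphi(\gamma)\,\rho(\gamma).h^{-1}$.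 A ciliated fat graph model of $\Sigma$ with one vertex $v$ and set $E$ of oriented edges consists of a linear order $\prec$ of the $2|E|$ half-edges at $v$ and of a family $(\gamma_e)_{e\in E}$ of free generators of $\pi_1(\Sigma)$, such that the free homotopy classes of the oriented boundary circles of the ribbon surface of the graph, read off as words in the $\gamma_e^{\pm1}$, are those of the oriented boundary circles of $\Sigma$. (In a product of loops the right factor is traversed first.) Holonomy gives an isomorphism $\mathcal{M}^\circ_\rho(\Sigma)\cong G^E$, $\varphi\mapsto(\varphi(\gamma_e))_{e\in E}$. Put $\kappa_e=\rho(\gamma_e)$. For $x\in\mathfrak{g}$ let $x^L(e)$ and $x^R(e)$ be the vector fields on $G^E$ given by $$(x^L(e)F)(g)=\tfrac{d}{dt}\Big|_{0}F(\dots,g_e\exp(tx),\dots),\qquad (x^R(e)F)(g)=\tfrac{d}{dt}\Big|_{0}F(\dots,\exp(tx)g_e,\dots),$$ and for a half-edge $\alpha$ of $e$ put $x_i(\alpha)=-x_i^R(e)$ if $\alpha$ is incoming at $v$, and $x_i(\alpha)=((\kappa_e)_*x_i)^L(e)$ if $\alpha$ is outgoing at $v$. Then, with $X\wedge Y=X\otimes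 Y-Y\otimes X$: 1. The bivector $$\pi=\sum_{\alpha\prec\beta}\sum_{i,j}r^{ij}\,x_i(\alpha)\wedge x_j(\beta)+\frac12\sum_{\alpha}\sum_{i,j}r^{ij}\,x_i(\alpha)\wedge x_j(\alpha),$$ where $\alpha,\beta$ run over the half-edges, defines a Poisson structure on $\mathcal{M}^\circ_\rho(\Sigma)\cong G^E$. 2. The subalgebra $\mathcal{O}(\mathcal{M}^\circ_\rho(\Sigma))^G$ of $G$-invariant functions is closed under the Poisson bracket, and the bracket on it is independent of the fat graph: any two ciliated one-vertex fat graph models of $\Sigma$ induce the same bracket on $\mathcal{O}(\mathcal{M}^\circ_\rho(\Sigma))^G$. -/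

import Mathlib

open scoped TensorProduct

namespace TwistedFR

/-! ### Affine algebraic groups -/

section Varieties

variable {k X : Type*} [Field k]

/-- If `A` is the algebra of regular functions on an affine variety `X`, this is the algebra of
regular functions on the product variety `X ^ E`: it is generated by the `f ∘ pr_e`. -/
def powAlg (A : Subalgebra k (X → k)) (E : Type*) : Subalgebra k ((E → X) → k) :=
  Algebra.adjoin k {F | ∃ e : E, ∃ f ∈ A, F = fun g => f (g e)}

end Varieties

/-- An affine algebraic group over `k` (in the applications algebraically closed), as a group `G`
with its algebra `coord` of regular functions: `G` is the affine variety attached to a finitely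
generated reduced algebra, and multiplication and inversion are morphisms of varieties. -/
class AffineAlgebraicGroup (k G : Type*) [Field k] [Group G] where
  coord : Subalgebra k (G → k)
  coord_fg : coord.FG
  eval_bijective : Function.Bijective
    fun g : G => (Pi.evalAlgHom k (fun _ : G => k) g).comp coord.val
  mul_regular : ∀ f ∈ coord, (fun p : Fin 2 → G => f (p 0 * p 1)) ∈ powAlg coord (Fin 2)
  inv_regular : ∀ f ∈ coord, (fun g : G => f g⁻¹) ∈ coord

section Group

variable (k G : Type*) [Field k] [Group G] [AffineAlgebraicGroup k G]

/-- The algebra `𝒪(G)`. -/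
abbrev coord : Subalgebra k (G → k) := AffineAlgebraicGroup.coord

/-- `G` is connected; for algebraic groups this is the same as irreducible. -/
def IsConnected : Prop := IsDomain (coord k G)

/-- The algebra `𝒪(G ^ E)`. -/
abbrev coordPow (E : Type*) : Subalgebra k ((E → G) → k) := powAlg (coord k G) E

variable {k G}

/-- `u : Y → G` pulls regular functions back into the algebra `B` of functions on `Y`. -/
def IsRegularMap {Y : Type*} (B : Subalgebra k (Y → k)) (u : Y → G) : Prop :=
  ∀ f ∈ coord k G, (fun y => f (u y)) ∈ B

theorem powAlg_comp {X Y E : Type*} {A : Subalgebra k (X → k)} {B : Subalgebra k (Y → k)}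
    {c : Y → E → X} (hc : ∀ e, ∀ f ∈ A, (fun y => f (c y e)) ∈ B)
    {F : (E → X) → k} (hF : F ∈ powAlg A E) : (fun y => F (c y)) ∈ B := by
  induction hF using Algebra.adjoin_induction with
  | mem F h => obtain ⟨e, f, hf, rfl⟩ := h; exact hc e f hf
  | algebraMap r => exact B.algebraMap_mem r
  | add x y _ _ hx hy => exact B.add_mem hx hy
  | mul x y _ _ hx hy => exact B.mul_mem hx hy

theorem IsRegularMap.const {Y : Type*} {B : Subalgebra k (Y → k)} (g : G) :
    IsRegularMap (k := k) B (fun _ : Y => g) :=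
  fun f _ => B.algebraMap_mem (f g)

theorem IsRegularMap.mul {Y : Type*} {B : Subalgebra k (Y → k)} {u v : Y → G}
    (hu : IsRegularMap B u) (hv : IsRegularMap B v) : IsRegularMap B (fun y => u y * v y) := by
  intro f hf
  refine powAlg_comp (A := coord k G) (B := B) (E := Fin 2) (c := fun y => ![u y, v y]) ?_
    (AffineAlgebraicGroup.mul_regular f hf)
  intro e
  fin_cases e
  · exact hu
  · exact hv

theorem IsRegularMap.inv {Y : Type*} {B : Subalgebra k (Y → k)} {u : Y → G}
    (hu : IsRegularMap B u) : IsRegularMap B (fun y => (u y)⁻¹) :=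
  fun f hf => hu _ (AffineAlgebraicGroup.inv_regular f hf)

theorem IsRegularMap.id : IsRegularMap (coord k G) (fun u : G => u) := fun _ hf => hf

theorem IsRegularMap.proj {E : Type*} (e : E) :
    IsRegularMap (coordPow k G E) (fun g : E → G => g e) :=
  fun f hf => Algebra.subset_adjoin ⟨e, f, hf, rfl⟩

/-- Pull-back of functions along a regular map `c : G → G ^ E`. -/
def pull {E : Type*} (c : G → E → G) (hc : ∀ e, IsRegularMap (coord k G) fun u => c u e) :
    coordPow k G E →ₐ[k] coord k G where
  toFun F := ⟨fun u => F.1 (c u), powAlg_comp hc F.2⟩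
  map_one' := rfl
  map_mul' _ _ := rfl
  map_zero' := rfl
  map_add' _ _ := rfl
  commutes' _ := rfl

/-- Pull-back of functions along a regular map `c : G → G`. -/
def pullOne (c : G → G) (hc : IsRegularMap (coord k G) c) : coord k G →ₐ[k] coord k G where
  toFun f := ⟨fun u => f.1 (c u), hc f.1 f.2⟩
  map_one' := rfl
  map_mul' _ _ := rfl
  map_zero' := rfl
  map_add' _ _ := rfl
  commutes' _ := rfl

@[simp] theorem pull_apply {E : Type*} (c : G → E → G)
    (hc : ∀ e, IsRegularMap (coord k G) fun u => c u e) (F : coordPow k G E) (u : G) :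
    (pull c hc F).1 u = F.1 (c u) := rfl

@[simp] theorem pullOne_apply (c : G → G) (hc : IsRegularMap (coord k G) c) (f : coord k G)
    (u : G) : (pullOne c hc f).1 u = f.1 (c u) := rfl

/-! ### The Lie algebra and invariant vector fields -/

/-- `f ↦ (u ↦ f (g u))`. -/
def leftTranslate (g : G) : coord k G →ₐ[k] coord k G :=
  pullOne (fun u => g * u) ((IsRegularMap.const g).mul IsRegularMap.id)

variable (k G) in
/-- The Lie algebra `𝔤` of `G`: the left-invariant derivations of `𝒪(G)`. -/
def lieAlg : LieSubalgebra k (Derivation k (coord k G) (coord k G)) where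
  carrier := {D | ∀ (g : G) (f : coord k G), D (leftTranslate g f) = leftTranslate g (D f)}
  add_mem' := by
    intro a b ha hb g f
    exact (congrArg₂ (· + ·) (ha g f) (hb g f)).trans (map_add (leftTranslate g) _ _).symm
  zero_mem' := fun g _ => (map_zero (leftTranslate g)).symm
  smul_mem' := by
    intro c a ha g f
    exact (congrArg (c • ·) (ha g f)).trans (map_smul (leftTranslate g) _ _).symm
  lie_mem' := by
    intro a b ha hb g f
    have ha' : ∀ f : coord k G, a (leftTranslate g f) = leftTranslate g (a f) := ha g
    have hb' : ∀ f : coord k G, b (leftTranslate g f) = leftTranslate g (b f) := hb g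
    show ⁅a, b⁆ (leftTranslate g f) = leftTranslate g (⁅a, b⁆ f)
    rw [Derivation.commutator_apply, Derivation.commutator_apply, map_sub, ha', hb', ha', hb']

theorem field_mem {Z E : Type*} {B : Subalgebra k (Z → k)}
    (D : Derivation k (coord k G) (coord k G)) (c : Z → G → E → G)
    (hc : ∀ z e, IsRegularMap (coord k G) fun u => c z u e) (pt : Z → G)
    (h1 : ∀ e, IsRegularMap B fun z => c z (pt z) e)
    (h2 : ∀ e, ∀ f : coord k G, (fun z => (D (pullOne (fun u => c z u e) (hc z e) f)).1 (pt z)) ∈ B)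
    (F : coordPow k G E) :
    (fun z => (D (pull (c z) (hc z) F)).1 (pt z)) ∈ B := by
  obtain ⟨F, hF⟩ := F
  induction hF using Algebra.adjoin_induction with
  | mem F h => obtain ⟨e, f, hf, rfl⟩ := h; exact h2 e ⟨f, hf⟩
  | algebraMap r =>
    have : ∀ z, D (pull (c z) (hc z) (algebraMap k (coordPow k G E) r)) = 0 := by
      intro z
      rw [AlgHom.commutes, Derivation.map_algebraMap]
    have h0 : (fun z => (D (pull (c z) (hc z) (algebraMap k (coordPow k G E) r))).1 (pt z)) = 0 := by
      funext z
      rw [this z]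
      rfl
    exact h0 ▸ B.zero_mem
  | add x y hx hy ihx ihy =>
    have : (fun z => (D (pull (c z) (hc z) (⟨x, hx⟩ + ⟨y, hy⟩))).1 (pt z)) =
        (fun z => (D (pull (c z) (hc z) ⟨x, hx⟩)).1 (pt z)) +
        (fun z => (D (pull (c z) (hc z) ⟨y, hy⟩)).1 (pt z)) := by
      funext z
      rw [map_add, map_add]
      rfl
    exact this ▸ B.add_mem ihx ihy
  | mul x y hx hy ihx ihy =>
    have : (fun z => (D (pull (c z) (hc z) (⟨x, hx⟩ * ⟨y, hy⟩))).1 (pt z)) =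
        (fun z => x (c z (pt z))) * (fun z => (D (pull (c z) (hc z) ⟨y, hy⟩)).1 (pt z)) +
        (fun z => y (c z (pt z))) * (fun z => (D (pull (c z) (hc z) ⟨x, hx⟩)).1 (pt z)) := by
      funext z
      rw [map_mul, Derivation.leibniz]
      rfl
    exact this ▸ B.add_mem (B.mul_mem (powAlg_comp h1 hx) ihy) (B.mul_mem (powAlg_comp h1 hy) ihx)

variable {E : Type*} [DecidableEq E]

theorem update_regular (g : E → G) (e : E) {v : G → G} (hv : IsRegularMap (coord k G) v) (e' : E) :
    IsRegularMap (coord k G) fun u => Function.update g e (v u) e' := by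
  by_cases h : e' = e
  · subst h
    simpa using hv
  · simpa [Function.update_of_ne h] using IsRegularMap.const (g e')

/-- The left-invariant vector field `x^L(e)` of `x ∈ 𝔤` on the copy of `G` with index `e` in
`G ^ E`: at `g` it is the derivation `x` applied in the `e`-th variable, i.e.
`(x^L(e) F) (g) = d/dt F (…, g_e exp (t x), …)` at `t = 0`. -/
def leftField (e : E) (x : lieAlg k G) : Derivation k (coordPow k G E) (coordPow k G E) :=
  Derivation.mk'
    { toFun := fun F =>
        ⟨fun g => (x.1 (pull (fun u => Function.update g e u)
            (update_regular g e IsRegularMap.id) F)).1 (g e), by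
          refine field_mem (B := coordPow k G E) x.1 (fun g u => Function.update g e u)
            (fun g => update_regular g e IsRegularMap.id) (fun g => g e) ?_ ?_ F
          · intro e'
            simpa using IsRegularMap.proj e'
          · intro e' f
            by_cases h : e' = e
            · subst h
              have : ∀ g : E → G, pullOne (fun u => Function.update g e' u e')
                  (update_regular g e' IsRegularMap.id e') f = f := by
                intro g
                ext u
                simp
              simp only [this]
              exact IsRegularMap.proj e' _ (x.1 f).2
            · have : ∀ g : E → G, pullOne (fun u => Function.update g e u e')
                  (update_regular g e IsRegularMap.id e') f =
                    algebraMap k (coord k G) (f.1 (g e')) := by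
                intro g
                ext u
                simp [Function.update_of_ne h]
              simp only [this, Derivation.map_algebraMap]
              exact (coordPow k G E).zero_mem⟩
      map_add' := by
        intro F F'
        ext g
        simp
      map_smul' := by
        intro a F
        ext g
        simp }
    (by
      intro F F'
      ext g
      simp)

/-- The right-invariant vector field `x^R(e)` of `x ∈ 𝔤` on the copy of `G` with index `e` in
`G ^ E`: `(x^R(e) F) (g) = d/dt F (…, exp (t x) g_e, …)` at `t = 0`. -/
def rightField (e : E) (x : lieAlg k G) : Derivation k (coordPow k G E) (coordPow k G E) :=
  Derivation.mk'
    { toFun := fun F =>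
        ⟨fun g => (x.1 (pull (fun u => Function.update g e (u * g e))
            (update_regular g e (IsRegularMap.id.mul (IsRegularMap.const (g e)))) F)).1 1, by
          refine field_mem (B := coordPow k G E) x.1 (fun g u => Function.update g e (u * g e))
            (fun g => update_regular g e (IsRegularMap.id.mul (IsRegularMap.const (g e))))
            (fun _ => 1) ?_ ?_ F
          · intro e'
            simpa using IsRegularMap.proj e'
          · intro e' f
            by_cases h : e' = e
            · subst h
              have key : (fun y : G => (x.1 (pullOne (fun u => u * y)
                  (IsRegularMap.id.mul (IsRegularMap.const y)) f)).1 1) ∈ coord k G := by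
                have := field_mem (B := coord k G) (E := Fin 2) x.1 (fun y u => ![u, y])
                  (fun y i => by
                    fin_cases i
                    · exact IsRegularMap.id
                    · exact IsRegularMap.const y)
                  (fun _ => 1)
                  (fun i => by
                    fin_cases i
                    · exact IsRegularMap.const 1
                    · exact IsRegularMap.id)
                  (fun i f => by
                    fin_cases i
                    · exact (coord k G).algebraMap_mem ((x.1 f).1 1)
                    · have : ∀ y : G, pullOne (fun _ : G => y) (IsRegularMap.const y) f =
                          algebraMap k (coord k G) (f.1 y) := fun y => rfl
                      show (fun y : G => (x.1 (pullOne (fun _ : G => y)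
                        (IsRegularMap.const y) f)).1 1) ∈ coord k G
                      simp only [this, Derivation.map_algebraMap]
                      exact (coord k G).zero_mem)
                  ⟨_, AffineAlgebraicGroup.mul_regular f.1 f.2⟩
                exact this
              have : ∀ g : E → G, pullOne (fun u => Function.update g e' (u * g e') e')
                  (update_regular g e' (IsRegularMap.id.mul (IsRegularMap.const (g e'))) e') f =
                  pullOne (fun u => u * g e')
                  (IsRegularMap.id.mul (IsRegularMap.const (g e'))) f := by
                intro g
                ext u
                simp
              simp only [this]
              exact IsRegularMap.proj e' _ key
            · have : ∀ g : E → G, pullOne (fun u => Function.update g e (u * g e) e')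
                  (update_regular g e (IsRegularMap.id.mul (IsRegularMap.const (g e))) e') f =
                    algebraMap k (coord k G) (f.1 (g e')) := by
                intro g
                ext u
                simp [Function.update_of_ne h]
              simp only [this, Derivation.map_algebraMap]
              exact (coordPow k G E).zero_mem⟩
      map_add' := by
        intro F F'
        ext g
        simp
      map_smul' := by
        intro a F
        ext g
        simp }
    (by
      intro F F'
      ext g
      simp)

/-! ### Outer automorphisms -/

variable (k G) in
/-- The group `Aut(G)` of automorphisms of the algebraic group `G`. -/
def AlgAut : Subgroup (MulAut G) where
  carrier := {a | IsRegularMap (coord k G) (fun u => a u) ∧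
    IsRegularMap (coord k G) (fun u => a⁻¹ u)}
  one_mem' := ⟨IsRegularMap.id, IsRegularMap.id⟩
  mul_mem' := by
    intro a b ha hb
    refine ⟨fun f hf => hb.1 _ (ha.1 f hf), fun f hf => ?_⟩
    have := ha.2 _ (hb.2 f hf)
    simpa [mul_inv_rev] using this
  inv_mem' := by
    intro a ha
    exact ⟨ha.2, by simpa using ha.1⟩

instance conj_range_normal : (MulAut.conj : G →* MulAut G).range.Normal where
  conj_mem := by
    rintro _ ⟨g, rfl⟩ a
    exact ⟨a g, by ext u; simp [MulAut.conj_apply]⟩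

variable (k G) in
/-- `Out(G) = Aut(G) / Inn(G)`. -/
abbrev Out : Type _ :=
  AlgAut k G ⧸ (MulAut.conj : G →* MulAut G).range.subgroupOf (AlgAut k G)

/-- The action `a_*` on `𝔤` of an automorphism `a` of `G`: `(a_* x) f = (x (f ∘ a)) ∘ a⁻¹`, the
differential of `a` at the unit. -/
def push (a : AlgAut k G) : lieAlg k G →ₗ[k] lieAlg k G where
  toFun x := ⟨Derivation.mk'
      ((pullOne (fun u => a.1⁻¹ u) a.2.2).toLinearMap ∘ₗ (x.1 : coord k G →ₗ[k] coord k G) ∘ₗ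
        (pullOne (fun u => a.1 u) a.2.1).toLinearMap)
      (by
        intro f f'
        ext u
        simp), by
      intro g f
      have h : pullOne (fun u => a.1 u) a.2.1 (leftTranslate g f) =
          leftTranslate (a.1⁻¹ g) (pullOne (fun u => a.1 u) a.2.1 f) := by
        ext u
        simp [leftTranslate]
      have hx := x.2 (a.1⁻¹ g) (pullOne (fun u => a.1 u) a.2.1 f)
      rw [← h] at hx
      ext u
      show (x.1 (pullOne (fun u => a.1 u) a.2.1 (leftTranslate g f))).1 (a.1⁻¹ u) =
        (x.1 (pullOne (fun u => a.1 u) a.2.1 f)).1 (a.1⁻¹ (g * u))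
      rw [hx, map_mul]
      rfl⟩
  map_add' x y := by
    ext f u
    simp
  map_smul' c x := by
    ext f u
    simp

end Group

/-! ### Classical r-matrices and Poisson brackets -/

section RMatrix

variable {k L : Type*} [Field k] [LieRing L] [LieAlgebra k L]

/-- `[r₁₂, s₁₃]`: `(a ⊗ b) ⊗ (c ⊗ d) ↦ [a, c] ⊗ b ⊗ d`. -/
noncomputable def bracket1213 : (L ⊗[k] L) ⊗[k] (L ⊗[k] L) →ₗ[k] L ⊗[k] (L ⊗[k] L) :=
  (LieModule.toModuleHom k L L : L ⊗[k] L →ₗ[k] L).rTensor (L ⊗[k] L) ∘ₗ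
    (TensorProduct.tensorTensorTensorComm k L L L L).toLinearMap

/-- `[r₁₂, s₂₃]`: `(a ⊗ b) ⊗ (c ⊗ d) ↦ a ⊗ [b, c] ⊗ d`. -/
noncomputable def bracket1223 : (L ⊗[k] L) ⊗[k] (L ⊗[k] L) →ₗ[k] L ⊗[k] (L ⊗[k] L) :=
  ((LieModule.toModuleHom k L L : L ⊗[k] L →ₗ[k] L).rTensor L ∘ₗ
      (TensorProduct.assoc k L L L).symm.toLinearMap).lTensor L ∘ₗ
    (TensorProduct.assoc k L L (L ⊗[k] L)).toLinearMap

/-- `[r₁₃, s₂₃]`: `(a ⊗ b) ⊗ (c ⊗ d) ↦ a ⊗ c ⊗ [b, d]`. -/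
noncomputable def bracket1323 : (L ⊗[k] L) ⊗[k] (L ⊗[k] L) →ₗ[k] L ⊗[k] (L ⊗[k] L) :=
  (TensorProduct.assoc k L L L).toLinearMap ∘ₗ
    (LieModule.toModuleHom k L L : L ⊗[k] L →ₗ[k] L).lTensor (L ⊗[k] L) ∘ₗ
    (TensorProduct.tensorTensorTensorComm k L L L L).toLinearMap

/-- A (quasi-triangular) classical r-matrix: a solution of the classical Yang-Baxter equation
`[r₁₂, r₁₃] + [r₁₂, r₂₃] + [r₁₃, r₂₃] = 0` whose symmetric part is ad-invariant. -/
structure IsClassicalRMatrix (r : L ⊗[k] L) : Prop where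
  cybe : bracket1213 (r ⊗ₜ[k] r) + bracket1223 (r ⊗ₜ[k] r) + bracket1323 (r ⊗ₜ[k] r) = 0
  symm_invariant : ∀ x : L, ⁅x, r + TensorProduct.comm k L L r⁆ = 0

end RMatrix

section Poisson

variable {k A : Type*} [Field k] [CommRing A] [Algebra k A]

/-- A Poisson structure on the commutative algebra `A`. -/
structure IsPoissonBracket (B : A →ₗ[k] A →ₗ[k] A) : Prop where
  skew : ∀ f, B f f = 0
  leibniz : ∀ f g h, B f (g * h) = B f g * h + g * B f h
  jacobi : ∀ f g h, B f (B g h) + B g (B h f) + B h (B f g) = 0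

/-- The bivector `X ∧ Y = X ⊗ Y - Y ⊗ X`, as a bracket: `(f, g) ↦ X f * Y g - Y f * X g`. -/
noncomputable def wedge (X Y : Derivation k A A) : A →ₗ[k] A →ₗ[k] A :=
  (LinearMap.mul k A).compl₁₂ (X : A →ₗ[k] A) (Y : A →ₗ[k] A) -
    (LinearMap.mul k A).compl₁₂ (Y : A →ₗ[k] A) (X : A →ₗ[k] A)

end Poisson

/-! ### Ciliated fat graphs with one vertex -/

/-- The half-edges of a graph with one vertex and set `E` of oriented edges: `Sum.inl e` is the
half of `e` that is outgoing at the vertex, `Sum.inr e` the half that is incoming. -/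
abbrev HalfEdge (E : Type*) : Type _ := E ⊕ E

/-- A ciliated fat graph with one vertex and set `E` of oriented edges: the orientation and the
cilium order the half-edges at the vertex linearly. (This is a gluing pattern.) -/
structure CiliatedFatGraph (E : Type*) [Fintype E] where
  order : HalfEdge E ≃ Fin (2 * Fintype.card E)

namespace CiliatedFatGraph

variable {E : Type*} [Fintype E] (Γ : CiliatedFatGraph E)

/-- The cyclic order of half-edges and cilium `none` around the vertex; the cilium is at `0`. -/
def position : Option (HalfEdge E) ≃ Fin (2 * Fintype.card E + 1) :=
  (Equiv.optionCongr Γ.order).trans (finSuccEquiv _).symm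

/-- The next half-edge (or the cilium) in the cyclic order at the vertex. -/
def next : Equiv.Perm (Option (HalfEdge E)) :=
  (Γ.position.trans (finRotate _)).trans Γ.position.symm

/-- Follow the boundary of the ribbon surface: having left the vertex along a half-edge, one comes
back along the other half of this edge and leaves along the next half-edge. (At the cilium one
stays at the vertex.) The cycles of this permutation are the boundary circles. -/
def boundaryStep : Equiv.Perm (Option (HalfEdge E)) :=
  (Equiv.optionCongr (Equiv.sumComm E E)).trans Γ.next

/-- The loop traversed on leaving the vertex along a half-edge. -/
def letter {S : Type*} [Group S] (γ : E → S) : Option (HalfEdge E) → S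
  | none => 1
  | some (Sum.inl e) => γ e
  | some (Sum.inr e) => (γ e)⁻¹

/-- The loop around the boundary circle that starts at `h`, if `γ e` is the class of the loop `e`.
In a product of loops the right factor is traversed first, as for holonomies. -/
noncomputable def boundaryWord {S : Type*} [Group S] (γ : E → S) (h : Option (HalfEdge E)) : S :=
  ((List.range (Function.minimalPeriod Γ.boundaryStep h)).map
    fun m => letter γ ((Γ.boundaryStep ^ m) h)).reverse.prod

/-- The free homotopy classes of all the oriented boundary circles of the ribbon surface. -/
def boundaryClasses {S : Type*} [Group S] (γ : E → S) : Set (ConjClasses S) :=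
  Set.range fun h => ConjClasses.mk (Γ.boundaryWord γ h)

end CiliatedFatGraph

/-- A ciliated one-vertex fat graph model, with set `E` of edges, of a connected oriented surface
with non-empty boundary. The surface is given by its fundamental group `S` and the set `bdry` of
free homotopy classes of its oriented boundary circles. The edges of an embedded ciliated fat graph
onto which the surface retracts are loops that generate `S` freely, and the boundary circles are
read off the fat graph. -/
structure FatGraphModel (E S : Type*) [Fintype E] [Group S] (bdry : Set (ConjClasses S))
    extends CiliatedFatGraph E where
  edge : FreeGroupBasis E S
  boundaryClasses_eq : toCiliatedFatGraph.boundaryClasses edge = bdry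

/-! ### The twisted representation variety -/

section Twisted

variable {k G S : Type*} [Field k] [Group G] [AffineAlgebraicGroup k G] [Group S]

/-- `Hom_ρ(S, G)`: the maps with `φ (γ γ') = φ γ * (ρ γ).φ (γ')`. They are the lifts of `ρ` to
`G ⋊ Out(G)` and, for `S` the fundamental group of `Σ`, the points of `ℳ_ρ^∘(Σ)`. Here `ρ` is
already composed with the splitting `Out(G) → Aut(G)`. -/
@[ext] structure TwistedHom (ρ : S →* AlgAut k G) where
  toFun : S → G
  map_mul' : ∀ γ γ', toFun (γ * γ') = toFun γ * (ρ γ).1 (toFun γ')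

namespace TwistedHom

variable {ρ : S →* AlgAut k G}

theorem map_one (φ : TwistedHom ρ) : φ.toFun 1 = 1 := by
  have := φ.map_mul' 1 1
  simpa using this

theorem map_inv (φ : TwistedHom ρ) (γ : S) :
    φ.toFun γ⁻¹ = (ρ γ⁻¹).1 (φ.toFun γ)⁻¹ := by
  have := φ.map_mul' γ⁻¹ γ
  rw [inv_mul_cancel, map_one] at this
  rw [_root_.map_inv, eq_inv_iff_mul_eq_one, ← this]

/-- The action of `h ∈ G` on `ℳ_ρ^∘(Σ)`: `(h.φ) γ = h * φ γ * (ρ γ).h⁻¹`. -/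
def gauge (h : G) (φ : TwistedHom ρ) : TwistedHom ρ where
  toFun γ := h * φ.toFun γ * (ρ γ).1 h⁻¹
  map_mul' γ γ' := by
    simp [φ.map_mul', mul_assoc]

variable (ρ) in
/-- The algebra `𝒪(ℳ_ρ^∘(Σ))` of regular functions: it is generated by the functions
`φ ↦ f (φ γ)`, with `γ ∈ S` and `f ∈ 𝒪(G)`. -/
def coordM : Subalgebra k (TwistedHom ρ → k) :=
  Algebra.adjoin k {F | ∃ γ : S, ∃ f ∈ coord k G, F = fun φ => f (φ.toFun γ)}

variable (ρ) in
/-- The subalgebra of `G`-invariant functions in `𝒪(ℳ_ρ^∘(Σ))`. -/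
def invariants : Subalgebra k (coordM ρ) where
  carrier := {F | ∀ (h : G) (φ : TwistedHom ρ), F.1 (φ.gauge h) = F.1 φ}
  mul_mem' := by
    intro a b ha hb h φ
    simp [ha h φ, hb h φ]
  add_mem' := by
    intro a b ha hb h φ
    simp [ha h φ, hb h φ]
  algebraMap_mem' := by
    intro r h φ
    rfl

/-- The lift of `ρ` with given holonomies along a basis of `S`, as a homomorphism to `G ⋊ S`. -/
noncomputable def liftHom {E : Type*} (b : FreeGroupBasis E S) (ρ : S →* AlgAut k G) (g : E → G) :
    S →* G ⋊[(AlgAut k G).subtype.comp ρ] S :=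
  b.lift fun e => ⟨g e, b e⟩

theorem liftHom_right {E : Type*} (b : FreeGroupBasis E S) (g : E → G) (γ : S) :
    (liftHom b ρ g γ).right = γ := by
  have : SemidirectProduct.rightHom.comp (liftHom b ρ g) = MonoidHom.id S := by
    apply b.ext_hom
    intro e
    simp [liftHom]
  exact DFunLike.congr_fun this γ

/-- The holonomy bijection `ℳ_ρ^∘(Σ) ≃ G ^ E`, `φ ↦ (φ e)_e`, for a set `E` of free generators. -/
noncomputable def hol {E : Type*} (b : FreeGroupBasis E S) (ρ : S →* AlgAut k G) :
    TwistedHom ρ ≃ (E → G) where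
  toFun φ e := φ.toFun (b e)
  invFun g :=
    { toFun := fun γ => (liftHom b ρ g γ).left
      map_mul' := by
        intro γ γ'
        rw [map_mul, SemidirectProduct.mul_left, liftHom_right]
        rfl }
  left_inv φ := by
    let Φ : S →* G ⋊[(AlgAut k G).subtype.comp ρ] S :=
      { toFun := fun γ => ⟨φ.toFun γ, γ⟩
        map_one' := by
          ext
          · exact φ.map_one
          · rfl
        map_mul' := by
          intro γ γ'
          ext
          · exact φ.map_mul' γ γ'
          · rfl }
    have : liftHom b ρ (fun e => φ.toFun (b e)) = Φ := by
      apply b.ext_hom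
      intro e
      simp [liftHom, Φ]
    ext γ
    show (liftHom b ρ (fun e => φ.toFun (b e)) γ).left = φ.toFun γ
    rw [this]
    rfl
  right_inv g := by
    funext e
    simp [liftHom]

theorem hol_symm_regular {E : Type*} (b : FreeGroupBasis E S) (ρ : S →* AlgAut k G) (γ : S) :
    IsRegularMap (coordPow k G E) fun g => ((hol b ρ).symm g).toFun γ := by
  obtain ⟨w, rfl⟩ := b.repr.symm.surjective γ
  have gen : ∀ e : E, IsRegularMap (coordPow k G E)
      fun g => ((hol b ρ).symm g).toFun (b.repr.symm (FreeGroup.of e)) := by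
    intro e
    have : ∀ g : E → G, ((hol b ρ).symm g).toFun (b.repr.symm (FreeGroup.of e)) = g e := fun g =>
      congrFun ((hol b ρ).apply_symm_apply g) e
    simp only [this]
    exact IsRegularMap.proj e
  induction w using FreeGroup.induction_on with
  | C1 =>
    simp only [_root_.map_one, TwistedHom.map_one]
    exact IsRegularMap.const 1
  | of e => exact gen e
  | inv_of e _ =>
    simp only [_root_.map_inv, TwistedHom.map_inv]
    intro f hf
    have := ((gen e).inv) _ ((ρ (b.repr.symm (FreeGroup.of e))⁻¹).2.1 f hf)
    simpa using this
  | mul v w hv hw =>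
    simp only [map_mul, TwistedHom.map_mul']
    exact hv.mul fun f hf => hw _ ((ρ _).2.1 f hf)

/-- The isomorphism `𝒪(G ^ E) ≃ 𝒪(ℳ_ρ^∘(Σ))`, pull-back along the holonomy bijection. -/
noncomputable def holPullback {E : Type*} (b : FreeGroupBasis E S) (ρ : S →* AlgAut k G) :
    coordPow k G E ≃ₐ[k] coordM ρ where
  toFun F := ⟨fun φ => F.1 (hol b ρ φ), powAlg_comp (B := coordM ρ)
    (fun e f hf => Algebra.subset_adjoin ⟨b e, f, hf, rfl⟩) F.2⟩
  invFun F := ⟨fun g => F.1 ((hol b ρ).symm g), by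
    obtain ⟨F, hF⟩ := F
    induction hF using Algebra.adjoin_induction with
    | mem F h => obtain ⟨γ, f, hf, rfl⟩ := h; exact hol_symm_regular b ρ γ f hf
    | algebraMap r => exact (coordPow k G E).algebraMap_mem r
    | add x y _ _ hx hy => exact (coordPow k G E).add_mem hx hy
    | mul x y _ _ hx hy => exact (coordPow k G E).mul_mem hx hy⟩
  left_inv F := by
    ext g
    simp
  right_inv F := by
    ext φ
    simp
  map_mul' _ _ := rfl
  map_add' _ _ := rfl
  commutes' _ := rfl

end TwistedHom

/-! ### The twisted Fock-Rosly bivector -/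

variable {E : Type*} [Fintype E] [DecidableEq E]

/-- The vector field `x(α)` on `G ^ E`: `-x^R(e)` for the incoming half `α` of `e`, and
`((κ_e)_* x)^L(e)` for the outgoing half. -/
def halfEdgeField (κ : E → AlgAut k G) (x : lieAlg k G) :
    HalfEdge E → Derivation k (coordPow k G E) (coordPow k G E)
  | Sum.inl e => leftField e (push (κ e) x)
  | Sum.inr e => -rightField e x

/-- The bivector
`∑_{α ≺ β} r^{ij} x_i(α) ∧ x_j(β) + 1/2 ∑_α r^{ij} x_i(α) ∧ x_j(α)` on `G ^ E`, as a bracket on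
`𝒪(G ^ E)`; here `r = ∑ r^{ij} x_i ⊗ x_j` for the basis `x` of `𝔤`. -/
noncomputable def fockRosly (Γ : CiliatedFatGraph E) (κ : E → AlgAut k G) {ι : Type*} [Fintype ι]
    (x : Module.Basis ι k (lieAlg k G)) (r : lieAlg k G ⊗[k] lieAlg k G) :
    coordPow k G E →ₗ[k] coordPow k G E →ₗ[k] coordPow k G E :=
  (∑ α : HalfEdge E, ∑ β : HalfEdge E with Γ.order α < Γ.order β, ∑ i, ∑ j,
      (x.tensorProduct x).repr r (i, j) •
        wedge (halfEdgeField κ (x i) α) (halfEdgeField κ (x j) β)) +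
    (1 / 2 : k) • ∑ α : HalfEdge E, ∑ i, ∑ j,
      (x.tensorProduct x).repr r (i, j) •
        wedge (halfEdgeField κ (x i) α) (halfEdgeField κ (x j) α)

/-- The twisted Fock-Rosly bracket on `𝒪(ℳ_ρ^∘(Σ))`: the bracket of the above bivector, with
`κ_e = ρ e`, under the identification `ℳ_ρ^∘(Σ) ≃ G ^ E` by holonomies. -/
noncomputable def FatGraphModel.bracket {bdry : Set (ConjClasses S)} (Γ : FatGraphModel E S bdry)
    (ρ : S →* AlgAut k G) {ι : Type*} [Fintype ι] (x : Module.Basis ι k (lieAlg k G))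
    (r : lieAlg k G ⊗[k] lieAlg k G) :
    TwistedHom.coordM ρ →ₗ[k] TwistedHom.coordM ρ →ₗ[k] TwistedHom.coordM ρ :=
  ((fockRosly Γ.toCiliatedFatGraph (fun e => ρ (Γ.edge e)) x r).compl₁₂
      (TwistedHom.holPullback Γ.edge ρ).symm.toLinearMap
      (TwistedHom.holPullback Γ.edge ρ).symm.toLinearMap).compr₂
    (TwistedHom.holPullback Γ.edge ρ).toLinearMap

end Twisted

end TwistedFR

/-!
Write `a` for the antisymmetric part of `r` and `t / 2` for its symmetric part. With the signs
`s(α, β)` of the linear order of the half-edges, the bracket is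
`∑_{α, β} ⟨a + s(α, β) t / 2, dF(α) ⊗ dF'(β)⟩`, where `dF(α)` is the linear form `x ↦ x(α) F` on
`𝔤` (`sum_wedge_order_eq`).

**Poisson structure.** The fields `x(α)` of different half-edges commute, and those of one half-edge
represent `𝔤` (`halfEdgeField_lie`). So the Jacobiator is the value of the Yang-Baxter expression of
the tensors `a + s(α, β) t / 2`, and by the Yang-Baxter equation and the transitivity of the order
only the terms of `[t₁₂, t₂₃]` on the diagonal remain (`jacobiator_orderTensor`). The forms of the
two halves of an edge are opposite up to an automorphism `Ad(g_e) ∘ κ_e` of `𝔤`, which preserves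
`t`, so their contributions cancel (`sum_ev₃_halfEdge_eq_zero`). Here the infinitesimal invariance
of `t` has to be integrated to invariance under `G`: the matrix coefficients of `Ad(h⁻¹) t` are
regular functions of `h` killed by `𝔤`, and on a connected group in characteristic zero these are
constant (`eq_const_of_lieAlg_eq_zero`), since the Euler field at the unit has no kernel on the
maximal ideal.

**Invariant functions.** For an invariant function the forms `dF(α)` sum to zero
(`isBalanced_edgeForm`), so only `t` contributes to the bracket; as `t` is `G`-invariant, the
bracket of invariant functions is invariant.

**Independence of the fat graph.** At a point `φ` the group `S = π₁(Σ)` acts on `𝔤` by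
`Ad(φ γ) ∘ ρ γ`, the tangent space consists of the cocycles `S → 𝔤` (`isCocycle_logDer`,
`eq_edgeDer`), and `dF` is a functional on cocycles that does not refer to the graph
(`sum_edgeForm_inr_eq_of_isCocycle`). The forms `dF(α)` are the jumps of a `𝔤*`-valued potential `p`
on the corners at the vertex. The boundary steps move `p` by an affine action of `S` on `𝔤*`, whose
translation parts `c` form a cocycle, and the bracket is the value of `dF'` on the cocycle `t c`
(`IsBalanced.sum_orderSign_eq`). For another model of the surface there is a bijection between the
boundary circles that respects free homotopy classes, because different boundary circles of a graph
have words with different conjugacy classes (`sameCycle_of_mk_eq`). Along it, `p` is carried to a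
map on the corners of the other graph that is equivariant for the same affine action
(`FatGraphModel.exists_section`). Sums of cocycles of affine functions along the boundary circles
recover the pairing of `dF` with the tangent vectors, and they agree for the two maps; so the second
map is a potential for `dF` on the other graph, with the same `c`, and the brackets coincide
(`FatGraphModel.sum_orderSign_eq`).
-/

namespace TwistedFR

/-! ### Point derivations and logarithmic derivatives -/

section GroupCalculus

variable {k G : Type*} [Field k] [Group G] [AffineAlgebraicGroup k G]

/-- Shortcut instance: the general search for it is slow. -/
scoped instance lieAlgModule : Module k (lieAlg k G) := inferInstance

/-- The comultiplication of `𝒪(G)`, in the form of finite sums. -/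
theorem exists_comul (f : coord k G) : ∃ s : Finset (coord k G × coord k G),
    ∀ u v : G, f.1 (u * v) = ∑ p ∈ s, p.1.1 u * p.2.1 v := by
  let pr : Fin 2 → coord k G →ₐ[k] ((Fin 2 → G) → k) := fun i =>
    { toFun := fun f p => f.1 (p i)
      map_one' := rfl
      map_mul' := fun _ _ => rfl
      map_zero' := rfl
      map_add' := fun _ _ => rfl
      commutes' := fun _ => rfl }
  have hle : powAlg (coord k G) (Fin 2) ≤
      (Algebra.TensorProduct.productMap (pr 0) (pr 1)).range := by
    refine Algebra.adjoin_le ?_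
    rintro _ ⟨i, f, hf, rfl⟩
    fin_cases i
    · exact ⟨⟨f, hf⟩ ⊗ₜ 1, by simp [pr]; rfl⟩
    · exact ⟨1 ⊗ₜ ⟨f, hf⟩, by simp [pr]; rfl⟩
  obtain ⟨t, ht⟩ := hle (AffineAlgebraicGroup.mul_regular f.1 f.2)
  obtain ⟨s, rfl⟩ := TensorProduct.exists_finset t
  refine ⟨s, fun u v => ?_⟩
  have := congrFun ht ![u, v]
  simp [pr, map_sum] at this
  exact this.symm

/-- `f ↦ (u ↦ f (u g))`. -/
def rightTranslate (g : G) : coord k G →ₐ[k] coord k G :=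
  pullOne (fun u => u * g) (IsRegularMap.id.mul (IsRegularMap.const g))

@[simp] theorem leftTranslate_apply (g : G) (f : coord k G) (u : G) :
    (leftTranslate g f).1 u = f.1 (g * u) := rfl

@[simp] theorem rightTranslate_apply (g : G) (f : coord k G) (u : G) :
    (rightTranslate g f).1 u = f.1 (u * g) := rfl

/-- `D` is a derivation at the point `y` of the algebra `B` of functions on `Y`. -/
structure IsPointDer {Y : Type*} {B : Subalgebra k (Y → k)} (y : Y) (D : B →ₗ[k] k) : Prop where
  leibniz : ∀ F F' : B, D (F * F') = F.1 y * D F' + F'.1 y * D F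

namespace IsPointDer

variable {Y : Type*} {B : Subalgebra k (Y → k)} {y : Y} {D D' : B →ₗ[k] k}

theorem map_algebraMap (hD : IsPointDer y D) (c : k) : D (algebraMap k B c) = 0 := by
  have h1 : D 1 = 0 := by
    have := hD.leibniz 1 1
    simpa using this
  rw [Algebra.algebraMap_eq_smul_one, map_smul, h1, smul_zero]

theorem ext_adjoin {s : Set (Y → k)} (hB : B = Algebra.adjoin k s) (hD : IsPointDer y D)
    (hD' : IsPointDer y D') (h : ∀ F : B, F.1 ∈ s → D F = D' F) : D = D' := by
  subst hB
  ext ⟨F, hF⟩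
  induction hF using Algebra.adjoin_induction with
  | mem F hF => exact h _ hF
  | algebraMap r => exact (hD.map_algebraMap r).trans (hD'.map_algebraMap r).symm
  | add x y hx hy ihx ihy =>
    have := congrArg₂ (· + ·) ihx ihy
    simp only [← map_add] at this
    exact this
  | mul a b ha hb iha ihb =>
    have h1 := hD.leibniz ⟨a, ha⟩ ⟨b, hb⟩
    have h2 := hD'.leibniz ⟨a, ha⟩ ⟨b, hb⟩
    rw [iha, ihb, ← h2] at h1
    exact h1

theorem sum {ι : Type*} (s : Finset ι) {D : ι → B →ₗ[k] k} (h : ∀ i ∈ s, IsPointDer y (D i)) :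
    IsPointDer y (∑ i ∈ s, D i) where
  leibniz F F' := by
    simp only [LinearMap.sum_apply, Finset.mul_sum, ← Finset.sum_add_distrib]
    exact Finset.sum_congr rfl fun i hi => (h i hi).leibniz F F'

end IsPointDer

/-- Evaluation at `y`, as a linear form on an algebra of functions. -/
def evalAt {Y : Type*} (B : Subalgebra k (Y → k)) (y : Y) : B →ₗ[k] k where
  toFun F := F.1 y
  map_add' _ _ := rfl
  map_smul' _ _ := rfl

@[simp] theorem evalAt_apply {Y : Type*} (B : Subalgebra k (Y → k)) (y : Y) (F : B) :
    evalAt B y F = F.1 y := rfl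

theorem isPointDer_of_derivation {Y : Type*} {B : Subalgebra k (Y → k)} (y : Y)
    (D : Derivation k B B) : IsPointDer y (evalAt B y ∘ₗ (D : B →ₗ[k] B)) where
  leibniz F F' := by simp

/-- The values of a left-invariant derivation are determined by those at the unit. -/
theorem lieAlg_apply (X : lieAlg k G) (f : coord k G) (g : G) :
    (X.1 f).1 g = (X.1 (leftTranslate g f)).1 1 := by
  have := congrArg (fun F : coord k G => F.1 1) (X.2 g f)
  simpa using this.symm

theorem lieAlg_apply_mul (X : lieAlg k G) (f : coord k G) (g h : G) :
    (X.1 f).1 (g * h) = (X.1 (leftTranslate g f)).1 h := by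
  have := congrArg (fun F : coord k G => F.1 h) (X.2 g f)
  simpa using this.symm

theorem lieAlg_ext {X X' : lieAlg k G} (h : ∀ f, (X.1 f).1 1 = (X'.1 f).1 1) : X = X' := by
  ext f g
  rw [lieAlg_apply, lieAlg_apply X', h]

theorem lieAlg_ext_at (g : G) {X X' : lieAlg k G} (h : ∀ f, (X.1 f).1 g = (X'.1 f).1 g) :
    X = X' := by
  refine lieAlg_ext fun f => ?_
  have h2 := h (leftTranslate g⁻¹ f)
  rw [lieAlg_apply X, lieAlg_apply X'] at h2
  have : leftTranslate g (leftTranslate g⁻¹ f) = f := by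
    ext u
    simp
  rwa [this] at h2

/-- The left-invariant derivation with a given value at the unit. -/
def lieOfPoint (d : coord k G →ₗ[k] k) (hd : IsPointDer (1 : G) d) : lieAlg k G :=
  ⟨Derivation.mk'
    { toFun := fun f => ⟨fun u => d (leftTranslate u f), by
        obtain ⟨s, hs⟩ := exists_comul f
        have : (fun u => d (leftTranslate u f)) = ∑ p ∈ s, d p.2 • p.1.1 := by
          funext u
          have h : leftTranslate u f = ∑ p ∈ s, p.1.1 u • p.2 := by
            ext v
            simp [hs]
          simp [h, mul_comm]
        rw [this]
        exact sum_mem fun p _ => (coord k G).smul_mem p.1.2 _⟩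
      map_add' := fun f f' => by
        ext u
        simp
      map_smul' := fun c f => by
        ext u
        simp }
    (fun f f' => by
      ext u
      simp [hd.leibniz]), fun g f => by
    ext u
    show d _ = d _
    congr 1
    ext v
    simp [mul_assoc]⟩

@[simp] theorem lieOfPoint_apply (d : coord k G →ₗ[k] k) (hd : IsPointDer (1 : G) d)
    (f : coord k G) (u : G) : ((lieOfPoint d hd).1 f).1 u = d (leftTranslate u f) := rfl

/-- Pull-back of functions on `G` along a regular map to `G`. -/
def pullTo {Y : Type*} {B : Subalgebra k (Y → k)} (u : Y → G) (hu : IsRegularMap B u) :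
    coord k G →ₐ[k] B where
  toFun f := ⟨fun y => f.1 (u y), hu f.1 f.2⟩
  map_one' := rfl
  map_mul' _ _ := rfl
  map_zero' := rfl
  map_add' _ _ := rfl
  commutes' _ := rfl

@[simp] theorem pullTo_apply {Y : Type*} {B : Subalgebra k (Y → k)} (u : Y → G)
    (hu : IsRegularMap B u) (f : coord k G) (y : Y) : (pullTo u hu f).1 y = f.1 (u y) := rfl

section LogDer

variable {Y : Type*} {B : Subalgebra k (Y → k)} {y : Y} {D : B →ₗ[k] k} {u v : Y → G}

/-- The right logarithmic derivative `(D u) u(y)⁻¹ ∈ 𝔤` at `y` of a regular map `u : Y → G`, in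
the direction of a point derivation `D`. -/
def logDer (hD : IsPointDer y D) (hu : IsRegularMap B u) : lieAlg k G :=
  lieOfPoint (D ∘ₗ (pullTo u hu).toLinearMap ∘ₗ (rightTranslate (u y)⁻¹).toLinearMap)
    ⟨fun F F' => by simp [hD.leibniz]⟩

theorem logDer_apply_one (hD : IsPointDer y D) (hu : IsRegularMap B u) (f : coord k G) :
    ((logDer hD hu).1 f).1 1 = D (pullTo u hu (rightTranslate (u y)⁻¹ f)) := by
  simp only [logDer, lieOfPoint_apply, LinearMap.comp_apply, AlgHom.toLinearMap_apply]
  congr 3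
  ext v
  simp

/-- The chain rule: `D` acts on the functions of `u` through the logarithmic derivative of `u`. -/
theorem apply_pullTo (hD : IsPointDer y D) (hu : IsRegularMap B u) (f : coord k G) :
    D (pullTo u hu f) = ((logDer hD hu).1 (rightTranslate (u y) f)).1 1 := by
  rw [logDer_apply_one]
  congr 2
  ext v
  simp

theorem logDer_eq_of (hD : IsPointDer y D) (hu : IsRegularMap B u) (X : lieAlg k G)
    (h : ∀ f, D (pullTo u hu f) = (X.1 (rightTranslate (u y) f)).1 1) : logDer hD hu = X := by
  refine lieAlg_ext fun f => ?_
  have hf : rightTranslate (u y) (rightTranslate (u y)⁻¹ f) = f := by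
    ext v
    simp
  rw [logDer_apply_one, h, hf]

variable (k G) in
/-- Conjugation `u ↦ g u g⁻¹`, as an automorphism of the algebraic group `G`. -/
def conjAut : G →* AlgAut k G where
  toFun g := ⟨MulAut.conj g,
    ((IsRegularMap.const g).mul IsRegularMap.id).mul (IsRegularMap.const g⁻¹), by
      rw [← map_inv]
      exact ((IsRegularMap.const g⁻¹).mul IsRegularMap.id).mul (IsRegularMap.const g⁻¹⁻¹)⟩
  map_one' := by
    ext
    simp
  map_mul' g h := by
    ext
    simp

@[simp] theorem conjAut_apply (g u : G) : (conjAut k G g).1 u = g * u * g⁻¹ := rfl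

theorem push_apply_one (a : AlgAut k G) (X : lieAlg k G) (f : coord k G) :
    ((push a X).1 f).1 1 = (X.1 (pullOne (fun u => a.1 u) a.2.1 f)).1 1 := by
  show (X.1 (pullOne (fun u => a.1 u) a.2.1 f)).1 (a.1⁻¹ 1) = _
  rw [map_one]

theorem push_mul (a b : AlgAut k G) (X : lieAlg k G) : push (a * b) X = push a (push b X) := by
  refine lieAlg_ext fun f => ?_
  simp only [push_apply_one]
  rfl

theorem push_one (X : lieAlg k G) : push (1 : AlgAut k G) X = X := by
  refine lieAlg_ext fun f => ?_
  simp only [push_apply_one]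
  rfl

theorem push_lie (a : AlgAut k G) (X X' : lieAlg k G) : push a ⁅X, X'⁆ = ⁅push a X, push a X'⁆ := by
  have key : ∀ (X : lieAlg k G) (f : coord k G), pullOne (fun u => a.1 u) a.2.1 ((push a X).1 f) =
      X.1 (pullOne (fun u => a.1 u) a.2.1 f) := by
    intro X f
    ext u
    show (X.1 (pullOne (fun u => a.1 u) a.2.1 f)).1 (a.1⁻¹ (a.1 u)) = _
    rw [MulAut.inv_apply_self]
  refine lieAlg_ext fun f => ?_
  rw [push_apply_one]
  simp only [LieSubalgebra.coe_bracket, Derivation.commutator_apply]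
  rw [AddSubgroupClass.coe_sub, AddSubgroupClass.coe_sub, Pi.sub_apply, Pi.sub_apply,
    push_apply_one, push_apply_one, key, key]

theorem comp_regular (a : AlgAut k G) (hu : IsRegularMap B u) :
    IsRegularMap B fun y => a.1 (u y) := fun f hf => hu _ (a.2.1 f hf)

theorem logDer_const (hD : IsPointDer y D) (g : G) :
    logDer hD (IsRegularMap.const (B := B) g) = 0 := by
  refine logDer_eq_of _ _ _ fun f => ?_
  exact hD.map_algebraMap (f.1 g)

theorem logDer_comp (hD : IsPointDer y D) (hu : IsRegularMap B u) (a : AlgAut k G) :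
    logDer hD (comp_regular a hu) = push a (logDer hD hu) := by
  refine lieAlg_ext fun f => ?_
  rw [push_apply_one, logDer_apply_one, logDer_apply_one]
  congr 1
  ext z
  simp

theorem apply_pullTo_mul (hD : IsPointDer y D) (hu : IsRegularMap B u) (hv : IsRegularMap B v)
    (f : coord k G) : D (pullTo _ (hu.mul hv) f) =
      D (pullTo u hu (rightTranslate (v y) f)) + D (pullTo v hv (leftTranslate (u y) f)) := by
  obtain ⟨s, hs⟩ := exists_comul f
  have h1 : pullTo _ (hu.mul hv) f = ∑ p ∈ s, pullTo u hu p.1 * pullTo v hv p.2 := by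
    ext z
    simp [hs]
  have h2 : rightTranslate (v y) f = ∑ p ∈ s, p.2.1 (v y) • p.1 := by
    ext z
    simp [hs, mul_comm]
  have h3 : leftTranslate (u y) f = ∑ p ∈ s, p.1.1 (u y) • p.2 := by
    ext z
    simp [hs]
  rw [h1, h2, h3]
  simp only [map_sum, map_smul, ← Finset.sum_add_distrib, hD.leibniz]
  refine Finset.sum_congr rfl fun p _ => ?_
  simp [add_comm]

/-- The product rule `δ(u v) = δ u + Ad(u) (δ v)`. -/
theorem logDer_mul (hD : IsPointDer y D) (hu : IsRegularMap B u) (hv : IsRegularMap B v) :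
    logDer hD (hu.mul hv) = logDer hD hu + push (conjAut k G (u y)) (logDer hD hv) := by
  refine lieAlg_ext fun f => ?_
  rw [logDer_apply_one, apply_pullTo_mul hD hu hv]
  show _ = ((logDer hD hu).1 f).1 1 + ((push (conjAut k G (u y)) (logDer hD hv)).1 f).1 1
  rw [push_apply_one, logDer_apply_one, logDer_apply_one]
  congr 3
  · ext z
    simp [mul_assoc]
  · ext z
    simp [mul_assoc]

theorem logDer_congr {u' : Y → G} (hD : IsPointDer y D) (hu : IsRegularMap B u)
    (hu' : IsRegularMap B u') (h : ∀ z, u z = u' z) : logDer hD hu = logDer hD hu' := by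
  obtain rfl : u = u' := funext h
  rfl

theorem logDer_inv (hD : IsPointDer y D) (hu : IsRegularMap B u) :
    logDer hD hu.inv = -push (conjAut k G (u y)⁻¹) (logDer hD hu) := by
  have h := logDer_mul hD hu.inv hu
  rw [logDer_congr hD (hu.inv.mul hu) (IsRegularMap.const 1) (by simp), logDer_const] at h
  exact eq_neg_of_add_eq_zero_left h.symm

/-- A left-invariant derivation as a point derivation at the unit. -/
theorem isPointDer_lieAlg (X : lieAlg k G) :
    IsPointDer (1 : G) (evalAt (coord k G) 1 ∘ₗ (X.1 : coord k G →ₗ[k] coord k G)) :=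
  isPointDer_of_derivation 1 X.1

theorem logDer_id (X : lieAlg k G) : logDer (isPointDer_lieAlg X) IsRegularMap.id = X := by
  refine logDer_eq_of _ _ _ fun f => ?_
  simp only [LinearMap.comp_apply, evalAt_apply]
  have : rightTranslate (1 : G) f = f := by
    ext z
    simp
  rw [this]
  rfl

end LogDer

end GroupCalculus

/-! ### Vector fields on powers of the group -/

section Fields

variable {k G : Type*} [Field k] [Group G] [AffineAlgebraicGroup k G]

/-- The right-invariant vector field of `x ∈ 𝔤` on `G`. -/
def rightDer (x : lieAlg k G) (f : coord k G) : coord k G :=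
  ⟨fun g => (x.1 (rightTranslate g f)).1 1, by
    obtain ⟨s, hs⟩ := exists_comul f
    have : (fun g => (x.1 (rightTranslate g f)).1 1) = ∑ p ∈ s, (x.1 p.1).1 1 • p.2.1 := by
      funext g
      have h : rightTranslate g f = ∑ p ∈ s, p.2.1 g • p.1 := by
        ext v
        simp [hs, mul_comm]
      simp [h, mul_comm]
    rw [this]
    exact sum_mem fun p _ => (coord k G).smul_mem p.2.2 _⟩

@[simp] theorem rightDer_apply (x : lieAlg k G) (f : coord k G) (g : G) :
    (rightDer x f).1 g = (x.1 (rightTranslate g f)).1 1 := rfl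

/-- Left- and right-invariant vector fields commute. -/
theorem rightDer_comm (x y : lieAlg k G) (f : coord k G) :
    x.1 (rightDer y f) = rightDer y (x.1 f) := by
  obtain ⟨s, hs⟩ := exists_comul f
  have h1 : rightDer y f = ∑ p ∈ s, (y.1 p.1).1 1 • p.2 := by
    ext g
    have h : rightTranslate g f = ∑ p ∈ s, p.2.1 g • p.1 := by
      ext v
      simp [hs, mul_comm]
    simp [h, mul_comm]
  ext g
  have h2 : rightTranslate g (x.1 f) = ∑ p ∈ s, (x.1 p.2).1 g • p.1 := by
    ext u
    have h : leftTranslate u f = ∑ p ∈ s, p.1.1 u • p.2 := by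
      ext v
      simp [hs]
    rw [rightTranslate_apply, lieAlg_apply_mul, h]
    simp [mul_comm]
  rw [rightDer_apply, h2, h1]
  simp [mul_comm]

/-- Right-invariant vector fields represent the opposite Lie algebra. -/
theorem rightDer_lie (x y : lieAlg k G) (f : coord k G) :
    rightDer x (rightDer y f) - rightDer y (rightDer x f) = rightDer ⁅y, x⁆ f := by
  have key : ∀ (x y : lieAlg k G) (g : G), (rightDer x (rightDer y f)).1 g =
      (y.1 (x.1 (rightTranslate g f))).1 1 := by
    intro x y g
    have h : rightTranslate g (rightDer y f) = rightDer y (rightTranslate g f) := by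
      ext u
      have : rightTranslate (u * g) f = rightTranslate u (rightTranslate g f) := by
        ext v
        simp [mul_assoc]
      simp only [rightTranslate_apply, rightDer_apply, this]
    have h1 : ∀ f : coord k G, rightTranslate 1 f = f := by
      intro f
      ext u
      simp
    rw [rightDer_apply, h, rightDer_comm, rightDer_apply, h1]
  ext g
  rw [AddSubgroupClass.coe_sub, Pi.sub_apply, key, key, rightDer_apply]
  simp [Derivation.commutator_apply]

section Point

variable {E : Type*}

/-- The function `g ↦ f (g e)` on `G ^ E`. -/
abbrev gen (e : E) (f : coord k G) : coordPow k G E := pullTo _ (IsRegularMap.proj e) f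

theorem IsPointDer.ext_gen {g : E → G} {D D' : coordPow k G E →ₗ[k] k} (hD : IsPointDer g D)
    (hD' : IsPointDer g D') (h : ∀ e f, D (gen e f) = D' (gen e f)) : D = D' := by
  refine hD.ext_adjoin rfl hD' ?_
  rintro ⟨_, hF⟩ ⟨e, f, hf, rfl⟩
  exact h e ⟨f, hf⟩

/-- A vector field on `G ^ E` is determined by its action on the coordinate functions of the
factors. -/
theorem derivation_ext_gen {D D' : Derivation k (coordPow k G E) (coordPow k G E)}
    (h : ∀ e f, D (gen e f) = D' (gen e f)) : D = D' := by
  ext F g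
  have := (isPointDer_of_derivation g D).ext_gen (isPointDer_of_derivation g D') fun e f => by
    simp [h e f]
  exact congrFun (congrArg DFunLike.coe this) F

end Point

variable {E : Type*} [DecidableEq E]

theorem leftField_apply (e : E) (x : lieAlg k G) (F : coordPow k G E) (g : E → G) :
    (leftField e x F).1 g = (x.1 (pull (fun u => Function.update g e u)
            (update_regular g e IsRegularMap.id) F)).1 (g e) := rfl

theorem rightField_apply (e : E) (x : lieAlg k G) (F : coordPow k G E) (g : E → G) :
    (rightField e x F).1 g = (x.1 (pull (fun u => Function.update g e (u * g e))
            (update_regular g e (IsRegularMap.id.mul (IsRegularMap.const (g e)))) F)).1 1 := rfl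

theorem leftField_gen (e e' : E) (x : lieAlg k G) (f : coord k G) :
    leftField e x (gen e' f) = if e' = e then gen e' (x.1 f) else 0 := by
  ext g
  rw [leftField_apply]
  split_ifs with h
  · subst h
    have : pull (fun u => Function.update g e' u) (update_regular g e' IsRegularMap.id)
        (gen e' f) = f := by
      ext u
      simp
    rw [this]
    rfl
  · have : pull (fun u => Function.update g e u) (update_regular g e IsRegularMap.id)
        (gen e' f) = algebraMap k (coord k G) (f.1 (g e')) := by
      ext u
      simp [Function.update_of_ne h]
    rw [this, Derivation.map_algebraMap]
    rfl

theorem rightField_gen (e e' : E) (x : lieAlg k G) (f : coord k G) :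
    rightField e x (gen e' f) = if e' = e then gen e' (rightDer x f) else 0 := by
  ext g
  rw [rightField_apply]
  split_ifs with h
  · subst h
    have : pull (fun u => Function.update g e' (u * g e')) (update_regular g e'
        (IsRegularMap.id.mul (IsRegularMap.const (g e')))) (gen e' f) =
        rightTranslate (g e') f := by
      ext u
      simp
    rw [this]
    rfl
  · have : pull (fun u => Function.update g e (u * g e)) (update_regular g e
        (IsRegularMap.id.mul (IsRegularMap.const (g e)))) (gen e' f) =
        algebraMap k (coord k G) (f.1 (g e')) := by
      ext u
      simp [Function.update_of_ne h]
    rw [this, Derivation.map_algebraMap]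
    rfl

/-- At a point `g`, the left-invariant field of `x` is the right-invariant field of
`Ad(g e) x`. -/
theorem leftField_eq_rightField (e : E) (x : lieAlg k G) (F : coordPow k G E) (g : E → G) :
    (leftField e x F).1 g = (rightField e (push (conjAut k G (g e)) x) F).1 g := by
  rw [leftField_apply, rightField_apply, push_apply_one, lieAlg_apply]
  refine congrArg (fun f : coord k G => (x.1 f).1 1) ?_
  ext u
  simp

/-- `halfEdgeField` as a linear map in the element of `𝔤`. -/
def halfEdgeLin (κ : E → AlgAut k G) (α : HalfEdge E) :
    lieAlg k G →ₗ[k] Derivation k (coordPow k G E) (coordPow k G E) where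
  toFun x := halfEdgeField κ x α
  map_add' x y := by
    cases α with
    | inl e =>
      refine derivation_ext_gen fun e' f => ?_
      simp only [halfEdgeField, leftField_gen, map_add, Derivation.add_apply]
      split_ifs
      · rfl
      · simp
    | inr e =>
      refine derivation_ext_gen fun e' f => ?_
      simp only [halfEdgeField, rightField_gen, Derivation.neg_apply, Derivation.add_apply]
      split_ifs
      · rw [← neg_add]
        rfl
      · simp
  map_smul' c x := by
    cases α with
    | inl e =>
      refine derivation_ext_gen fun e' f => ?_
      simp only [halfEdgeField, leftField_gen, map_smul, Derivation.smul_apply, RingHom.id_apply]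
      split_ifs
      · rfl
      · simp
    | inr e =>
      refine derivation_ext_gen fun e' f => ?_
      simp only [halfEdgeField, rightField_gen, Derivation.neg_apply, Derivation.smul_apply,
        RingHom.id_apply]
      split_ifs
      · rw [smul_neg]
        rfl
      · simp

/-- The derivation of `𝒪(G)` that `x(α)` induces on the copy of `G` it moves. -/
def halfEdgeDer (κ : E → AlgAut k G) (x : lieAlg k G) : HalfEdge E → coord k G → coord k G
  | Sum.inl e => fun f => (push (κ e) x).1 f
  | Sum.inr _ => fun f => -rightDer x f

theorem halfEdgeField_gen (κ : E → AlgAut k G) (x : lieAlg k G) (α : HalfEdge E) (e' : E)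
    (f : coord k G) : halfEdgeField κ x α (gen e' f) =
      if e' = Sum.elim id id α then gen e' (halfEdgeDer κ x α f) else 0 := by
  cases α with
  | inl e => exact leftField_gen e e' _ f
  | inr e =>
    show -rightField e x (gen e' f) = _
    rw [rightField_gen]
    by_cases h : e' = e
    · rw [if_pos h, if_pos (by exact h)]
      exact (map_neg _ _).symm
    · rw [if_neg h, if_neg (by exact h), neg_zero]

theorem rightDer_neg (x : lieAlg k G) (f : coord k G) : rightDer x (-f) = -rightDer x f := by
  ext g
  simp

/-- The vector fields of different half-edges commute, and those of one half-edge represent `𝔤`. -/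
theorem halfEdgeField_lie (κ : E → AlgAut k G) (x y : lieAlg k G) (α β : HalfEdge E) :
    ⁅halfEdgeField κ x α, halfEdgeField κ y β⁆ =
      if α = β then halfEdgeField κ ⁅x, y⁆ α else 0 := by
  refine derivation_ext_gen fun e' f => ?_
  rw [Derivation.commutator_apply, halfEdgeField_gen, halfEdgeField_gen]
  by_cases hα : e' = Sum.elim id id α
  · by_cases hβ : e' = Sum.elim id id β
    · rw [if_pos hα, if_pos hβ, halfEdgeField_gen, halfEdgeField_gen, if_pos hα, if_pos hβ,
        ← map_sub]
      rcases α with a | a <;> rcases β with b | b <;> simp only [Sum.elim_inl, Sum.elim_inr, id]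
        at hα hβ <;> subst hα <;> subst hβ
      · rw [if_pos rfl, halfEdgeField_gen, if_pos (by rfl)]
        simp only [halfEdgeDer, push_lie]
        rfl
      · rw [if_neg (by simp)]
        simp [halfEdgeDer, rightDer_comm]
      · rw [if_neg (by simp)]
        simp [halfEdgeDer, rightDer_comm]
      · rw [if_pos rfl, halfEdgeField_gen, if_pos (by rfl)]
        simp only [halfEdgeDer, rightDer_neg, neg_neg]
        rw [rightDer_lie]
        congr 1
        ext g
        simp only [rightDer_apply, LieSubalgebra.coe_bracket, NegMemClass.coe_neg, Pi.neg_apply]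
        rw [← lie_skew, Derivation.neg_apply]
        rfl
    · have hne : α ≠ β := fun h => hβ (h ▸ hα)
      rw [if_neg hβ, if_pos hα, halfEdgeField_gen, if_neg hβ, if_neg hne]
      simp
  · by_cases hβ : e' = Sum.elim id id β
    · have hne : α ≠ β := fun h => hα (h ▸ hβ)
      rw [if_pos hβ, if_neg hα, halfEdgeField_gen, if_neg hα, if_neg hne]
      simp
    · rw [if_neg hβ, if_neg hα]
      split_ifs with h
      · rw [halfEdgeField_gen, if_neg hα]
        simp
      · simp

/-- The two halves of an edge carry opposite fields, up to `Ad(g e) ∘ κ e`. -/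
theorem halfEdgeField_inl (κ : E → AlgAut k G) (x : lieAlg k G) (e : E) (F : coordPow k G E)
    (g : E → G) : (halfEdgeField κ x (Sum.inl e) F).1 g =
      -(halfEdgeField κ (push (conjAut k G (g e) * κ e) x) (Sum.inr e) F).1 g := by
  rw [push_mul]
  show (leftField e (push (κ e) x) F).1 g =
    -(-(rightField e (push (conjAut k G (g e)) (push (κ e) x)) F).1 g)
  rw [leftField_eq_rightField, neg_neg]

end Fields

/-! ### Connected groups: invariance under the Lie algebra and under the group -/

section Abstract

variable {k A : Type*} [Field k] [CommRing A] [Algebra k A]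

theorem sum_smul_derivation_apply {ι : Type*} (s : Finset ι) (t : ι → A)
    (D : ι → Derivation k A A) (a : A) : (∑ i ∈ s, t i • D i) a = ∑ i ∈ s, t i * D i a := by
  classical
  induction s using Finset.induction_on with
  | empty => simp
  | insert i s hi ih => simp [Finset.sum_insert hi, ih]

/-- If a derivation `D` acts like the Euler field of the ideal `m`, i.e. as the identity on
`m / m ^ 2`, then it acts as multiplication by `n` on `m ^ n / m ^ (n + 1)`. -/
theorem euler_pow {m : Ideal A} {D : Derivation k A A} (hDm : ∀ a, D a ∈ m)
    (hD1 : ∀ a ∈ m, D a - a ∈ m ^ 2) (n : ℕ) : ∀ a ∈ m ^ n, D a - (n : A) * a ∈ m ^ (n + 1) := by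
  induction n with
  | zero =>
    intro a _
    simpa using hDm a
  | succ n ih =>
    intro a ha
    rw [pow_succ'] at ha
    refine Submodule.mul_induction_on ha (fun b hb c hc => ?_) (fun b c hb hc => ?_)
    · have : D (b * c) - ((n + 1 : ℕ) : A) * (b * c) =
          b * (D c - (n : A) * c) + (D b - b) * c := by
        rw [Derivation.leibniz]
        simp only [smul_eq_mul]
        push_cast
        ring
      rw [this]
      refine add_mem ?_ ?_
      · rw [pow_succ' m (n + 1)]
        exact Ideal.mul_mem_mul hb (ih c hc)
      · rw [show n + 1 + 1 = 2 + n by ring, pow_add]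
        exact Ideal.mul_mem_mul (hD1 b hb) hc
    · have : D (b + c) - ((n + 1 : ℕ) : A) * (b + c) =
          (D b - ((n + 1 : ℕ) : A) * b) + (D c - ((n + 1 : ℕ) : A) * c) := by
        rw [map_add]
        ring
      rw [this]
      exact add_mem hb hc

/-- A function of `m` killed by an Euler field of `m` is zero: it lies in every power of `m`, and
these have zero intersection by Krull's theorem. -/
theorem eq_zero_of_euler_eq_zero [CharZero k] [IsDomain A] [IsNoetherianRing A] {m : Ideal A}
    (hm : m ≠ ⊤) {D : Derivation k A A} (hDm : ∀ a, D a ∈ m)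
    (hD1 : ∀ a ∈ m, D a - a ∈ m ^ 2) {f : A} (hfm : f ∈ m) (hf : D f = 0) : f = 0 := by
  have hmem : ∀ n : ℕ, f ∈ m ^ (n + 1) := by
    intro n
    induction n with
    | zero => simpa using hfm
    | succ n ih =>
      have h := euler_pow hDm hD1 (n + 1) f ih
      rw [hf, zero_sub, neg_mem_iff] at h
      have h2 := (m ^ (n + 1 + 1)).mul_mem_left (algebraMap k A (((n + 1 : ℕ) : k)⁻¹)) h
      rwa [← mul_assoc, ← map_natCast (algebraMap k A), ← map_mul,
        inv_mul_cancel₀ (Nat.cast_ne_zero.mpr n.succ_ne_zero), map_one, one_mul] at h2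
  have hbot : f ∈ (⨅ n : ℕ, m ^ n : Ideal A) := by
    rw [Submodule.mem_iInf]
    intro n
    exact Ideal.pow_le_pow_right (Nat.le_succ n) (hmem n)
  rwa [Ideal.iInf_pow_eq_bot_of_isDomain m hm] at hbot

/-- A tensor is determined by its matrix coefficients. -/
theorem tensor_ext_dual {V : Type*} [AddCommGroup V] [Module k V] [Module.Finite k V]
    {t t' : V ⊗[k] V}
    (h : ∀ θ η : Module.Dual k V, TensorProduct.dualDistrib k V V (θ ⊗ₜ η) t =
      TensorProduct.dualDistrib k V V (θ ⊗ₜ η) t') : t = t' := by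
  let b := Module.finBasis k V
  apply (b.tensorProduct b).ext_elem
  rintro ⟨i, j⟩
  have key : ∀ t, (b.tensorProduct b).repr t (i, j) =
      TensorProduct.dualDistrib k V V (b.coord i ⊗ₜ b.coord j) t := by
    intro t
    induction t using TensorProduct.induction_on with
    | zero => simp
    | tmul u v => simp [mul_comm]
    | add u v hu hv => simp only [map_add, Finsupp.add_apply, hu, hv]
  rw [key, key, h]

/-- This and the next two lemmas are instances of `map_sum` that spare the unifier a search
through the layers of subtypes below `lieAlg` and `coordPow`. -/
theorem coe_sum_apply {Y ι : Type*} {B : Subalgebra k (Y → k)} (s : Finset ι) (F : ι → B)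
    (y : Y) : (∑ i ∈ s, F i).1 y = ∑ i ∈ s, (F i).1 y :=
  map_sum (evalAt B y) F s

theorem derivation_map_sum {ι : Type*} (D : Derivation k A A) (s : Finset ι) (F : ι → A) :
    D (∑ i ∈ s, F i) = ∑ i ∈ s, D (F i) :=
  map_sum D F s

theorem linearMap_map_sum {V W ι : Type*} [AddCommGroup V] [Module k V] [AddCommGroup W]
    [Module k W] (D : V →ₗ[k] W) (s : Finset ι) (F : ι → V) :
    D (∑ i ∈ s, F i) = ∑ i ∈ s, D (F i) :=
  map_sum D F s

theorem dual_apply_eq_sum {V : Type*} [AddCommGroup V] [Module k V] [Module.Finite k V]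
    (θ : Module.Dual k V) (X : V) :
    θ X = ∑ j, (Module.finBasis k V).coord j X * θ (Module.finBasis k V j) := by
  conv_lhs => rw [← (Module.finBasis k V).sum_repr X, map_sum]
  simp only [map_smul, smul_eq_mul, Module.Basis.coord_apply]

/-- A `𝔤`-invariant tensor is constant under a family of linear maps `Ad y` of a Lie algebra `𝔤`
whose matrix coefficients satisfy the differential equation of the adjoint representation, if the
functions killed by `𝔤` are constant. -/
theorem map_tensor_eq_of_lie_eq_zero {L Y : Type*} [LieRing L] [LieAlgebra k L]
    [Module.Finite k L] {B : Subalgebra k (Y → k)} (D : L → Derivation k B B) (Ad : Y → L →ₗ[k] L)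
    (c : Module.Dual k L → L → B) (hc : ∀ θ x y, (c θ x).1 y = θ (Ad y x))
    (hD : ∀ θ x z y, (D z (c θ x)).1 y = -θ ⁅z, Ad y x⁆)
    (hconst : ∀ F : B, (∀ z, D z F = 0) → ∀ y y', F.1 y = F.1 y') {t : L ⊗[k] L}
    (ht : ∀ y z, ⁅(z : L), TensorProduct.map (Ad y) (Ad y) t⁆ = 0) (y y' : Y) :
    TensorProduct.map (Ad y) (Ad y) t = TensorProduct.map (Ad y') (Ad y') t := by
  refine tensor_ext_dual fun θ η => ?_
  obtain ⟨s, hs⟩ := TensorProduct.exists_finset t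
  let F : B := ∑ p ∈ s, c θ p.1 * c η p.2
  have hF : ∀ u, F.1 u = TensorProduct.dualDistrib k L L (θ ⊗ₜ η)
      (TensorProduct.map (Ad u) (Ad u) t) := by
    intro u
    rw [hs, linearMap_map_sum, linearMap_map_sum, coe_sum_apply]
    refine Finset.sum_congr rfl fun p _ => ?_
    rw [TensorProduct.map_tmul, TensorProduct.dualDistrib_apply, ← hc, ← hc]
    rfl
  rw [← hF, ← hF]
  refine hconst F (fun z => Subtype.ext (funext fun u => ?_)) y y'
  have h1 := congrArg (TensorProduct.dualDistrib k L L (θ ⊗ₜ η)) (ht u z)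
  rw [hs, linearMap_map_sum, lie_sum, linearMap_map_sum, LinearMap.map_zero] at h1
  show (D z F).1 u = 0
  rw [derivation_map_sum, coe_sum_apply, ← neg_eq_zero, ← h1, ← Finset.sum_neg_distrib]
  refine Finset.sum_congr rfl fun p _ => ?_
  rw [TensorProduct.map_tmul, TensorProduct.LieModule.lie_tmul_right, LinearMap.map_add,
    TensorProduct.dualDistrib_apply, TensorProduct.dualDistrib_apply, Derivation.leibniz]
  show -((c θ p.1).1 u * (D z (c η p.2)).1 u + (c η p.2).1 u * (D z (c θ p.1)).1 u) = _
  rw [hD, hD, hc, hc]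
  ring

/-- Automorphisms of a Lie algebra preserve its invariant tensors. -/
theorem lie_map_eq_zero {L : Type*} [LieRing L] [LieAlgebra k L] (f g : L →ₗ[k] L)
    (hf : ∀ x y, f ⁅x, y⁆ = ⁅f x, f y⁆) (hfg : ∀ y, f (g y) = y) {t : L ⊗[k] L}
    (ht : ∀ y : L, ⁅y, t⁆ = 0) (y : L) : ⁅y, TensorProduct.map f f t⁆ = 0 := by
  have key : ∀ t : L ⊗[k] L, TensorProduct.map f f ⁅g y, t⁆ = ⁅y, TensorProduct.map f f t⁆ := by
    intro t
    induction t using TensorProduct.induction_on with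
    | zero => simp
    | tmul u v => simp [TensorProduct.LieModule.lie_tmul_right, hf, hfg]
    | add u v hu hv => simp only [lie_add, map_add, hu, hv]
  rw [← key, ht, map_zero]

end Abstract

section Connected

variable {k G : Type*} [Field k] [Group G] [AffineAlgebraicGroup k G]

/-- The maximal ideal of the unit. -/
def unitIdeal (k G : Type*) [Field k] [Group G] [AffineAlgebraicGroup k G] :
    Ideal (coord k G) where
  carrier := {f | f.1 1 = 0}
  add_mem' := by
    intro a b ha hb
    show a.1 1 + b.1 1 = 0
    rw [show a.1 1 = 0 from ha, show b.1 1 = 0 from hb, add_zero]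
  zero_mem' := rfl
  smul_mem' := by
    intro c a ha
    show c.1 1 * a.1 1 = 0
    rw [show a.1 1 = 0 from ha, mul_zero]

theorem mem_unitIdeal {f : coord k G} : f ∈ unitIdeal k G ↔ f.1 1 = 0 := Iff.rfl

/-- The differential at the unit: `f ↦ (X ↦ (X f) 1)`. -/
def differential (k G : Type*) [Field k] [Group G] [AffineAlgebraicGroup k G] :
    coord k G →ₗ[k] Module.Dual k (lieAlg k G) :=
  LinearMap.mk₂ k (fun f X => (X.1 f).1 1) (fun f f' X => by simp) (fun c f X => by simp)
    (fun f X X' => by simp) (fun c f X => by simp)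

@[simp] theorem differential_apply (f : coord k G) (X : lieAlg k G) :
    differential k G f X = (X.1 f).1 1 := rfl

theorem differential_surjective [Module.Finite k (lieAlg k G)] :
    Function.Surjective (differential k G) := by
  have h : Function.Injective (differential k G).flip := by
    intro X X' h
    exact lieAlg_ext fun f => LinearMap.congr_fun h f
  exact LinearMap.flip_injective_iff₂.mp h

/-- The cotangent space at the unit is `𝔪 / 𝔪²`: every linear form on `𝔪 / 𝔪²` extends to a
left-invariant derivation. -/
theorem mem_sq_of_differential_eq_zero {f : coord k G} (hf : f ∈ unitIdeal k G)
    (h : differential k G f = 0) : f ∈ unitIdeal k G ^ 2 := by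
  by_contra hn
  let P : Submodule k (coord k G) := Submodule.span k {1} ⊔ (unitIdeal k G ^ 2).restrictScalars k
  have hP : f ∉ P := by
    intro hfP
    obtain ⟨a, ha, b, hb, hab⟩ := Submodule.mem_sup.mp hfP
    obtain ⟨c, rfl⟩ := Submodule.mem_span_singleton.mp ha
    have hb1 : b.1 1 = 0 := Ideal.pow_le_self two_ne_zero hb
    have h1 := congrArg (fun F : coord k G => F.1 1) hab
    simp [hb1, mem_unitIdeal.mp hf] at h1
    rw [h1, zero_smul, zero_add] at hab
    exact hn (hab ▸ hb)
  obtain ⟨d, hd, hdP⟩ := Submodule.exists_le_ker_of_notMem hP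
  have h1 : d 1 = 0 := hdP (Submodule.mem_sup_left (Submodule.mem_span_singleton_self 1))
  have hpt : IsPointDer (1 : G) d := by
    constructor
    intro F F'
    have hF : ∀ F : coord k G, F - F.1 1 • (1 : coord k G) ∈ unitIdeal k G := by
      intro F
      simp [mem_unitIdeal]
    have h2 : d ((F - F.1 1 • (1 : coord k G)) * (F' - F'.1 1 • (1 : coord k G))) = 0 := by
      apply hdP
      refine Submodule.mem_sup_right ?_
      show _ ∈ unitIdeal k G ^ 2
      rw [pow_two]
      exact Ideal.mul_mem_mul (hF F) (hF F')
    have h3 : (F - F.1 1 • (1 : coord k G)) * (F' - F'.1 1 • (1 : coord k G)) =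
        F * F' - F.1 1 • F' - F'.1 1 • F + (F.1 1 * F'.1 1) • (1 : coord k G) := by
      ext u
      simp
      ring
    rw [h3] at h2
    simp only [map_add, map_sub, map_smul, h1, smul_eq_mul] at h2
    linear_combination h2
  apply hd
  have := LinearMap.congr_fun h (lieOfPoint d hpt)
  simpa [show leftTranslate (1 : G) f = f by ext u; simp] using this

/-- On a connected group in characteristic zero, a function killed by `𝔤` is constant. With
coordinates `t i` at the unit and the dual elements `x i` of `𝔤`, the Euler field
`∑ i, t i • x i` acts as multiplication by `n` on `𝔪 ^ n / 𝔪 ^ (n + 1)`, so that a function in `𝔪`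
killed by `𝔤` lies in every power of `𝔪`. -/
theorem eq_const_of_lieAlg_eq_zero [CharZero k] [Module.Finite k (lieAlg k G)]
    (hG : IsConnected k G) {f : coord k G} (hf : ∀ X : lieAlg k G, X.1 f = 0) (g : G) :
    f.1 g = f.1 1 := by
  have : IsDomain (coord k G) := hG
  have : IsNoetherianRing (coord k G) :=
    isNoetherianRing_of_fg (AffineAlgebraicGroup.coord_fg (k := k) (G := G))
  let m := unitIdeal k G
  let x := Module.finBasis k (lieAlg k G)
  have ht : ∀ i, ∃ t ∈ m, differential k G t = x.coord i := by
    intro i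
    obtain ⟨t, ht⟩ := differential_surjective (x.coord i)
    refine ⟨t - algebraMap k _ (t.1 1), ?_, ?_⟩
    · show t.1 1 - t.1 1 = 0
      exact sub_self _
    · rw [map_sub, ht, sub_eq_self]
      ext X
      simp
  choose t htm ht using ht
  let D : Derivation k (coord k G) (coord k G) := ∑ i, t i • (x i).1
  have hD : ∀ a, D a = ∑ i, t i * (x i).1 a :=
    sum_smul_derivation_apply Finset.univ t fun i => (x i).1
  have hDm : ∀ a, D a ∈ m := by
    intro a
    rw [hD]
    exact sum_mem fun i _ => Ideal.mul_mem_right _ _ (htm i)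
  have hD1 : ∀ a ∈ m, D a - a ∈ m ^ 2 := by
    intro a ha
    refine mem_sq_of_differential_eq_zero (sub_mem (hDm a) ha) ?_
    rw [LinearMap.map_sub, sub_eq_zero]
    refine x.ext fun j => ?_
    have h1 : ∀ i, ((x j).1 (t i * (x i).1 a)).1 1 =
        if i = j then ((x j).1 a).1 1 else 0 := by
      intro i
      have h2 : ((x j).1 (t i)).1 1 = if i = j then 1 else 0 := by
        rw [← differential_apply, ht, Module.Basis.coord_apply, Module.Basis.repr_self,
          Finsupp.single_apply]
        simp [eq_comm]
      have h3 : (t i).1 1 = 0 := htm i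
      rw [Derivation.leibniz]
      show (t i).1 1 * _ + ((x i).1 a).1 1 * ((x j).1 (t i)).1 1 = _
      rw [h2, h3]
      split_ifs with h
      · subst h
        simp
      · simp
    rw [hD, differential_apply, derivation_map_sum, coe_sum_apply,
      Finset.sum_congr rfl fun i _ => h1 i,
      Finset.sum_ite_eq' Finset.univ j, if_pos (Finset.mem_univ j), differential_apply]
  have hm : m ≠ ⊤ := by
    rw [Ne, Ideal.eq_top_iff_one]
    exact one_ne_zero
  have h0 : f - algebraMap k (coord k G) (f.1 1) = 0 := by
    refine eq_zero_of_euler_eq_zero hm hDm hD1 ?_ ?_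
    · show f.1 1 - f.1 1 = 0
      exact sub_self _
    · rw [hD]
      refine Finset.sum_eq_zero fun i _ => ?_
      rw [map_sub, hf, Derivation.map_algebraMap, sub_zero, mul_zero]
  have := congrArg (fun F : coord k G => F.1 g) h0
  exact sub_eq_zero.mp this

/-- The matrix coefficient `h ↦ θ (Ad(h⁻¹) x)` of the adjoint representation. -/
def adCoeff [Module.Finite k (lieAlg k G)] (θ : Module.Dual k (lieAlg k G)) (x : lieAlg k G) :
    coord k G :=
  ⟨fun h => θ (push (conjAut k G h⁻¹) x), by
    obtain ⟨f, rfl⟩ := differential_surjective θ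
    obtain ⟨s, hs⟩ := exists_comul f
    choose s' hs' using fun p : coord k G × coord k G => exists_comul p.2
    have : (fun h => differential k G f (push (conjAut k G h⁻¹) x)) =
        ∑ p ∈ s, ∑ q ∈ s' p, (x.1 q.1).1 1 • ((fun h => p.1.1 h⁻¹) * q.2.1) := by
      funext h
      rw [differential_apply, push_apply_one]
      have h2 : pullOne (fun u => (conjAut k G h⁻¹).1 u) (conjAut k G h⁻¹).2.1 f =
          ∑ p ∈ s, ∑ q ∈ s' p, (p.1.1 h⁻¹ * q.2.1 h) • q.1 := by
        ext u
        rw [pullOne_apply, conjAut_apply, inv_inv, mul_assoc, hs, coe_sum_apply]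
        refine Finset.sum_congr rfl fun p _ => ?_
        rw [coe_sum_apply, hs', Finset.mul_sum]
        refine Finset.sum_congr rfl fun q _ => ?_
        show _ = p.1.1 h⁻¹ * q.2.1 h * q.1.1 u
        ring
      rw [h2, derivation_map_sum, coe_sum_apply, Finset.sum_apply]
      refine Finset.sum_congr rfl fun p _ => ?_
      rw [derivation_map_sum, coe_sum_apply, Finset.sum_apply]
      refine Finset.sum_congr rfl fun q _ => ?_
      rw [Derivation.map_smul]
      show p.1.1 h⁻¹ * q.2.1 h * (x.1 q.1).1 1 = (x.1 q.1).1 1 * (p.1.1 h⁻¹ * q.2.1 h)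
      ring
    rw [this]
    exact sum_mem fun p _ => sum_mem fun q _ => (coord k G).smul_mem
      ((coord k G).mul_mem (AffineAlgebraicGroup.inv_regular _ p.1.2) q.2.2) _⟩

@[simp] theorem adCoeff_apply [Module.Finite k (lieAlg k G)] (θ : Module.Dual k (lieAlg k G))
    (x : lieAlg k G) (h : G) : (adCoeff θ x).1 h = θ (push (conjAut k G h⁻¹) x) := rfl

/-- At a point `h`, the right-invariant field of `x` is the left-invariant field of `Ad(h⁻¹) x`.
-/
theorem rightDer_eq_ad (x : lieAlg k G) (f : coord k G) (h : G) :
    (rightDer x f).1 h = ((push (conjAut k G h⁻¹) x).1 f).1 h := by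
  rw [lieAlg_apply (push (conjAut k G h⁻¹) x) f h, push_apply_one, rightDer_apply]
  refine congrArg (fun f : coord k G => (x.1 f).1 1) (Subtype.ext (funext fun u => ?_))
  rw [rightTranslate_apply, pullOne_apply, leftTranslate_apply, conjAut_apply]
  group

/-- The value at `h` of the derivative of `f`, as a linear form on `𝔤`. -/
def evalLie (f : coord k G) (h : G) : Module.Dual k (lieAlg k G) where
  toFun X := (X.1 f).1 h
  map_add' _ _ := rfl
  map_smul' _ _ := rfl

@[simp] theorem evalLie_apply (f : coord k G) (h : G) (X : lieAlg k G) :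
    evalLie f h X = (X.1 f).1 h := rfl

set_option maxHeartbeats 1000000 in
/-- The differential of the adjoint representation is the bracket. This expresses that left-
and right-invariant vector fields commute. -/
theorem lieAlg_apply_adCoeff [Module.Finite k (lieAlg k G)] (θ : Module.Dual k (lieAlg k G))
    (x y : lieAlg k G) (h : G) :
    (y.1 (adCoeff θ x)).1 h = -θ ⁅y, push (conjAut k G h⁻¹) x⁆ := by
  let b := Module.finBasis k (lieAlg k G)
  let c := fun j => adCoeff (b.coord j) x
  have hR : ∀ f : coord k G, rightDer x f = ∑ j, c j * (b j).1 f := by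
    intro f
    ext u
    rw [rightDer_eq_ad, ← evalLie_apply, dual_apply_eq_sum, coe_sum_apply]
    rfl
  let Z : lieAlg k G := ∑ j, (y.1 (c j)).1 h • b j
  have hZ : Z + ⁅y, push (conjAut k G h⁻¹) x⁆ = 0 := by
    refine lieAlg_ext_at h fun f => ?_
    have h1 := congrArg (fun F : coord k G => F.1 h) (rightDer_comm y x f)
    simp only [hR f, hR (y.1 f), derivation_map_sum, coe_sum_apply] at h1
    have hterm : ∀ j, (y.1 (c j * (b j).1 f)).1 h =
        (c j).1 h * (y.1 ((b j).1 f)).1 h + (y.1 (c j)).1 h * ((b j).1 f).1 h := by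
      intro j
      rw [Derivation.leibniz]
      show (c j).1 h * _ + ((b j).1 f).1 h * (y.1 (c j)).1 h = _
      ring
    rw [Finset.sum_congr rfl fun j _ => hterm j, Finset.sum_add_distrib] at h1
    have h2 : evalLie f h Z = ∑ j, (y.1 (c j)).1 h * ((b j).1 f).1 h := by
      rw [linearMap_map_sum]
      exact Finset.sum_congr rfl fun j _ => LinearMap.map_smul _ _ _
    have h3 : evalLie (y.1 f) h (push (conjAut k G h⁻¹) x) =
        ∑ j, (c j * (b j).1 (y.1 f)).1 h := dual_apply_eq_sum _ _
    have h5 : (y.1 ((push (conjAut k G h⁻¹) x).1 f)).1 h =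
        ∑ j, (c j).1 h * (y.1 ((b j).1 f)).1 h :=
      dual_apply_eq_sum
        { toFun := fun X : lieAlg k G => (y.1 (X.1 f)).1 h
          map_add' := fun X X' =>
            congrArg (fun F : coord k G => F.1 h) (map_add y.1 (X.1 f) (X'.1 f))
          map_smul' := fun a X =>
            congrArg (fun F : coord k G => F.1 h) (y.1.map_smul a (X.1 f)) } _
    have h6 : evalLie f h ⁅y, push (conjAut k G h⁻¹) x⁆ =
        (y.1 ((push (conjAut k G h⁻¹) x).1 f)).1 h -
          evalLie (y.1 f) h (push (conjAut k G h⁻¹) x) := by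
      rw [evalLie_apply, LieSubalgebra.coe_bracket, Derivation.commutator_apply]
      rfl
    show evalLie f h (Z + ⁅y, push (conjAut k G h⁻¹) x⁆) = 0
    rw [LinearMap.map_add, h6, h2, h3, h5, ← h1]
    ring
  have hθ : ∀ j, (y.1 (c j)).1 h = -b.coord j ⁅y, push (conjAut k G h⁻¹) x⁆ := by
    intro j
    rw [← LinearMap.map_neg, ← eq_neg_of_add_eq_zero_left hZ, linearMap_map_sum]
    simp only [LinearMap.map_smul, Module.Basis.coord_apply, Module.Basis.repr_self,
      Finsupp.single_apply, smul_eq_mul, mul_ite, mul_one, mul_zero]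
    rw [Finset.sum_ite_eq' Finset.univ j, if_pos (Finset.mem_univ j)]
  have hsum : adCoeff θ x = ∑ j, θ (b j) • c j := by
    ext u
    rw [adCoeff_apply, dual_apply_eq_sum, coe_sum_apply]
    exact Finset.sum_congr rfl fun j _ => mul_comm _ _
  rw [hsum, derivation_map_sum, dual_apply_eq_sum θ, ← Finset.sum_neg_distrib, coe_sum_apply]
  refine Finset.sum_congr rfl fun j _ => ?_
  rw [Derivation.map_smul]
  show θ (b j) * (y.1 (c j)).1 h = _
  rw [hθ j]
  show _ = -(b.coord j _ * θ (b j))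
  ring

theorem map_push_mul (a b : AlgAut k G) (t : lieAlg k G ⊗[k] lieAlg k G) :
    TensorProduct.map (push (a * b)) (push (a * b)) t =
      TensorProduct.map (push a) (push a) (TensorProduct.map (push b) (push b) t) := by
  rw [show (push (a * b) : lieAlg k G →ₗ[k] lieAlg k G) = push a ∘ₗ push b from
    LinearMap.ext (push_mul a b), TensorProduct.map_comp, LinearMap.comp_apply]

/-- For a connected group in characteristic zero, a `𝔤`-invariant tensor is `G`-invariant. -/
theorem map_push_conjAut_of_lie_eq_zero [CharZero k] [Module.Finite k (lieAlg k G)]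
    (hG : IsConnected k G) {t : lieAlg k G ⊗[k] lieAlg k G} (ht : ∀ y : lieAlg k G, ⁅y, t⁆ = 0)
    (h : G) : TensorProduct.map (push (conjAut k G h)) (push (conjAut k G h)) t = t := by
  have hinv : ∀ (u : G) (y : lieAlg k G),
      ⁅y, TensorProduct.map (push (conjAut k G u⁻¹)) (push (conjAut k G u⁻¹)) t⁆ = 0 := by
    intro u y
    refine lie_map_eq_zero _ (push (conjAut k G u)) (push_lie _) (fun y => ?_) ht y
    rw [← push_mul, ← map_mul, inv_mul_cancel, map_one, push_one]
  have key := map_tensor_eq_of_lie_eq_zero (fun y : lieAlg k G => y.1)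
    (fun u => push (conjAut k G u⁻¹)) adCoeff adCoeff_apply lieAlg_apply_adCoeff
    (fun F hF g g' => (eq_const_of_lieAlg_eq_zero hG hF g).trans
      (eq_const_of_lieAlg_eq_zero hG hF g').symm) hinv h⁻¹ 1
  have h1 : (push (conjAut k G (1 : G)⁻¹) : lieAlg k G →ₗ[k] lieAlg k G) = LinearMap.id := by
    rw [inv_one, map_one]
    exact LinearMap.ext push_one
  simp only [inv_inv] at key
  rw [key, h1, TensorProduct.map_id, LinearMap.id_apply]

end Connected

/-! ### Brackets of bivectors and the classical Yang-Baxter equation -/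

section Bivectors

variable {k A L : Type*} [Field k] [CommRing A] [Algebra k A] [LieRing L] [LieAlgebra k L]

/-- The linear form `a ⊗ b ↦ u a * v b`. -/
noncomputable def ev₂ {V : Type*} [AddCommGroup V] [Module k V] (u v : V →ₗ[k] A) :
    V ⊗[k] V →ₗ[k] A :=
  LinearMap.mul' k A ∘ₗ TensorProduct.map u v

@[simp] theorem ev₂_tmul {V : Type*} [AddCommGroup V] [Module k V] (u v : V →ₗ[k] A) (a b : V) :
    ev₂ u v (a ⊗ₜ b) = u a * v b := by
  simp [ev₂]

/-- The linear form `a ⊗ b ⊗ c ↦ u a * v b * w c`. -/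
noncomputable def ev₃ {V : Type*} [AddCommGroup V] [Module k V] (u v w : V →ₗ[k] A) :
    V ⊗[k] (V ⊗[k] V) →ₗ[k] A :=
  LinearMap.mul' k A ∘ₗ TensorProduct.map u (ev₂ v w)

@[simp] theorem ev₃_tmul {V : Type*} [AddCommGroup V] [Module k V] (u v w : V →ₗ[k] A)
    (a b c : V) : ev₃ u v w (a ⊗ₜ (b ⊗ₜ c)) = u a * (v b * w c) := by
  simp [ev₃]

theorem tensor_eq_sum {V ι : Type*} [AddCommGroup V] [Module k V] [Fintype ι]
    (x : Module.Basis ι k V) (t : V ⊗[k] V) :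
    t = ∑ i, ∑ j, (x.tensorProduct x).repr t (i, j) • (x i ⊗ₜ[k] x j) := by
  conv_lhs => rw [← (x.tensorProduct x).sum_repr t]
  rw [Fintype.sum_prod_type]
  simp

@[simp] theorem bracket1213_tmul (a b c d : L) :
    bracket1213 (k := k) ((a ⊗ₜ b) ⊗ₜ (c ⊗ₜ d)) = ⁅a, c⁆ ⊗ₜ (b ⊗ₜ d) := rfl

@[simp] theorem bracket1223_tmul (a b c d : L) :
    bracket1223 (k := k) ((a ⊗ₜ b) ⊗ₜ (c ⊗ₜ d)) = a ⊗ₜ (⁅b, c⁆ ⊗ₜ d) := rfl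

@[simp] theorem bracket1323_tmul (a b c d : L) :
    bracket1323 (k := k) ((a ⊗ₜ b) ⊗ₜ (c ⊗ₜ d)) = a ⊗ₜ (c ⊗ₜ ⁅b, d⁆) := rfl

/-- The Jacobiator of the bracket of an antisymmetric matrix `M` and derivations `D`: the second
derivatives cancel. -/
theorem jacobiator_eq {I : Type*} [Fintype I] (D : I → Derivation k A A) (M : I → I → k)
    (hM : ∀ p q, M p q = -M q p) (B : A →ₗ[k] A →ₗ[k] A)
    (hB : ∀ f g, B f g = ∑ p, ∑ q, M p q • (D p f * D q g)) (f g h : A) :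
    B f (B g h) + B g (B h f) + B h (B f g) =
      (∑ p, ∑ q, ∑ r, ∑ s, (M p q * M r s) • (D p f * (⁅D q, D r⁆ g * D s h))) +
      (∑ p, ∑ q, ∑ r, ∑ s, (M p q * M r s) • (D p g * (⁅D q, D r⁆ h * D s f))) +
      (∑ p, ∑ q, ∑ r, ∑ s, (M p q * M r s) • (D p h * (⁅D q, D r⁆ f * D s g))) := by
  let S : A → A → A → A := fun f g h =>
    ∑ p, ∑ q, ∑ r, ∑ s, (M p q * M r s) • (D p f * (D q (D r g) * D s h))
  have hS : ∀ f g h, (∑ p, ∑ q, ∑ r, ∑ s, (M p q * M r s) • (D p f * (⁅D q, D r⁆ g * D s h))) =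
      S f g h - S h g f := by
    intro f g h
    -- reversing the order of the four indices exchanges the outer two arguments
    have h1 : S h g f = ∑ p, ∑ q, ∑ r, ∑ s, (M p q * M r s) • (D p f * (D r (D q g) * D s h)) := by
      calc S h g f = ∑ s, ∑ r, ∑ q, ∑ p, (M p q * M r s) • (D p f * (D r (D q g) * D s h)) := by
            refine Finset.sum_congr rfl fun s _ => Finset.sum_congr rfl fun r _ =>
              Finset.sum_congr rfl fun q _ => Finset.sum_congr rfl fun p _ => ?_
            rw [hM s r, hM q p, neg_mul_neg, mul_comm (M r s)]
            congr 1
            ring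
        _ = ∑ r, ∑ s, ∑ p, ∑ q, (M p q * M r s) • (D p f * (D r (D q g) * D s h)) := by
            rw [Finset.sum_comm]
            refine Finset.sum_congr rfl fun s _ => Finset.sum_congr rfl fun r _ => ?_
            rw [Finset.sum_comm]
        _ = ∑ r, ∑ p, ∑ s, ∑ q, (M p q * M r s) • (D p f * (D r (D q g) * D s h)) :=
            Finset.sum_congr rfl fun r _ => Finset.sum_comm
        _ = ∑ p, ∑ r, ∑ q, ∑ s, (M p q * M r s) • (D p f * (D r (D q g) * D s h)) := by
            rw [Finset.sum_comm]
            refine Finset.sum_congr rfl fun s _ => Finset.sum_congr rfl fun r _ => ?_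
            rw [Finset.sum_comm]
        _ = _ := Finset.sum_congr rfl fun p _ => Finset.sum_comm
    rw [h1]
    simp only [S, ← Finset.sum_sub_distrib, ← smul_sub, Derivation.commutator_apply]
    refine Finset.sum_congr rfl fun p _ => Finset.sum_congr rfl fun q _ =>
      Finset.sum_congr rfl fun r _ => Finset.sum_congr rfl fun s _ => ?_
    congr 1
    ring
  have hBB : ∀ f g h, B f (B g h) = S f g h - S f h g := by
    intro f g h
    have h1 : S f h g = -∑ p, ∑ q, ∑ r, ∑ s, (M p q * M r s) • (D p f * (D q (D s h) * D r g)) := by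
      simp only [← Finset.sum_neg_distrib]
      refine Finset.sum_congr rfl fun p _ => Finset.sum_congr rfl fun q _ => ?_
      rw [Finset.sum_comm]
      refine Finset.sum_congr rfl fun r _ => Finset.sum_congr rfl fun s _ => ?_
      rw [hM s r, mul_neg, neg_smul]
    rw [h1, sub_neg_eq_add, hB f, hB g]
    simp only [S, ← Finset.sum_add_distrib, ← smul_add, map_sum, Derivation.map_smul,
      Derivation.leibniz, Finset.mul_sum, Finset.smul_sum, smul_eq_mul, mul_smul_comm, smul_smul]
    refine Finset.sum_congr rfl fun p _ => Finset.sum_congr rfl fun q _ =>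
      Finset.sum_congr rfl fun r _ => Finset.sum_congr rfl fun s _ => ?_
    congr 1
    ring
  rw [hS, hS, hS, hBB, hBB, hBB]
  ring

section RMatrix

/-- The antisymmetric part of a tensor. -/
noncomputable def antisymmPart (r : L ⊗[k] L) : L ⊗[k] L :=
  (1 / 2 : k) • (r - TensorProduct.comm k L L r)

/-- Twice the symmetric part of a tensor. -/
noncomputable def symmPart (r : L ⊗[k] L) : L ⊗[k] L := r + TensorProduct.comm k L L r

theorem comm_comm (r : L ⊗[k] L) : TensorProduct.comm k L L (TensorProduct.comm k L L r) = r :=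
  (TensorProduct.comm k L L).symm_apply_apply r

theorem comm_antisymmPart (r : L ⊗[k] L) :
    TensorProduct.comm k L L (antisymmPart r) = -antisymmPart r := by
  rw [antisymmPart, map_smul, map_sub, comm_comm, ← smul_neg, neg_sub]

theorem comm_symmPart (r : L ⊗[k] L) :
    TensorProduct.comm k L L (symmPart r) = symmPart r := by
  rw [symmPart, map_add, comm_comm, add_comm]

theorem antisymmPart_add_symmPart [CharZero k] (r : L ⊗[k] L) :
    antisymmPart r + (1 / 2 : k) • symmPart r = r := by
  rw [antisymmPart, symmPart, ← smul_add, sub_add_add_cancel, ← two_smul k r, smul_smul]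
  norm_num

/-- `[t₁₂, u₁₃ + u₂₃] = 0` for invariant `t`. -/
theorem bracket1213_invariant {t : L ⊗[k] L} (ht : ∀ x : L, ⁅x, t⁆ = 0) (u : L ⊗[k] L) :
    bracket1213 (t ⊗ₜ[k] u) = -bracket1223 (t ⊗ₜ[k] u) := by
  have key : ∀ (t : L ⊗[k] L) (c d : L), bracket1213 (t ⊗ₜ[k] (c ⊗ₜ[k] d)) +
      bracket1223 (t ⊗ₜ[k] (c ⊗ₜ[k] d)) =
        -TensorProduct.assoc k L L L (⁅c, t⁆ ⊗ₜ d) := by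
    intro t c d
    induction t using TensorProduct.induction_on with
    | zero => simp
    | tmul a b =>
      rw [bracket1213_tmul, bracket1223_tmul, TensorProduct.LieModule.lie_tmul_right,
        TensorProduct.add_tmul, map_add, TensorProduct.assoc_tmul, TensorProduct.assoc_tmul,
        ← lie_skew a c, ← lie_skew b c, TensorProduct.neg_tmul, TensorProduct.neg_tmul,
        TensorProduct.tmul_neg, neg_add]
    | add s t hs ht =>
      simp only [TensorProduct.add_tmul, lie_add, map_add, neg_add, ← hs, ← ht]
      abel
  rw [eq_neg_iff_add_eq_zero]
  induction u using TensorProduct.induction_on with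
  | zero => simp
  | tmul c d => rw [key, ht, TensorProduct.zero_tmul, map_zero, neg_zero]
  | add u v hu hv =>
    rw [TensorProduct.tmul_add, map_add, map_add, add_add_add_comm, hu, hv, add_zero]

/-- `[u₁₂ + u₁₃, t₂₃] = 0` for invariant `t`. -/
theorem bracket1323_invariant {t : L ⊗[k] L} (ht : ∀ x : L, ⁅x, t⁆ = 0) (u : L ⊗[k] L) :
    bracket1323 (u ⊗ₜ[k] t) = -bracket1223 (u ⊗ₜ[k] t) := by
  have key : ∀ (t : L ⊗[k] L) (a b : L), bracket1323 ((a ⊗ₜ[k] b) ⊗ₜ[k] t) +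
      bracket1223 ((a ⊗ₜ[k] b) ⊗ₜ[k] t) = a ⊗ₜ ⁅b, t⁆ := by
    intro t a b
    induction t using TensorProduct.induction_on with
    | zero => simp
    | tmul c d =>
      simp only [bracket1323_tmul, bracket1223_tmul, TensorProduct.LieModule.lie_tmul_right,
        TensorProduct.tmul_add]
      abel
    | add s t hs ht =>
      simp only [TensorProduct.tmul_add, lie_add, map_add, ← hs, ← ht]
      abel
  rw [eq_neg_iff_add_eq_zero]
  induction u using TensorProduct.induction_on with
  | zero => simp
  | tmul c d => rw [key, ht, TensorProduct.tmul_zero]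
  | add u v hu hv =>
    rw [TensorProduct.add_tmul, map_add, map_add, add_add_add_comm, hu, hv, add_zero]

/-- `[t₁₃, u₂₁ + u₂₃] = 0` for invariant `t`. -/
theorem bracket1213_invariant_right {t : L ⊗[k] L} (ht : ∀ x : L, ⁅x, t⁆ = 0) (u : L ⊗[k] L) :
    bracket1213 (u ⊗ₜ[k] t) = bracket1323 (t ⊗ₜ[k] TensorProduct.comm k L L u) := by
  have key : ∀ (t : L ⊗[k] L) (a b : L), bracket1213 ((a ⊗ₜ[k] b) ⊗ₜ[k] t) -
      bracket1323 (t ⊗ₜ[k] (b ⊗ₜ[k] a)) =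
        TensorProduct.leftComm k L L L (b ⊗ₜ ⁅a, t⁆) := by
    intro t a b
    induction t using TensorProduct.induction_on with
    | zero => simp
    | tmul c d =>
      simp only [bracket1323_tmul, bracket1213_tmul, TensorProduct.LieModule.lie_tmul_right,
        TensorProduct.tmul_add, map_add, TensorProduct.leftComm_tmul]
      rw [← lie_skew a d, TensorProduct.tmul_neg, TensorProduct.tmul_neg, sub_eq_add_neg]
    | add s t hs ht =>
      simp only [TensorProduct.tmul_add, TensorProduct.add_tmul, lie_add, map_add, ← hs, ← ht]
      abel
  rw [← sub_eq_zero]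
  induction u using TensorProduct.induction_on with
  | zero => simp
  | tmul c d => rw [TensorProduct.comm_tmul, key, ht, TensorProduct.tmul_zero, map_zero]
  | add u v hu hv =>
    rw [TensorProduct.add_tmul, map_add, map_add, TensorProduct.tmul_add, map_add,
      add_sub_add_comm, hu, hv, add_zero]

end RMatrix

/-- The expression `[r₁₂, s₁₃] + [r₁₂, u₂₃] + [s₁₃, u₂₃]`. -/
noncomputable def yangBaxter (r s u : L ⊗[k] L) : L ⊗[k] (L ⊗[k] L) :=
  bracket1213 (r ⊗ₜ[k] s) + bracket1223 (r ⊗ₜ[k] u) + bracket1323 (s ⊗ₜ[k] u)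

/-- The Yang-Baxter expression of combinations of an antisymmetric and a symmetric invariant
tensor: the mixed terms vanish. -/
theorem yangBaxter_add_smul {a t : L ⊗[k] L} (ha : TensorProduct.comm k L L a = -a)
    (ht : ∀ x : L, ⁅x, t⁆ = 0) (c₁ c₂ c₃ : k) :
    yangBaxter (a + c₁ • t) (a + c₂ • t) (a + c₃ • t) = yangBaxter a a a +
      (-(c₁ * c₂) + c₁ * c₃ - c₂ * c₃) • bracket1223 (t ⊗ₜ[k] t) := by
  have h1 := bracket1213_invariant ht a
  have h2 := bracket1213_invariant ht t
  have h3 := bracket1323_invariant ht a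
  have h4 := bracket1323_invariant ht t
  have h5 := bracket1213_invariant_right ht a
  rw [ha, TensorProduct.tmul_neg, map_neg] at h5
  simp only [yangBaxter, TensorProduct.add_tmul, TensorProduct.tmul_add, ← TensorProduct.smul_tmul',
    TensorProduct.tmul_smul, map_add, map_smul, h1, h2, h3, h4, h5]
  module

/-- For an r-matrix with antisymmetric part `a` and symmetric part `t / 2`, the Yang-Baxter
expression of the tensors `a + (c / 2) t` is a multiple of `[t₁₂, t₂₃]`. The multiple vanishes if
`c₁ = c₂ = c₃ = 1`, which is the Yang-Baxter equation for `r` itself. -/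
theorem yangBaxter_sign [CharZero k] {r : L ⊗[k] L} (hr : IsClassicalRMatrix r) (c₁ c₂ c₃ : k) :
    yangBaxter (antisymmPart r + (c₁ / 2) • symmPart r) (antisymmPart r + (c₂ / 2) • symmPart r)
      (antisymmPart r + (c₃ / 2) • symmPart r) =
      ((1 - c₁ * c₂ + c₁ * c₃ - c₂ * c₃) / 4) •
        bracket1223 (symmPart r ⊗ₜ[k] symmPart r) := by
  have h := yangBaxter_add_smul (comm_antisymmPart r)
    (show ∀ x : L, ⁅x, symmPart r⁆ = 0 from hr.symm_invariant)
  have h1 := h (1 / 2) (1 / 2) (1 / 2)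
  rw [antisymmPart_add_symmPart, yangBaxter, hr.cybe] at h1
  rw [h, eq_neg_of_add_eq_zero_left h1.symm]
  module

end Bivectors

/-! ### The Jacobiator of commuting Lie algebra actions -/

section Jacobi

variable {k A L : Type*} [Field k] [CommRing A] [Algebra k A] [LieRing L] [LieAlgebra k L]

/-- The linear map `x ↦ X x f`, for a linear family `X` of derivations. -/
def act (X : L →ₗ[k] Derivation k A A) (f : A) : L →ₗ[k] A where
  toFun x := X x f
  map_add' x y := by simp
  map_smul' c x := by simp

@[simp] theorem act_apply (X : L →ₗ[k] Derivation k A A) (f : A) (x : L) : act X f x = X x f := rfl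

theorem ev₂_comm {V : Type*} [AddCommGroup V] [Module k V] (u v : V →ₗ[k] A) (t : V ⊗[k] V) :
    ev₂ u v (TensorProduct.comm k V V t) = ev₂ v u t := by
  induction t using TensorProduct.induction_on with
  | zero => simp
  | tmul a b => simp [mul_comm]
  | add s t hs ht => simp only [map_add, hs, ht]

theorem ev₂_eq_sum {V ι : Type*} [AddCommGroup V] [Module k V] [Fintype ι]
    (x : Module.Basis ι k V) (u v : V →ₗ[k] A) (t : V ⊗[k] V) :
    ev₂ u v t = ∑ i, ∑ j, (x.tensorProduct x).repr t (i, j) • (u (x i) * v (x j)) := by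
  conv_lhs => rw [tensor_eq_sum x t]
  simp only [map_sum, map_smul, ev₂_tmul]

theorem ev₃_bracket1223_eq_sum {ι : Type*} [Fintype ι] (x : Module.Basis ι k L)
    (u v w : L →ₗ[k] A) (s t : L ⊗[k] L) :
    ev₃ u v w (bracket1223 (s ⊗ₜ[k] t)) = ∑ i, ∑ j, ∑ l, ∑ m,
      ((x.tensorProduct x).repr s (i, j) * (x.tensorProduct x).repr t (l, m)) •
        (u (x i) * (v ⁅x j, x l⁆ * w (x m))) := by
  have h1 : ∀ a b : L, ev₃ u v w (bracket1223 ((a ⊗ₜ[k] b) ⊗ₜ[k] t)) =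
      ∑ l, ∑ m, (x.tensorProduct x).repr t (l, m) • (u a * (v ⁅b, x l⁆ * w (x m))) := by
    intro a b
    conv_lhs => rw [tensor_eq_sum x t]
    simp only [TensorProduct.tmul_sum, map_sum, TensorProduct.tmul_smul, map_smul,
      bracket1223_tmul, ev₃_tmul]
  conv_lhs => rw [tensor_eq_sum x s]
  simp only [TensorProduct.sum_tmul, map_sum, ← TensorProduct.smul_tmul', map_smul, h1,
    Finset.smul_sum, smul_smul]

theorem sum_rotate {α β γ M : Type*} [Fintype α] [Fintype β] [Fintype γ] [AddCommMonoid M]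
    (F : α → β → γ → M) : ∑ a, ∑ b, ∑ c, F a b c = ∑ c, ∑ a, ∑ b, F a b c :=
  (Finset.sum_congr rfl fun _ _ => Finset.sum_comm).trans Finset.sum_comm

theorem ev₃_rotate (u v w : L →ₗ[k] A) (s t : L ⊗[k] L) :
    ev₃ v w u (bracket1223 (s ⊗ₜ[k] t)) =
      -ev₃ u v w (bracket1323 (TensorProduct.comm k L L t ⊗ₜ[k] s)) := by
  induction s using TensorProduct.induction_on with
  | zero => simp
  | add s s' hs hs' =>
    rw [TensorProduct.add_tmul, TensorProduct.tmul_add, map_add, map_add, map_add, map_add, hs, hs',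
      neg_add]
  | tmul a b =>
    induction t using TensorProduct.induction_on with
    | zero => simp
    | add s s' hs hs' =>
      rw [map_add, TensorProduct.add_tmul, TensorProduct.tmul_add, map_add, map_add, map_add,
        map_add, hs, hs', neg_add]
    | tmul c d =>
      rw [TensorProduct.comm_tmul, bracket1223_tmul, bracket1323_tmul, ev₃_tmul, ev₃_tmul,
        ← lie_skew, map_neg]
      ring

theorem ev₃_rotate' (u v w : L →ₗ[k] A) (s t : L ⊗[k] L) :
    ev₃ w u v (bracket1223 (s ⊗ₜ[k] t)) =
      -ev₃ u v w (bracket1213 (t ⊗ₜ[k] TensorProduct.comm k L L s)) := by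
  induction s using TensorProduct.induction_on with
  | zero => simp
  | add s s' hs hs' =>
    rw [map_add, TensorProduct.add_tmul, TensorProduct.tmul_add, map_add, map_add, map_add, map_add,
      hs, hs', neg_add]
  | tmul a b =>
    induction t using TensorProduct.induction_on with
    | zero => simp
    | add s s' hs hs' =>
      rw [TensorProduct.add_tmul, TensorProduct.tmul_add, map_add, map_add, map_add,
        map_add, hs, hs', neg_add]
    | tmul c d =>
      rw [TensorProduct.comm_tmul, bracket1223_tmul, bracket1213_tmul, ev₃_tmul, ev₃_tmul,
        ← lie_skew, map_neg]
      ring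

variable {H : Type*}

/-- The sign of the order of the values of `o`. -/
def orderSign (k : Type*) [Field k] {n : ℕ} (o : H → Fin n) (α β : H) : k :=
  if o α < o β then 1 else if o β < o α then -1 else 0

theorem orderSign_swap {n : ℕ} (o : H → Fin n) (α β : H) :
    orderSign k o β α = -orderSign k o α β := by
  simp only [orderSign]
  split_ifs <;> first | omega | simp

/-- The coefficient of `[t₁₂, t₂₃]` in the Yang-Baxter expression vanishes for the signs of a
linear order, unless the three arguments coincide. -/
theorem orderSign_cubic [DecidableEq H] {n : ℕ} {o : H → Fin n} (ho : Function.Injective o)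
    (α β γ : H) :
    1 - orderSign k o α β * orderSign k o α γ + orderSign k o α β * orderSign k o β γ -
      orderSign k o α γ * orderSign k o β γ = if α = β ∧ β = γ then 1 else 0 := by
  simp only [orderSign, ← ho.eq_iff (a := α), ← ho.eq_iff (a := β)]
  split_ifs <;> first | omega | norm_num

/-- The tensors `a + (s / 2) t` for the signs `s` of a linear order, where `r` has antisymmetric
part `a` and symmetric part `t / 2`: this is `r` above the diagonal, `-r₂₁` below it, and `a` on
it. -/
noncomputable def orderTensor {n : ℕ} (o : H → Fin n) (r : L ⊗[k] L) (α β : H) : L ⊗[k] L :=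
  antisymmPart r + (orderSign k o α β / 2) • symmPart r

theorem comm_orderTensor {n : ℕ} (o : H → Fin n) (r : L ⊗[k] L) (α β : H) :
    TensorProduct.comm k L L (orderTensor o r α β) = -orderTensor o r β α := by
  rw [orderTensor, orderTensor, map_add, map_smul, comm_antisymmPart, comm_symmPart,
    orderSign_swap o α β, neg_div, neg_smul, neg_add, neg_neg]

variable {ι : Type*} [Fintype H] [DecidableEq H] [Fintype ι] {X : H → L →ₗ[k] Derivation k A A}

theorem sum_bracket_eq_ev₃ (x : Module.Basis ι k L)
    (hX : ∀ α β y z, ⁅X α y, X β z⁆ = if α = β then X α ⁅y, z⁆ else 0) (R : H → H → L ⊗[k] L)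
    (f g h : A) :
    (∑ p : H × ι, ∑ q : H × ι, ∑ u : H × ι, ∑ v : H × ι,
      ((x.tensorProduct x).repr (R p.1 q.1) (p.2, q.2) *
        (x.tensorProduct x).repr (R u.1 v.1) (u.2, v.2)) •
        (X p.1 (x p.2) f * (⁅X q.1 (x q.2), X u.1 (x u.2)⁆ g * X v.1 (x v.2) h))) =
      ∑ α, ∑ β, ∑ γ, ev₃ (act (X α) f) (act (X β) g) (act (X γ) h)
        (bracket1223 (R α β ⊗ₜ[k] R β γ)) := by
  have h1 : ∀ (p q : H × ι), (∑ u : H × ι, ∑ v : H × ι,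
      ((x.tensorProduct x).repr (R p.1 q.1) (p.2, q.2) *
        (x.tensorProduct x).repr (R u.1 v.1) (u.2, v.2)) •
        (X p.1 (x p.2) f * (⁅X q.1 (x q.2), X u.1 (x u.2)⁆ g * X v.1 (x v.2) h))) =
      ∑ γ, ∑ l, ∑ m, ((x.tensorProduct x).repr (R p.1 q.1) (p.2, q.2) *
        (x.tensorProduct x).repr (R q.1 γ) (l, m)) •
        (act (X p.1) f (x p.2) * (act (X q.1) g ⁅x q.2, x l⁆ * act (X γ) h (x m))) := by
    intro p q
    rw [Fintype.sum_prod_type, Finset.sum_eq_single q.1]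
    · simp only [Fintype.sum_prod_type, hX, if_pos]
      rw [Finset.sum_comm]
      rfl
    · intro β _ hβ
      simp only [hX, if_neg (Ne.symm hβ)]
      simp
    · simp
  simp only [h1]
  simp only [Fintype.sum_prod_type, ev₃_bracket1223_eq_sum x]
  refine Finset.sum_congr rfl fun α _ => ?_
  rw [Finset.sum_comm]
  refine Finset.sum_congr rfl fun β _ => ?_
  exact sum_rotate _

/-- The Jacobiator of a bracket given by commuting actions of a Lie algebra `L` and an antisymmetric
family of tensors is the value of their Yang-Baxter expression. -/
theorem jacobiator_eq_ev₃ (x : Module.Basis ι k L)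
    (hX : ∀ α β y z, ⁅X α y, X β z⁆ = if α = β then X α ⁅y, z⁆ else 0) (R : H → H → L ⊗[k] L)
    (hR : ∀ α β, TensorProduct.comm k L L (R α β) = -R β α) (B : A →ₗ[k] A →ₗ[k] A)
    (hB : ∀ f g, B f g = ∑ α, ∑ β, ev₂ (act (X α) f) (act (X β) g) (R α β)) (f g h : A) :
    B f (B g h) + B g (B h f) + B h (B f g) = ∑ α, ∑ β, ∑ γ,
      ev₃ (act (X α) f) (act (X β) g) (act (X γ) h) (yangBaxter (R α β) (R α γ) (R β γ)) := by
  have hcomm : ∀ (t : L ⊗[k] L) (i j : ι), (x.tensorProduct x).repr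
      (TensorProduct.comm k L L t) (i, j) = (x.tensorProduct x).repr t (j, i) := by
    intro t i j
    induction t using TensorProduct.induction_on with
    | zero => simp
    | tmul a b => simp [mul_comm]
    | add s t hs ht => simp only [map_add, Finsupp.add_apply, hs, ht]
  rw [jacobiator_eq (fun p : H × ι => X p.1 (x p.2))
    (fun p q => (x.tensorProduct x).repr (R p.1 q.1) (p.2, q.2)) ?_ B ?_ f g h,
    sum_bracket_eq_ev₃ x hX, sum_bracket_eq_ev₃ x hX, sum_bracket_eq_ev₃ x hX]
  · rw [sum_rotate fun α β γ => ev₃ (act (X α) g) (act (X β) h) (act (X γ) f) _,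
      ← sum_rotate fun β γ α => ev₃ (act (X α) h) (act (X β) f) (act (X γ) g) _]
    simp only [← Finset.sum_add_distrib]
    refine Finset.sum_congr rfl fun α _ => Finset.sum_congr rfl fun β _ =>
      Finset.sum_congr rfl fun γ _ => ?_
    rw [ev₃_rotate (act (X α) f), ev₃_rotate' (act (X α) f), hR, TensorProduct.neg_tmul,
      TensorProduct.tmul_neg, map_neg, map_neg, map_neg, map_neg, neg_neg, neg_neg, yangBaxter,
      map_add, map_add]
    ring
  · intro p q
    rw [← hcomm, hR, map_neg, Finsupp.neg_apply]
  · intro f g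
    rw [hB]
    simp only [Fintype.sum_prod_type, ev₂_eq_sum x]
    refine Finset.sum_congr rfl fun α _ => ?_
    rw [Finset.sum_comm]
    rfl

/-- For an r-matrix only the diagonal part of the Jacobiator survives. -/
theorem jacobiator_orderTensor [CharZero k] (x : Module.Basis ι k L)
    (hX : ∀ α β y z, ⁅X α y, X β z⁆ = if α = β then X α ⁅y, z⁆ else 0) {n : ℕ} {o : H → Fin n}
    (ho : Function.Injective o) {r : L ⊗[k] L} (hr : IsClassicalRMatrix r)
    (B : A →ₗ[k] A →ₗ[k] A) (hB : ∀ f g, B f g =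
      ∑ α, ∑ β, ev₂ (act (X α) f) (act (X β) g) (orderTensor o r α β)) (f g h : A) :
    B f (B g h) + B g (B h f) + B h (B f g) = (1 / 4 : k) • ∑ α,
      ev₃ (act (X α) f) (act (X α) g) (act (X α) h)
        (bracket1223 (symmPart r ⊗ₜ[k] symmPart r)) := by
  rw [jacobiator_eq_ev₃ x hX _ (comm_orderTensor o r) B hB, Finset.smul_sum]
  refine Finset.sum_congr rfl fun α _ => ?_
  simp only [orderTensor, yangBaxter_sign hr, orderSign_cubic ho, map_smul]
  rw [Finset.sum_eq_single α, Finset.sum_eq_single α]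
  · rw [if_pos ⟨rfl, rfl⟩]
  · intro γ _ hγ
    rw [if_neg (fun h => hγ h.2.symm), zero_div, zero_smul]
  · simp
  · intro β _ hβ
    refine Finset.sum_eq_zero fun γ _ => ?_
    rw [if_neg (fun h => hβ h.1.symm), zero_div, zero_smul]
  · simp

theorem sum_wedge_eq_ev₂ (x : Module.Basis ι k L) (r : L ⊗[k] L)
    (X Y : L →ₗ[k] Derivation k A A) (f g : A) :
    (∑ i, ∑ j, (x.tensorProduct x).repr r (i, j) • wedge (X (x i)) (Y (x j))) f g =
      ev₂ (act X f) (act Y g) r - ev₂ (act Y f) (act X g) (TensorProduct.comm k L L r) := by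
  rw [ev₂_comm, ev₂_eq_sum x, ev₂_eq_sum x, ← Finset.sum_sub_distrib]
  simp only [LinearMap.sum_apply, ← Finset.sum_sub_distrib, ← smul_sub, LinearMap.smul_apply]
  refine Finset.sum_congr rfl fun i _ => Finset.sum_congr rfl fun j _ => ?_
  simp [wedge, mul_comm]

/-- The bracket of the bivector `∑_{α ≺ β} r^{ij} x_i(α) ∧ x_j(β) + ...` through the tensors
`orderTensor`. -/
theorem sum_wedge_order_eq [CharZero k] (x : Module.Basis ι k L) (r : L ⊗[k] L) {n : ℕ}
    {o : H → Fin n} (ho : Function.Injective o) (f g : A) :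
    ((∑ α : H, ∑ β : H with o α < o β, ∑ i, ∑ j,
      (x.tensorProduct x).repr r (i, j) • wedge (X α (x i)) (X β (x j))) +
    (1 / 2 : k) • ∑ α : H, ∑ i, ∑ j,
      (x.tensorProduct x).repr r (i, j) • wedge (X α (x i)) (X α (x j))) f g =
      ∑ α, ∑ β, ev₂ (act (X α) f) (act (X β) g) (orderTensor o r α β) := by
  have h1 : ∀ α β, ev₂ (act (X α) f) (act (X β) g) (orderTensor o r α β) =
      (if o α < o β then ev₂ (act (X α) f) (act (X β) g) r else 0) -
      (if o β < o α then ev₂ (act (X α) f) (act (X β) g) (TensorProduct.comm k L L r) else 0) +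
      (if α = β then ev₂ (act (X α) f) (act (X β) g) (antisymmPart r) else 0) := by
    intro α β
    have hr1 : antisymmPart r + ((1 : k) / 2) • symmPart r = r := antisymmPart_add_symmPart r
    have hr2 : antisymmPart r + (-1 / 2 : k) • symmPart r = -TensorProduct.comm k L L r := by
      conv_rhs => rw [← hr1, map_add, map_smul, comm_antisymmPart, comm_symmPart]
      module
    simp only [orderTensor, orderSign, ← ho.eq_iff (a := α)]
    rcases lt_trichotomy (o α) (o β) with h | h | h
    · rw [if_pos h, if_pos h, if_neg h.asymm, if_neg h.ne, hr1, sub_zero, add_zero]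
    · rw [if_neg h.not_lt, if_neg h.not_gt, if_neg h.not_lt, if_neg h.not_gt, if_pos h]
      simp
    · rw [if_neg h.asymm, if_pos h, if_neg h.asymm, if_pos h, if_neg h.ne', hr2, map_neg]
      simp
  simp only [h1, Finset.sum_add_distrib, Finset.sum_sub_distrib]
  simp only [LinearMap.add_apply, LinearMap.smul_apply]
  congr 1
  · have h2 : ∀ α : H, (∑ β : H with o α < o β, ∑ i, ∑ j, (x.tensorProduct x).repr r (i, j) •
        wedge (X α (x i)) (X β (x j))) f g = ∑ β, if o α < o β then
          ev₂ (act (X α) f) (act (X β) g) r -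
            ev₂ (act (X β) f) (act (X α) g) (TensorProduct.comm k L L r) else 0 := by
      intro α
      rw [Finset.sum_filter]
      rw [LinearMap.sum_apply, LinearMap.sum_apply]
      refine Finset.sum_congr rfl fun β _ => ?_
      split_ifs
      · exact sum_wedge_eq_ev₂ x r _ _ f g
      · rfl
    rw [LinearMap.sum_apply, LinearMap.sum_apply, Finset.sum_congr rfl fun α _ => h2 α]
    rw [Finset.sum_comm (f := fun α β => if o β < o α then _ else _)]
    simp only [← Finset.sum_sub_distrib]
    refine Finset.sum_congr rfl fun α _ => Finset.sum_congr rfl fun β _ => ?_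
    split_ifs <;> simp
  · simp only [Finset.sum_ite_eq, Finset.mem_univ, if_true]
    rw [LinearMap.sum_apply, LinearMap.sum_apply,
      Finset.sum_congr rfl fun α _ => sum_wedge_eq_ev₂ x r (X α) (X α) f g, Finset.smul_sum]
    simp only [antisymmPart, map_smul, map_sub]

end Jacobi

/-! ### The twisted Fock-Rosly bivector is Poisson -/

section PoissonAxioms

variable {k A L : Type*} [Field k] [CommRing A] [Algebra k A] [LieRing L] [LieAlgebra k L]

/-- The bracket defined by commuting actions of a Lie algebra, a linear order of these actions and
an r-matrix is Poisson as soon as the diagonal contributions of `[t₁₂, t₂₃]` cancel. -/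
theorem isPoissonBracket_of_orderTensor [CharZero k] {H ι : Type*} [Fintype H] [DecidableEq H]
    [Fintype ι] {X : H → L →ₗ[k] Derivation k A A} (x : Module.Basis ι k L)
    (hX : ∀ α β y z, ⁅X α y, X β z⁆ = if α = β then X α ⁅y, z⁆ else 0) {n : ℕ} {o : H → Fin n}
    (ho : Function.Injective o) {r : L ⊗[k] L} (hr : IsClassicalRMatrix r)
    (B : A →ₗ[k] A →ₗ[k] A) (hB : ∀ f g, B f g =
      ∑ α, ∑ β, ev₂ (act (X α) f) (act (X β) g) (orderTensor o r α β))
    (hdiag : ∀ f g h, ∑ α, ev₃ (act (X α) f) (act (X α) g) (act (X α) h)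
      (bracket1223 (symmPart r ⊗ₜ[k] symmPart r)) = 0) : IsPoissonBracket B where
  skew f := by
    have h1 : B f f = -B f f := by
      conv_lhs => rw [hB]
      rw [hB]
      refine Finset.sum_comm.trans ?_
      rw [← Finset.sum_neg_distrib]
      refine Finset.sum_congr rfl fun α _ => ?_
      rw [← Finset.sum_neg_distrib]
      refine Finset.sum_congr rfl fun β _ => ?_
      rw [← ev₂_comm, comm_orderTensor, map_neg]
    have h2 : (2 : k) • B f f = 0 := by
      rw [two_smul]
      nth_rw 1 [h1]
      exact neg_add_cancel _
    exact (smul_eq_zero_iff_right two_ne_zero).mp h2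
  leibniz f g h := by
    simp only [hB, ev₂_eq_sum x, Finset.sum_mul, Finset.mul_sum, ← Finset.sum_add_distrib]
    refine Finset.sum_congr rfl fun α _ => Finset.sum_congr rfl fun β _ =>
      Finset.sum_congr rfl fun i _ => Finset.sum_congr rfl fun j _ => ?_
    rw [smul_mul_assoc, mul_smul_comm, ← smul_add, act_apply, act_apply, act_apply, act_apply,
      Derivation.leibniz]
    congr 1
    simp only [smul_eq_mul]
    ring
  jacobi f g h := by
    rw [jacobiator_orderTensor x hX ho hr B hB, hdiag, smul_zero]

theorem map_bracket1223 (p : L →ₗ[k] L) (hp : ∀ x y, p ⁅x, y⁆ = ⁅p x, p y⁆) (s t : L ⊗[k] L) :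
    TensorProduct.map p (TensorProduct.map p p) (bracket1223 (s ⊗ₜ[k] t)) =
      bracket1223 (TensorProduct.map p p s ⊗ₜ[k] TensorProduct.map p p t) := by
  induction s using TensorProduct.induction_on with
  | zero => simp
  | add s s' hs hs' => simp only [TensorProduct.add_tmul, map_add, hs, hs']
  | tmul a b =>
    induction t using TensorProduct.induction_on with
    | zero => simp
    | add s s' hs hs' => simp only [TensorProduct.tmul_add, map_add, hs, hs']
    | tmul c d => simp [hp]

theorem ev₃_neg_comp (p : L →ₗ[k] L) (u v w : L →ₗ[k] A) (t : L ⊗[k] (L ⊗[k] L)) :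
    ev₃ (-(u ∘ₗ p)) (-(v ∘ₗ p)) (-(w ∘ₗ p)) t =
      -ev₃ u v w (TensorProduct.map p (TensorProduct.map p p) t) := by
  induction t using TensorProduct.induction_on with
  | zero => simp
  | add s s' hs hs' => simp only [map_add, hs, hs', neg_add]
  | tmul a t =>
    induction t using TensorProduct.induction_on with
    | zero => simp
    | add s s' hs hs' => simp only [TensorProduct.tmul_add, map_add, hs, hs', neg_add]
    | tmul b c => simp

theorem map_ev₃ {A' : Type*} [CommRing A'] [Algebra k A'] (φ : A →ₐ[k] A') (u v w : L →ₗ[k] A)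
    (t : L ⊗[k] (L ⊗[k] L)) : φ (ev₃ u v w t) =
      ev₃ (φ.toLinearMap ∘ₗ u) (φ.toLinearMap ∘ₗ v) (φ.toLinearMap ∘ₗ w) t := by
  induction t using TensorProduct.induction_on with
  | zero => simp
  | add s s' hs hs' => simp only [map_add, hs, hs']
  | tmul a t =>
    induction t using TensorProduct.induction_on with
    | zero => simp
    | add s s' hs hs' => simp only [TensorProduct.tmul_add, map_add, hs, hs']
    | tmul b c => simp

theorem map_ev₂ {A' : Type*} [CommRing A'] [Algebra k A'] (φ : A →ₐ[k] A') (u v : L →ₗ[k] A)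
    (t : L ⊗[k] L) : φ (ev₂ u v t) = ev₂ (φ.toLinearMap ∘ₗ u) (φ.toLinearMap ∘ₗ v) t := by
  induction t using TensorProduct.induction_on with
  | zero => simp
  | add s s' hs hs' => simp only [map_add, hs, hs']
  | tmul a b => simp

/-- A Poisson structure may be transported along an isomorphism. -/
theorem IsPoissonBracket.transport {A' : Type*} [CommRing A'] [Algebra k A'] (φ : A ≃ₐ[k] A')
    {B : A →ₗ[k] A →ₗ[k] A} (hB : IsPoissonBracket B) :
    IsPoissonBracket ((B.compl₁₂ φ.symm.toLinearMap φ.symm.toLinearMap).compr₂ φ.toLinearMap) where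
  skew f := by simp [hB.skew]
  leibniz f g h := by simp [hB.leibniz]
  jacobi f g h := by
    have := congrArg φ (hB.jacobi (φ.symm f) (φ.symm g) (φ.symm h))
    simpa using this

/-- If opposite families of forms are related by an automorphism preserving `t`, the contributions
of `[t₁₂, t₂₃]` cancel. -/
theorem ev₃_add_eq_zero (p : L →ₗ[k] L) (hp : ∀ x y, p ⁅x, y⁆ = ⁅p x, p y⁆) {t : L ⊗[k] L}
    (ht : TensorProduct.map p p t = t) {u v w u' v' w' : L →ₗ[k] A} (hu : u = -(u' ∘ₗ p))
    (hv : v = -(v' ∘ₗ p)) (hw : w = -(w' ∘ₗ p)) :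
    ev₃ u v w (bracket1223 (t ⊗ₜ[k] t)) + ev₃ u' v' w' (bracket1223 (t ⊗ₜ[k] t)) = 0 := by
  rw [hu, hv, hw, ev₃_neg_comp, map_bracket1223 p hp, ht, neg_add_cancel]

end PoissonAxioms

section Evaluation

variable {k : Type*} [Field k]

/-- Evaluation at a point, as a homomorphism of algebras. -/
def evalHom {Y : Type*} (B : Subalgebra k (Y → k)) (y : Y) : B →ₐ[k] k :=
  (Pi.evalAlgHom k (fun _ : Y => k) y).comp B.val

theorem evalHom_apply {Y : Type*} (B : Subalgebra k (Y → k)) (y : Y) (F : B) :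
    evalHom B y F = F.1 y := rfl

variable {L : Type*} [LieRing L] [LieAlgebra k L]

theorem sum_ev₃_eq_zero_of_inl_eq_neg {Y E : Type*} [Fintype E] {B : Subalgebra k (Y → k)}
    (X : E ⊕ E → L →ₗ[k] Derivation k B B) (p : E → Y → L →ₗ[k] L)
    (hp : ∀ e y, ∀ a b, p e y ⁅a, b⁆ = ⁅p e y a, p e y b⁆) {t : L ⊗[k] L}
    (ht : ∀ e y, TensorProduct.map (p e y) (p e y) t = t)
    (hX : ∀ f y e, (evalHom B y).toLinearMap ∘ₗ act (X (Sum.inl e)) f =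
      -(((evalHom B y).toLinearMap ∘ₗ act (X (Sum.inr e)) f) ∘ₗ p e y)) (F F' F'' : B) :
    ∑ α, ev₃ (act (X α) F) (act (X α) F') (act (X α) F'') (bracket1223 (t ⊗ₜ[k] t)) = 0 := by
  refine Subtype.ext (funext fun y => ?_)
  rw [coe_sum_apply, Fintype.sum_sum_type, ← Finset.sum_add_distrib]
  refine Finset.sum_eq_zero fun e _ => ?_
  rw [← evalHom_apply, ← evalHom_apply, map_ev₃, map_ev₃]
  exact ev₃_add_eq_zero _ (hp e y) (ht e y) (hX F y e) (hX F' y e) (hX F'' y e)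

theorem apply_eq_sum_ev₂ {Y H : Type*} [Fintype H] {B : Subalgebra k (Y → k)}
    (X : H → L →ₗ[k] Derivation k B B) (R : H → H → L ⊗[k] L) {P F F' : B}
    (hP : P = ∑ α, ∑ β, ev₂ (act (X α) F) (act (X β) F') (R α β)) (y : Y) :
    P.1 y = ∑ α, ∑ β, ev₂ ((evalHom B y).toLinearMap ∘ₗ act (X α) F)
      ((evalHom B y).toLinearMap ∘ₗ act (X β) F') (R α β) := by
  rw [hP, coe_sum_apply]
  refine Finset.sum_congr rfl fun α _ => ?_
  rw [coe_sum_apply]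
  refine Finset.sum_congr rfl fun β _ => ?_
  rw [← evalHom_apply, map_ev₂]

end Evaluation

section FockRosly

variable {k G : Type*} [Field k] [Group G] [AffineAlgebraicGroup k G]
variable {E : Type*} [DecidableEq E]

theorem fockRosly_apply [Fintype E] [CharZero k] (Γ : CiliatedFatGraph E) (κ : E → AlgAut k G)
    {ι : Type*}
    [Fintype ι] (x : Module.Basis ι k (lieAlg k G)) (r : lieAlg k G ⊗[k] lieAlg k G)
    (F F' : coordPow k G E) : fockRosly Γ κ x r F F' =
      ∑ α, ∑ β, ev₂ (act (halfEdgeLin κ α) F) (act (halfEdgeLin κ β) F')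
        (orderTensor Γ.order r α β) :=
  sum_wedge_order_eq (X := halfEdgeLin κ) x r Γ.order.injective F F'

/-- The linear form `x ↦ (x(α) F) (g)` on `𝔤`. -/
def halfEdgeForm (κ : E → AlgAut k G) (F : coordPow k G E) (g : E → G) (α : HalfEdge E) :
    lieAlg k G →ₗ[k] k :=
  (evalHom (coordPow k G E) g).toLinearMap ∘ₗ act (halfEdgeLin κ α) F

theorem halfEdgeForm_inl (κ : E → AlgAut k G) (F : coordPow k G E) (g : E → G) (e : E) :
    halfEdgeForm κ F g (Sum.inl e) =
      -(halfEdgeForm κ F g (Sum.inr e) ∘ₗ push (conjAut k G (g e) * κ e)) :=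
  LinearMap.ext fun y => halfEdgeField_inl κ y e F g

/-- The two halves of an edge give opposite contributions to the Jacobiator. -/
theorem sum_ev₃_halfEdge_eq_zero [Fintype E] (κ : E → AlgAut k G) {t : lieAlg k G ⊗[k] lieAlg k G}
    (hinv : ∀ (e : E) (g : G), TensorProduct.map (push (conjAut k G g * κ e))
      (push (conjAut k G g * κ e)) t = t) (F F' F'' : coordPow k G E) :
    ∑ α, ev₃ (act (halfEdgeLin κ α) F) (act (halfEdgeLin κ α) F') (act (halfEdgeLin κ α) F'')
      (bracket1223 (t ⊗ₜ[k] t)) = 0 :=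
  sum_ev₃_eq_zero_of_inl_eq_neg (halfEdgeLin κ) (fun e g => push (conjAut k G (g e) * κ e))
    (fun e g => push_lie (conjAut k G (g e) * κ e)) (fun e g => hinv e (g e))
    (fun f g e => halfEdgeForm_inl κ f g e) F F' F''

set_option maxHeartbeats 800000 in
/-- The twisted Fock-Rosly bivector is Poisson. The Jacobiator is a sum over the half-edges of the
values of the invariant trivector `[t₁₂, t₂₃]`, and the two halves of an edge contribute opposite
terms. -/
theorem isPoissonBracket_fockRosly [Fintype E] [CharZero k] (Γ : CiliatedFatGraph E)
    (κ : E → AlgAut k G) {ι : Type*} [Fintype ι] (x : Module.Basis ι k (lieAlg k G))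
    {r : lieAlg k G ⊗[k] lieAlg k G} (hr : IsClassicalRMatrix r)
    (hinv : ∀ (e : E) (g : G), TensorProduct.map (push (conjAut k G g * κ e))
      (push (conjAut k G g * κ e)) (symmPart r) = symmPart r) :
    IsPoissonBracket (fockRosly Γ κ x r) :=
  isPoissonBracket_of_orderTensor x (fun α β y z => halfEdgeField_lie κ y z α β)
    Γ.order.injective hr _ (fockRosly_apply Γ κ x r) (sum_ev₃_halfEdge_eq_zero κ hinv)

/-- The value of the bracket at a point, in terms of the differentials of the functions. -/
theorem fockRosly_eval [Fintype E] [CharZero k] (Γ : CiliatedFatGraph E) (κ : E → AlgAut k G)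
    {ι : Type*} [Fintype ι] (x : Module.Basis ι k (lieAlg k G)) (r : lieAlg k G ⊗[k] lieAlg k G)
    (F F' : coordPow k G E) (g : E → G) : (fockRosly Γ κ x r F F').1 g =
      ∑ α, ∑ β, ev₂ (halfEdgeForm κ F g α) (halfEdgeForm κ F' g β)
        (orderTensor Γ.order r α β) :=
  apply_eq_sum_ev₂ (halfEdgeLin κ) (orderTensor Γ.order r) (fockRosly_apply Γ κ x r F F') g

end FockRosly

/-! ### Cocycles along the cycles of a permutation -/

section Cycles

variable {H S : Type*} [Group S] (b : Equiv.Perm H) (l : H → S)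

/-- The product of the labels of the first `n` points on the orbit of `h` under `b`, with the first
label on the right. -/
def orbitWord (h : H) (n : ℕ) : S :=
  ((List.range n).map fun m => l ((b ^ m) h)).reverse.prod

theorem orbitWord_zero (h : H) : orbitWord b l h 0 = 1 := rfl

theorem orbitWord_succ (h : H) (n : ℕ) :
    orbitWord b l h (n + 1) = l ((b ^ n) h) * orbitWord b l h n := by
  simp [orbitWord, List.range_succ]

theorem orbitWord_add (h : H) (m n : ℕ) :
    orbitWord b l h (m + n) = orbitWord b l ((b ^ n) h) m * orbitWord b l h n := by
  induction m with
  | zero => simp [orbitWord_zero]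
  | succ m ih => rw [Nat.add_right_comm, orbitWord_succ, ih, orbitWord_succ, mul_assoc, pow_add,
      Equiv.Perm.mul_apply]

/-- The product of the labels along the cycle of `h`. -/
noncomputable def cycleWord (h : H) : S := orbitWord b l h (Function.minimalPeriod b h)

theorem pow_minimalPeriod_apply (h : H) : (b ^ Function.minimalPeriod b h) h = h := by
  rw [← Equiv.Perm.iterate_eq_pow]
  exact Function.iterate_minimalPeriod

theorem pow_mod_eq_of_pow_apply_eq [Finite H] {h : H} {m n : ℕ} (hmn : (b ^ m) h = (b ^ n) h) :
    m % Function.minimalPeriod b h = n % Function.minimalPeriod b h := by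
  have hpos : 0 < Function.minimalPeriod b h :=
    Function.minimalPeriod_pos_of_mem_periodicPts
      (b.injective.mem_periodicPts h)
  refine (Function.iterate_eq_iterate_iff_of_lt_minimalPeriod (Nat.mod_lt m hpos)
    (Nat.mod_lt n hpos)).mp ?_
  rw [Function.iterate_mod_minimalPeriod_eq, Function.iterate_mod_minimalPeriod_eq,
    Equiv.Perm.iterate_eq_pow, Equiv.Perm.iterate_eq_pow, hmn]

variable {b l} {X : Type*} {A : S →* Equiv.Perm X} {p : H → X}

theorem section_pow (hp : ∀ h, p (b h) = A (l h) (p h)) (h : H) (n : ℕ) :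
    p ((b ^ n) h) = A (orbitWord b l h n) (p h) := by
  induction n with
  | zero => simp [orbitWord_zero]
  | succ n ih =>
    rw [orbitWord_succ, map_mul, Equiv.Perm.mul_apply, ← ih, ← hp, pow_succ', Equiv.Perm.mul_apply]

theorem section_cycleWord (hp : ∀ h, p (b h) = A (l h) (p h)) (h : H) :
    A (cycleWord b l h) (p h) = p h := by
  rw [cycleWord, ← section_pow hp, pow_minimalPeriod_apply]

/-- An equivariant map on a cycle may take any value at a given point that is fixed by the word of
the cycle. -/
theorem exists_section_of_fixed [Finite H] {h : H} {x : X} (hx : A (cycleWord b l h) x = x) :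
    ∃ q : H → X, q h = x ∧ ∀ h', b.SameCycle h h' → q (b h') = A (l h') (q h') := by
  classical
  have hper : Function.Periodic (fun n => A (orbitWord b l h n) x)
      (Function.minimalPeriod b h) := fun n => by
    simp only [orbitWord_add, pow_minimalPeriod_apply, map_mul, Equiv.Perm.mul_apply]
    exact congrArg _ hx
  -- different numbers of steps to the same point give the same value, as the word of the cycle
  -- fixes `x`
  have hwd : ∀ m n, (b ^ m) h = (b ^ n) h →
      A (orbitWord b l h m) x = A (orbitWord b l h n) x := fun m n hmn => by
    have h1 := hper.map_mod_nat m
    have h2 := hper.map_mod_nat n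
    rw [pow_mod_eq_of_pow_apply_eq b hmn] at h1
    exact h1.symm.trans h2
  have hex : ∀ h', b.SameCycle h h' → ∃ n : ℕ, (b ^ n) h = h' := fun h' hh =>
    hh.exists_nat_pow_eq
  choose! n hn using hex
  refine ⟨fun h' => A (orbitWord b l h (n h')) x, ?_, fun h' hh => ?_⟩
  · have := hwd (n h) 0 (by rw [hn h (Equiv.Perm.SameCycle.refl _ _)]; rfl)
    simpa [orbitWord_zero] using this
  · have := hwd (n (b h')) (n h' + 1) (by
      rw [hn _ (Equiv.Perm.sameCycle_apply_right.mpr hh), pow_succ', Equiv.Perm.mul_apply,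
        hn h' hh])
    show A (orbitWord b l h (n (b h'))) x = _
    rw [this, orbitWord_succ, map_mul, Equiv.Perm.mul_apply, hn h' hh]

variable {M : Type*} [AddCommGroup M] {T : S → X → M}

theorem cocycle_one (hT : ∀ g h x, T (g * h) x = T h x + T g (A h x)) (x : X) : T 1 x = 0 := by
  have := hT 1 1 x
  simpa using this

/-- The value of a cocycle on the word of a path is the sum of its values on the letters, each
taken at the current value of the equivariant map `p`. -/
theorem cocycle_orbitWord (hT : ∀ g h x, T (g * h) x = T h x + T g (A h x))
    (hp : ∀ h, p (b h) = A (l h) (p h)) (h : H) (n : ℕ) :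
    T (orbitWord b l h n) (p h) = ∑ m ∈ Finset.range n, T (l ((b ^ m) h)) (p ((b ^ m) h)) := by
  induction n with
  | zero => simp [orbitWord_zero, cocycle_one hT]
  | succ n ih => rw [orbitWord_succ, hT, ih, Finset.sum_range_succ, section_pow hp h n]

/-- The value of a cocycle on a fixed point only depends on the conjugacy class. -/
theorem cocycle_conj (hT : ∀ g h x, T (g * h) x = T h x + T g (A h x)) {w : S} {x : X}
    (hx : A w x = x) (g : S) : T (g * w * g⁻¹) (A g x) = T w x := by
  have h1 : T g⁻¹ (A g x) + T g x = 0 := by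
    rw [add_comm, ← hT, inv_mul_cancel, cocycle_one hT]
  have h2 : A g⁻¹ (A g x) = x := by
    rw [← Equiv.Perm.mul_apply, ← map_mul, inv_mul_cancel, map_one, Equiv.Perm.one_apply]
  rw [hT, hT, h2, hx, add_left_comm, h1, add_zero]

theorem sum_cycle_eq [Fintype H] (b : Equiv.Perm H) (f : H → M) (h : H)
    [DecidablePred (b.SameCycle h)] :
    ∑ m ∈ Finset.range (Function.minimalPeriod b h), f ((b ^ m) h) =
      ∑ h' with b.SameCycle h h', f h' := by
  have hpos : 0 < Function.minimalPeriod b h :=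
    Function.minimalPeriod_pos_of_mem_periodicPts (b.injective.mem_periodicPts h)
  refine Finset.sum_nbij (fun m => (b ^ m) h) (fun m _ => ?_) (fun m hm n hn hmn => ?_)
    (fun h' hh => ?_) (fun _ _ => rfl)
  · rw [Finset.mem_filter]
    exact ⟨Finset.mem_univ _, ⟨m, by simp⟩⟩
  · have := pow_mod_eq_of_pow_apply_eq b hmn
    rwa [Nat.mod_eq_of_lt (by simpa using hm), Nat.mod_eq_of_lt (by simpa using hn)] at this
  · obtain ⟨n, hn⟩ := (by simpa using hh : b.SameCycle h h').exists_nat_pow_eq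
    refine ⟨n % Function.minimalPeriod b h, by simpa using Nat.mod_lt n hpos, ?_⟩
    show (b ^ _) h = h'
    rw [← Equiv.Perm.iterate_eq_pow, Function.iterate_mod_minimalPeriod_eq,
      Equiv.Perm.iterate_eq_pow, hn]

/-- Another starting point conjugates the word of a cycle. -/
theorem cycleWord_apply [Finite H] (b : Equiv.Perm H) (l : H → S) (h : H) :
    cycleWord b l (b h) = l h * cycleWord b l h * (l h)⁻¹ := by
  have hper : Function.minimalPeriod b (b h) = Function.minimalPeriod b h :=
    Function.minimalPeriod_apply (b.injective.mem_periodicPts h)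
  have h1 : orbitWord b l h 1 = l h := by rw [orbitWord_succ, orbitWord_zero, mul_one]; rfl
  have h2 := orbitWord_add b l h (Function.minimalPeriod b h) 1
  rw [orbitWord_succ, pow_minimalPeriod_apply, h1, pow_one] at h2
  rw [eq_mul_inv_iff_mul_eq, cycleWord, hper, cycleWord, h2]

theorem mk_cycleWord_eq_of_sameCycle [Finite H] {h h' : H} (hh : b.SameCycle h h') :
    ConjClasses.mk (cycleWord b l h) = ConjClasses.mk (cycleWord b l h') := by
  obtain ⟨n, rfl⟩ := hh.exists_nat_pow_eq
  induction n with
  | zero => rfl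
  | succ n ih =>
    rw [ih ⟨n, by simp⟩, pow_succ', Equiv.Perm.mul_apply, cycleWord_apply]
    exact ConjClasses.mk_eq_mk_iff_isConj.mpr (isConj_iff.mpr ⟨_, rfl⟩)

/-- Suppose the cycles of two labelled permutations have pairwise distinct conjugacy classes of
words, and the same classes occur for both. Then an equivariant map for the first permutation gives
one for the second, with the same value on all cocycles. -/
theorem exists_section_matching [Fintype H] [Nonempty H] {H' : Type*} [Fintype H'] [Nonempty H']
    {b' : Equiv.Perm H'}
    {l' : H' → S}
    (hb : ∀ h₁ h₂, ConjClasses.mk (cycleWord b l h₁) = ConjClasses.mk (cycleWord b l h₂) →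
      b.SameCycle h₁ h₂)
    (hb' : ∀ h₁ h₂, ConjClasses.mk (cycleWord b' l' h₁) = ConjClasses.mk (cycleWord b' l' h₂) →
      b'.SameCycle h₁ h₂)
    (hrange : (Set.range fun h => ConjClasses.mk (cycleWord b l h)) =
      Set.range fun h => ConjClasses.mk (cycleWord b' l' h))
    (hp : ∀ h, p (b h) = A (l h) (p h)) :
    ∃ p' : H' → X, (∀ h, p' (b' h) = A (l' h) (p' h)) ∧
      ∀ T : S → X → M, (∀ g h x, T (g * h) x = T h x + T g (A h x)) →
        ∑ h, T (l h) (p h) = ∑ h, T (l' h) (p' h) := by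
  classical
  have : Nonempty X := ⟨p (Classical.arbitrary H)⟩
  let cl : H → ConjClasses S := fun h => ConjClasses.mk (cycleWord b l h)
  let cl' : H' → ConjClasses S := fun h => ConjClasses.mk (cycleWord b' l' h)
  let C : Finset (ConjClasses S) := Finset.univ.image cl
  have hC : ∀ c ∈ C, ∃ h h' g, cl h = c ∧ cl' h' = c ∧
      g * cycleWord b l h * g⁻¹ = cycleWord b' l' h' := fun c hc => by
    obtain ⟨h, -, rfl⟩ := Finset.mem_image.mp hc
    obtain ⟨h', hh⟩ : cl h ∈ Set.range cl' := hrange ▸ Set.mem_range_self h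
    obtain ⟨g, hg⟩ := isConj_iff.mp (ConjClasses.mk_eq_mk_iff_isConj.mp hh.symm)
    exact ⟨h, h', g, rfl, hh, hg⟩
  have hC' : ∀ h, cl' h ∈ C := fun h => by
    obtain ⟨h', hh⟩ : cl' h ∈ Set.range cl := by
      rw [show Set.range cl = Set.range cl' from hrange]
      exact Set.mem_range_self h
    exact Finset.mem_image.mpr ⟨h', Finset.mem_univ _, hh⟩
  -- for each class choose starting points of its two cycles, and an element conjugating their words
  choose! h h' g hh hh' hg using hC
  have hq : ∀ c ∈ C, ∃ q : H' → X, q (h' c) = A (g c) (p (h c)) ∧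
      ∀ y, b'.SameCycle (h' c) y → q (b' y) = A (l' y) (q y) := fun c hc => by
    refine exists_section_of_fixed ?_
    rw [← hg c hc, ← Equiv.Perm.mul_apply, ← map_mul, inv_mul_cancel_right, map_mul,
      Equiv.Perm.mul_apply, section_cycleWord hp]
  choose! q hq1 hq2 using hq
  have hsame' : ∀ c ∈ C, ∀ y, b'.SameCycle (h' c) y ↔ cl' y = c := fun c hc y =>
    ⟨fun h => (mk_cycleWord_eq_of_sameCycle h).symm.trans (hh' c hc),
      fun h => hb' _ _ ((hh' c hc).trans h.symm)⟩
  have hsame : ∀ c ∈ C, ∀ y, b.SameCycle (h c) y ↔ cl y = c := fun c hc y =>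
    ⟨fun h => (mk_cycleWord_eq_of_sameCycle h).symm.trans (hh c hc),
      fun h => hb _ _ ((hh c hc).trans h.symm)⟩
  have hp' : ∀ y, (fun y => q (cl' y) y) (b' y) = A (l' y) ((fun y => q (cl' y) y) y) := fun y => by
    have : cl' (b' y) = cl' y := (mk_cycleWord_eq_of_sameCycle
      (Equiv.Perm.sameCycle_apply_right.mpr (Equiv.Perm.SameCycle.refl b' y))).symm
    show q (cl' (b' y)) (b' y) = _
    rw [this]
    exact hq2 _ (hC' y) y ((hsame' _ (hC' y) y).mpr rfl)
  refine ⟨fun y => q (cl' y) y, hp', fun T hT => ?_⟩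
  rw [← Finset.sum_fiberwise_of_maps_to (s := Finset.univ) (t := C) (g := cl)
      (fun y _ => Finset.mem_image_of_mem _ (Finset.mem_univ y)),
    ← Finset.sum_fiberwise_of_maps_to (s := Finset.univ) (t := C) (g := cl')
      (fun y _ => hC' y)]
  refine Finset.sum_congr rfl fun c hc => ?_
  have e1 := (cocycle_orbitWord hT hp (h c) _).trans
    (sum_cycle_eq b (fun y => T (l y) (p y)) (h c))
  have e2 := (cocycle_orbitWord (p := fun y => q (cl' y) y) hT hp' (h' c) _).trans
    (sum_cycle_eq b' (fun y => T (l' y) (q (cl' y) y)) (h' c))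
  simp only [hsame c hc] at e1
  simp only [hsame' c hc] at e2
  refine e1.symm.trans (Eq.trans ?_ e2)
  show T (cycleWord b l (h c)) (p (h c)) = T (cycleWord b' l' (h' c)) (q (cl' (h' c)) (h' c))
  rw [hh' c hc, hq1 c hc, ← hg c hc, cocycle_conj hT (section_cycleWord hp _)]

end Cycles

/-! ### Boundary circles of a fat graph -/

namespace CiliatedFatGraph

variable {E : Type*} [Fintype E] (Γ : CiliatedFatGraph E)

theorem position_next (h : Option (HalfEdge E)) :
    Γ.position (Γ.next h) = Γ.position h + 1 := by
  simp [next]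

theorem position_none : Γ.position none = 0 := by
  simp [position]

theorem position_some (α : HalfEdge E) : Γ.position (some α) = (Γ.order α).succ := by
  simp [position]

open Fin.NatCast in
/-- The cyclic order at the vertex has a single cycle. -/
theorem eq_univ_of_next_mem {C : Set (Option (HalfEdge E))} (hC : C.Nonempty)
    (hnext : ∀ h ∈ C, Γ.next h ∈ C) : C = Set.univ := by
  obtain ⟨h, hh⟩ := hC
  have key : ∀ n : ℕ, Γ.position.symm (Γ.position h + (n : Fin (2 * Fintype.card E + 1))) ∈ C := by
    intro n
    induction n with
    | zero => simpa using hh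
    | succ n ih =>
      have := hnext _ ih
      rwa [← Γ.position.symm_apply_apply (Γ.next _), position_next, Equiv.apply_symm_apply,
        add_assoc, ← Nat.cast_succ] at this
  refine Set.eq_univ_of_forall fun h' => ?_
  have := key (Γ.position h' - Γ.position h).val
  rwa [Fin.cast_val_eq_self, add_sub_cancel, Equiv.symm_apply_apply] at this

theorem boundaryStep_some_inl (e : E) :
    Γ.boundaryStep (some (Sum.inl e)) = Γ.next (some (Sum.inr e)) := rfl

theorem boundaryStep_some_inr (e : E) :
    Γ.boundaryStep (some (Sum.inr e)) = Γ.next (some (Sum.inl e)) := rfl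

theorem boundaryStep_none : Γ.boundaryStep none = Γ.next none := rfl

/-- Different boundary circles have words that are not conjugate. Every edge is traversed once in
each direction by the boundary, so the exponent sum of an edge on a circle tells which of the two
directions occurs there, up to the ambiguity that both or none occur. If two different circles have
the same exponent sums, each of them traverses its edges in both directions; but then it is closed
under `next`, and contains all half-edges. -/
theorem sameCycle_of_mk_eq {S : Type*} [Group S] (γ : FreeGroupBasis E S)
    {h₁ h₂ : Option (HalfEdge E)}
    (h : ConjClasses.mk (cycleWord Γ.boundaryStep (letter γ) h₁) =
      ConjClasses.mk (cycleWord Γ.boundaryStep (letter γ) h₂)) :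
    Γ.boundaryStep.SameCycle h₁ h₂ := by
  classical
  -- the exponent sum of `e` on the circle of `h`
  have hsum : ∀ (e : E) (h : Option (HalfEdge E)),
      (γ.lift (fun e' => Multiplicative.ofAdd (if e' = e then (1 : ℤ) else 0))
        (cycleWord Γ.boundaryStep (letter γ) h)).toAdd =
      (if Γ.boundaryStep.SameCycle h (some (Sum.inl e)) then 1 else 0) -
        (if Γ.boundaryStep.SameCycle h (some (Sum.inr e)) then 1 else 0) := fun e h => by
    set χ := γ.lift (fun e' => Multiplicative.ofAdd (if e' = e then (1 : ℤ) else 0)) with hχ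
    have hγ : ∀ e', χ (γ e') = Multiplicative.ofAdd (if e' = e then (1 : ℤ) else 0) := fun e' => by
      simp [hχ]
    have h1 := (cocycle_orbitWord (X := Unit) (A := 1) (b := Γ.boundaryStep) (l := letter γ)
      (p := fun _ => ()) (T := fun g _ => (χ g).toAdd)
      (fun g h _ => by rw [map_mul, toAdd_mul, add_comm]) (fun _ => rfl) h _).trans
      (sum_cycle_eq Γ.boundaryStep (fun y => (χ (letter γ y)).toAdd) h)
    have h2 : ∀ y : Option (HalfEdge E), (χ (letter γ y)).toAdd =
        (if y = some (Sum.inl e) then 1 else 0) - (if y = some (Sum.inr e) then 1 else 0) := by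
      rintro (_ | e' | e')
      · simp [letter]
      · simp [letter, hγ]
      · simp [letter, hγ]
    refine h1.trans ?_
    simp only [h2, Finset.sum_sub_distrib, Finset.sum_ite_eq', Finset.mem_filter, Finset.mem_univ,
      true_and]
  by_contra hne
  have hswap : ∀ e, Γ.boundaryStep.SameCycle h₁ (some (Sum.inl e)) ↔
      Γ.boundaryStep.SameCycle h₁ (some (Sum.inr e)) := fun e => by
    have hconj := isConj_iff_eq.mp (MonoidHom.map_isConj
      (γ.lift (fun e' => Multiplicative.ofAdd (if e' = e then (1 : ℤ) else 0)))
      (ConjClasses.mk_eq_mk_iff_isConj.mp h))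
    have h1 := hsum e h₁
    rw [hconj, hsum e h₂] at h1
    have h2 : ∀ y, Γ.boundaryStep.SameCycle h₁ y → ¬ Γ.boundaryStep.SameCycle h₂ y :=
      fun y h1 h2 => hne (h1.trans h2.symm)
    have h3 := h2 (some (Sum.inl e))
    have h4 := h2 (some (Sum.inr e))
    split_ifs at h1 <;> first | omega | tauto
  have hnext : ∀ y, Γ.boundaryStep.SameCycle h₁ y → Γ.boundaryStep.SameCycle h₁ (Γ.next y) := by
    rintro (_ | e | e) hy
    · rw [← boundaryStep_none]
      exact Equiv.Perm.sameCycle_apply_right.mpr hy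
    · rw [← boundaryStep_some_inr]
      exact Equiv.Perm.sameCycle_apply_right.mpr ((hswap e).mp hy)
    · rw [← boundaryStep_some_inl]
      exact Equiv.Perm.sameCycle_apply_right.mpr ((hswap e).mpr hy)
  have huniv := Γ.eq_univ_of_next_mem (C := {y | Γ.boundaryStep.SameCycle h₁ y})
    ⟨h₁, Equiv.Perm.SameCycle.refl _ _⟩ hnext
  exact hne (huniv.ge (Set.mem_univ h₂))

end CiliatedFatGraph

/-- Equivariant maps on the boundary circles of two models of a surface correspond to each other,
with the same values on cocycles. -/
theorem FatGraphModel.exists_section {E E' S : Type*} [Fintype E] [Fintype E'] [Group S]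
    {bdry : Set (ConjClasses S)} (Γ : FatGraphModel E S bdry) (Γ' : FatGraphModel E' S bdry)
    {X M : Type*} [AddCommGroup M] (A : S →* Equiv.Perm X) {p : Option (HalfEdge E) → X}
    (hp : ∀ h, p (Γ.boundaryStep h) = A (CiliatedFatGraph.letter Γ.edge h) (p h)) :
    ∃ p' : Option (HalfEdge E') → X,
      (∀ h, p' (Γ'.boundaryStep h) = A (CiliatedFatGraph.letter Γ'.edge h) (p' h)) ∧
      ∀ T : S → X → M, (∀ g h x, T (g * h) x = T h x + T g (A h x)) →
        ∑ h, T (CiliatedFatGraph.letter Γ.edge h) (p h) =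
          ∑ h, T (CiliatedFatGraph.letter Γ'.edge h) (p' h) :=
  exists_section_matching (fun _ _ => Γ.sameCycle_of_mk_eq Γ.edge)
    (fun _ _ => Γ'.sameCycle_of_mk_eq Γ'.edge)
    (Γ.boundaryClasses_eq.trans Γ'.boundaryClasses_eq.symm) hp

/-! ### Potentials on half-edges and affine actions of free groups -/

namespace CiliatedFatGraph

variable {E : Type*} [Fintype E] (Γ : CiliatedFatGraph E)

section Potential

variable {W : Type*} [AddCommGroup W] (ξ : HalfEdge E → W)

/-- The sum of the values of `ξ` on the half-edges between the cilium and `h`. -/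
def potential (h : Option (HalfEdge E)) : W :=
  ∑ β with Γ.position (some β) < Γ.position h, ξ β

theorem potential_none : Γ.potential ξ none = 0 := by
  simp [potential, position_none]

theorem potential_next (hξ : ∑ α, ξ α = 0) (h : Option (HalfEdge E)) :
    Γ.potential ξ (Γ.next h) = Γ.potential ξ h + h.elim 0 ξ := by
  classical
  have hh : h.elim 0 ξ = ∑ β with Γ.position (some β) = Γ.position h, ξ β := by
    simp only [Γ.position.injective.eq_iff]
    cases h with
    | none => simp
    | some α => simp [Finset.sum_filter]
  have hdisj : Disjoint (Finset.univ.filter fun β => Γ.position (some β) < Γ.position h)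
      (Finset.univ.filter fun β => Γ.position (some β) = Γ.position h) :=
    Finset.disjoint_filter.mpr fun β _ h1 h2 => h1.ne h2
  rw [hh, potential, potential, ← Finset.sum_union hdisj, ← Finset.filter_or]
  simp only [← le_iff_lt_or_eq, position_next]
  by_cases hl : Γ.position h = Fin.last _
  · rw [hl, Fin.last_add_one]
    simp [Fin.le_last, hξ]
  · refine Finset.sum_congr (Finset.filter_congr fun β _ => ?_) fun _ _ => rfl
    rw [Fin.lt_def, Fin.le_def, Fin.val_add_one_of_lt (lt_of_le_of_ne (Fin.le_last _) hl)]
    omega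

/-- A map with jumps `ξ` at the half-edges is the potential of `ξ`, up to a constant. -/
theorem eq_add_potential (hξ : ∑ α, ξ α = 0) {p : Option (HalfEdge E) → W}
    (hp : ∀ h, p (Γ.next h) = p h + h.elim 0 ξ) (h : Option (HalfEdge E)) :
    p h = p none + Γ.potential ξ h := by
  have := Γ.eq_univ_of_next_mem (C := {h | p h = p none + Γ.potential ξ h})
    ⟨none, by simp [potential_none]⟩ (fun h hh => by
      show p _ = _
      rw [hp, potential_next Γ ξ hξ, ← add_assoc, show p h = _ from hh])
  exact this.ge (Set.mem_univ h)

/-- Summed with the signs of the linear order, the jumps of `p` give the sum of its values on the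
two sides of a half-edge, up to a constant. -/
theorem sum_orderSign_smul {k : Type*} [Field k] [Module k W] (hξ : ∑ α, ξ α = 0)
    {p : Option (HalfEdge E) → W} (hp : ∀ h, p (Γ.next h) = p h + h.elim 0 ξ) (β : HalfEdge E) :
    ∑ α, orderSign k Γ.order α β • ξ α = p (some β) + p (Γ.next (some β)) - (p none + p none) := by
  have h1 : ∑ α, orderSign k Γ.order α β • ξ α =
      Γ.potential ξ (some β) - ∑ α with Γ.order β < Γ.order α, ξ α := by
    simp only [potential, position_some, Fin.succ_lt_succ_iff, Finset.sum_filter,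
      ← Finset.sum_sub_distrib]
    refine Finset.sum_congr rfl fun α _ => ?_
    rw [orderSign]
    split_ifs <;> first | omega | simp
  have h2 : (∑ α with Γ.order β < Γ.order α, ξ α) + Γ.potential ξ (Γ.next (some β)) = 0 := by
    classical
    have : Γ.potential ξ (Γ.next (some β)) = ∑ α with ¬ Γ.order β < Γ.order α, ξ α := by
      rw [potential_next Γ ξ hξ, potential]
      simp only [position_some, Fin.succ_lt_succ_iff, not_lt, le_iff_lt_or_eq,
        Γ.order.injective.eq_iff, Finset.filter_or]
      rw [Finset.sum_union (Finset.disjoint_filter.mpr fun α _ h1 h2 => by simp [h2] at h1)]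
      simp [Finset.sum_filter]
    rw [this, Finset.sum_filter_add_sum_filter_not, hξ]
  rw [h1, eq_neg_of_add_eq_zero_left h2, eq_add_potential Γ ξ hξ hp (some β),
    eq_add_potential Γ ξ hξ hp (Γ.next (some β))]
  abel

end Potential

end CiliatedFatGraph

section Cocycles

variable {k S E : Type*} [Field k] [Group S]

theorem freeGroupBasis_induction (b : FreeGroupBasis E S) {P : S → Prop} (one : P 1)
    (basis : ∀ e, P (b e)) (inv : ∀ s, P s → P s⁻¹) (mul : ∀ s t, P s → P t → P (s * t)) (s : S) :
    P s := by
  obtain ⟨w, rfl⟩ := b.repr.symm.surjective s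
  induction w using FreeGroup.induction_on with
  | C1 => rwa [map_one]
  | of e => exact basis e
  | inv_of e h =>
    rw [map_inv]
    exact inv _ (basis e)
  | mul v w hv hw =>
    rw [map_mul]
    exact mul _ _ hv hw

/-- Crossed homomorphisms to a representation. -/
def IsCocycle {V : Type*} [AddCommGroup V] [Module k V] (g : S →* Module.End k V) (c : S → V) :
    Prop :=
  ∀ s t, c (s * t) = c s + g s (c t)

namespace IsCocycle

variable {V : Type*} [AddCommGroup V] [Module k V] {g : S →* Module.End k V} {c c' : S → V}

theorem apply_inv_apply (g : S →* Module.End k V) (s : S) (v : V) : g s (g s⁻¹ v) = v := by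
  rw [← Module.End.mul_apply, ← map_mul, mul_inv_cancel, map_one, Module.End.one_apply]

theorem inv_apply_apply (g : S →* Module.End k V) (s : S) (v : V) : g s⁻¹ (g s v) = v := by
  rw [← Module.End.mul_apply, ← map_mul, inv_mul_cancel, map_one, Module.End.one_apply]

theorem one (hc : IsCocycle g c) : c 1 = 0 := by
  have := hc 1 1
  simpa using this

theorem inv (hc : IsCocycle g c) (s : S) : c s⁻¹ = -g s⁻¹ (c s) := by
  have := hc s⁻¹ s
  rw [inv_mul_cancel, hc.one] at this
  exact eq_neg_of_add_eq_zero_left this.symm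

theorem ext_basis (hc : IsCocycle g c) (hc' : IsCocycle g c') (b : FreeGroupBasis E S)
    (h : ∀ e, c (b e) = c' (b e)) (s : S) : c s = c' s := by
  refine freeGroupBasis_induction b (P := fun s => c s = c' s) ?_ h (fun s hs => ?_)
    (fun s t hs ht => ?_) s
  · rw [hc.one, hc'.one]
  · rw [hc.inv, hc'.inv, hs]
  · rw [hc, hc', hs, ht]

/-- A free group has an affine action with given linear part and given translations on a basis. The
translation parts of all elements form a cocycle. -/
theorem exists_affine (g : S →* Module.End k V) (b : FreeGroupBasis E S) (v : E → V) :
    ∃ (A : S →* Equiv.Perm V) (c : S → V), IsCocycle g c ∧ (∀ s x, A s x = g s x + c s) ∧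
      ∀ e, c (b e) = v e := by
  let T : E → Equiv.Perm V := fun e =>
    { toFun := fun x => g (b e) x + v e
      invFun := fun x => g (b e)⁻¹ (x - v e)
      left_inv := fun x => by simp only [add_sub_cancel_right, inv_apply_apply]
      right_inv := fun x => by simp only [apply_inv_apply, sub_add_cancel] }
  have hT : ∀ e x, b.lift T (b e) x = g (b e) x + v e := fun e x => by simp [T]
  have hA : ∀ s, ∀ x, b.lift T s x = g s x + b.lift T s 0 := fun s => by
    refine freeGroupBasis_induction b (P := fun s => ∀ x, b.lift T s x = g s x + b.lift T s 0)
      (fun x => ?_) (fun e x => ?_) (fun s hs x => ?_) (fun s t hs ht x => ?_) s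
    · simp
    · rw [hT, hT, map_zero, zero_add]
    · have key : ∀ x, b.lift T s⁻¹ x = g s⁻¹ (x - b.lift T s 0) := fun x => by
        rw [map_inv, Equiv.Perm.inv_eq_iff_eq, hs, apply_inv_apply, sub_add_cancel]
      rw [key, key, zero_sub, map_sub, map_neg, sub_eq_add_neg]
    · simp only [map_mul, Equiv.Perm.mul_apply, Module.End.mul_apply]
      rw [hs, ht, map_add, hs (b.lift T t 0), add_assoc]
  refine ⟨b.lift T, fun s => b.lift T s 0, fun s t => ?_, hA, fun e =>
    (hT e 0).trans (by rw [map_zero, zero_add])⟩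
  show b.lift T (s * t) 0 = _
  rw [map_mul, Equiv.Perm.mul_apply, hA s, add_comm]

end IsCocycle

variable {V : Type*} [AddCommGroup V] [Module k V]

/-- The dual representation. -/
def dualAction (g : S →* Module.End k V) : S →* Module.End k (V →ₗ[k] k) where
  toFun s :=
    { toFun := fun w => w ∘ₗ g s⁻¹
      map_add' := fun _ _ => rfl
      map_smul' := fun _ _ => rfl }
  map_one' := by
    ext w v
    simp
  map_mul' s t := by
    ext w v
    simp

theorem dualAction_apply (g : S →* Module.End k V) (s : S) (w : V →ₗ[k] k) (v : V) :
    dualAction g s w v = w (g s⁻¹ v) := rfl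

/-- For an affine action of a free group on the dual of `V`, there is a cocycle `w ↦ (A s w) (l s)
+ θ s`
with values in the affine functions, with prescribed linear parts on a basis. The linear parts `l`
of any such cocycle form a cocycle with values in `V`. -/
theorem exists_affine_cocycle (g : S →* Module.End k V) (b : FreeGroupBasis E S)
    {A : S →* Equiv.Perm (V →ₗ[k] k)} {c : S → V →ₗ[k] k} (hc : IsCocycle (dualAction g) c)
    (hA : ∀ s w, A s w = dualAction g s w + c s) (v : E → V) :
    ∃ (l : S → V) (θ : S → k), IsCocycle g l ∧ (∀ e, l (b e) = v e) ∧
      ∀ s t w, (A (s * t) w) (l (s * t)) + θ (s * t) =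
        ((A t w) (l t) + θ t) + ((A s (A t w)) (l s) + θ s) := by
  -- the pair `(v, z)` stands for the affine function `w ↦ w v + z`, on which `s` acts through the
  -- affine transformation `A s⁻¹` of its argument
  let N : S →* Module.End k (V × k) :=
    { toFun := fun s =>
        { toFun := fun x => (g s x.1, x.2 + c s⁻¹ x.1)
          map_add' := fun x y => by
            ext
            · simp
            · simp [add_add_add_comm]
          map_smul' := fun a x => by
            ext
            · simp
            · simp [mul_add] }
      map_one' := by
        ext x <;> simp [hc.one]
      map_mul' := fun s t => by
        refine LinearMap.ext fun x => Prod.ext ?_ ?_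
        · simp
        · simp only [mul_inv_rev, hc t⁻¹ s⁻¹, LinearMap.add_apply, dualAction_apply, inv_inv,
            LinearMap.coe_mk, AddHom.coe_mk, Module.End.mul_apply, add_assoc] }
  have hN : ∀ s x, N s x = (g s x.1, x.2 + c s⁻¹ x.1) := fun _ _ => rfl
  obtain ⟨-, u, hu, -, hv⟩ := IsCocycle.exists_affine N b fun e => (v e, 0)
  refine ⟨fun s => (u s).1, fun s => (u s).2, fun s t => ?_, fun e => by simp [hv], fun s t w => ?_⟩
  · simp [hu s t, hN]
  · have h1 : (A (s * t) w) (g s (u t).1) = (A t w) (u t).1 - c s⁻¹ (u t).1 := by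
      rw [map_mul, Equiv.Perm.mul_apply, hA s, hc.inv, LinearMap.add_apply, dualAction_apply,
        IsCocycle.inv_apply_apply, LinearMap.neg_apply, dualAction_apply, inv_inv,
        sub_neg_eq_add]
    simp only [hu s t, hN, Prod.fst_add, Prod.snd_add, map_add, h1]
    rw [map_mul, Equiv.Perm.mul_apply]
    ring

end Cocycles

/-! ### The symmetric part of the bracket of two models -/

section EdgeForms

variable {k S V : Type*} [Field k] [Group S] [AddCommGroup V] [Module k V]

/-- Linear forms on the half-edges, as given by the differential of an invariant function: the forms
on the two halves of an edge are opposite up to the holonomy, and the sum of all of them is zero. -/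
structure IsBalanced {E : Type*} [Fintype E] (γ : E → S) (g : S →* Module.End k V)
    (ξ : HalfEdge E → V →ₗ[k] k) : Prop where
  inl_eq : ∀ e, ξ (Sum.inl e) = -(ξ (Sum.inr e) ∘ₗ g (γ e))
  sum_eq_zero : ∑ α, ξ α = 0

/-- The contraction of the first factor with a linear form. -/
noncomputable def contractLeft (t : V ⊗[k] V) : (V →ₗ[k] k) →ₗ[k] V where
  toFun w := TensorProduct.lid k V (w.rTensor V t)
  map_add' w w' := by rw [LinearMap.rTensor_add, LinearMap.add_apply, map_add]
  map_smul' a w := by rw [LinearMap.rTensor_smul, LinearMap.smul_apply, map_smul, RingHom.id_apply]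

theorem apply_contractLeft (w u : V →ₗ[k] k) (t : V ⊗[k] V) :
    u (contractLeft t w) = ev₂ w u t := by
  show u (TensorProduct.lid k V (w.rTensor V t)) = _
  induction t using TensorProduct.induction_on with
  | zero => simp
  | add s s' hs hs' => simp only [map_add, hs, hs']
  | tmul a b => simp

theorem contractLeft_map (p : V →ₗ[k] V) (w : V →ₗ[k] k) (t : V ⊗[k] V) :
    contractLeft (TensorProduct.map p p t) w = p (contractLeft t (w ∘ₗ p)) := by
  show TensorProduct.lid k V (w.rTensor V (TensorProduct.map p p t)) =
    p (TensorProduct.lid k V ((w ∘ₗ p).rTensor V t))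
  induction t using TensorProduct.induction_on with
  | zero => simp
  | add s s' hs hs' => simp only [map_add, hs, hs']
  | tmul a b => simp

theorem contractLeft_dualAction {g : S →* Module.End k V} {t : V ⊗[k] V} {s : S}
    (ht : TensorProduct.map (g s) (g s) t = t) (w : V →ₗ[k] k) :
    contractLeft t (dualAction g s w) = g s (contractLeft t w) := by
  conv_lhs => rw [← ht]
  rw [contractLeft_map]
  congr 2
  ext v
  rw [LinearMap.comp_apply, dualAction_apply, IsCocycle.inv_apply_apply]

variable {E : Type*} [Fintype E] (Γ : CiliatedFatGraph E) {γ : E → S} {g : S →* Module.End k V}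
  {ξ ξ₂ : HalfEdge E → V →ₗ[k] k} {p : Option (HalfEdge E) → V →ₗ[k] k}

theorem IsBalanced.inr_eq (hξ : IsBalanced γ g ξ) (e : E) :
    ξ (Sum.inr e) = -(dualAction g (γ e) (ξ (Sum.inl e))) := by
  ext v
  rw [hξ.inl_eq, map_neg, neg_neg, dualAction_apply, LinearMap.comp_apply,
    IsCocycle.apply_inv_apply]

/-- A map with jumps `ξ` at the half-edges is equivariant along the boundary circles for any affine
action with appropriate translation parts. -/
theorem IsBalanced.boundaryStep_eq (hξ : IsBalanced γ g ξ)
    (hp : ∀ h, p (Γ.next h) = p h + h.elim 0 ξ) {A : S →* Equiv.Perm (V →ₗ[k] k)}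
    {c : S → V →ₗ[k] k} (hA : ∀ s w, A s w = dualAction g s w + c s)
    (hc : ∀ e, c (γ e) = p (Γ.next (some (Sum.inr e))) - dualAction g (γ e) (p (some (Sum.inl e))))
    (h : Option (HalfEdge E)) :
    p (Γ.boundaryStep h) = A (CiliatedFatGraph.letter γ h) (p h) := by
  rcases h with _ | e | e
  · rw [Γ.boundaryStep_none, hp, CiliatedFatGraph.letter, map_one]
    exact add_zero _
  · rw [Γ.boundaryStep_some_inl, CiliatedFatGraph.letter, hA, hc, add_sub_cancel]
  · rw [Γ.boundaryStep_some_inr, CiliatedFatGraph.letter, map_inv, Equiv.Perm.eq_inv_iff_eq, hA, hc,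
      hp, hp, map_add]
    show _ + dualAction g (γ e) (ξ (Sum.inl e)) + (_ + ξ (Sum.inr e) - _) = _
    rw [hξ.inr_eq]
    abel

/-- The sum along the boundary circles of the values of a cocycle of affine functions. -/
theorem sum_affine_cocycle {A : S →* Equiv.Perm (V →ₗ[k] k)}
    (hp : ∀ h, p (Γ.boundaryStep h) = A (CiliatedFatGraph.letter γ h) (p h)) {l : S → V}
    {θ : S → k} (hl : ∀ s t w, (A (s * t) w) (l (s * t)) + θ (s * t) =
        ((A t w) (l t) + θ t) + ((A s (A t w)) (l s) + θ s)) :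
    ∑ h, ((A (CiliatedFatGraph.letter γ h) (p h)) (l (CiliatedFatGraph.letter γ h)) +
        θ (CiliatedFatGraph.letter γ h)) =
      ∑ e, (p (Γ.next (some (Sum.inr e))) - p (some (Sum.inr e))) (l (γ e)) := by
  have h1 : ∀ w, (A 1 w) (l 1) + θ 1 = 0 := fun w => by
    have := hl 1 1 w
    simpa using this
  have h2 : ∀ s w, (A s⁻¹ w) (l s⁻¹) + θ s⁻¹ = -(w (l s) + θ s) := fun s w => by
    have := hl s s⁻¹ w
    rw [mul_inv_cancel, h1, ← Equiv.Perm.mul_apply, ← map_mul, mul_inv_cancel, map_one,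
      Equiv.Perm.one_apply] at this
    exact eq_neg_of_add_eq_zero_left this.symm
  rw [Fintype.sum_option, Fintype.sum_sum_type]
  simp only [CiliatedFatGraph.letter, h1, h2, zero_add]
  rw [← Finset.sum_add_distrib]
  refine Finset.sum_congr rfl fun e _ => ?_
  have := hp (some (Sum.inl e))
  rw [Γ.boundaryStep_some_inl, CiliatedFatGraph.letter] at this
  rw [← this, LinearMap.sub_apply]
  ring

/-- The contribution of the symmetric part `t` to the bracket only depends on the pairing of `ξ₂`
with
the translation parts of an affine action that makes the potential of `ξ` equivariant. -/
theorem IsBalanced.sum_orderSign_eq (hξ : IsBalanced γ g ξ) (hξ₂ : IsBalanced γ g ξ₂)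
    (hp : ∀ h, p (Γ.next h) = p h + h.elim 0 ξ) {t : V ⊗[k] V}
    (ht : ∀ s, TensorProduct.map (g s) (g s) t = t) :
    ∑ α, ∑ β, orderSign k Γ.order α β * ev₂ (ξ α) (ξ₂ β) t = 2 * ∑ e, ξ₂ (Sum.inr e) (contractLeft t
      (p (Γ.next (some (Sum.inr e))) - dualAction g (γ e) (p (some (Sum.inl e))))) := by
  have h1 : ∀ β, ∑ α, orderSign k Γ.order α β * ev₂ (ξ α) (ξ₂ β) t =
      ξ₂ β (contractLeft t (p (some β) + p (Γ.next (some β)))) -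
        ξ₂ β (contractLeft t (p none + p none)) := fun β => by
    rw [← LinearMap.map_sub (ξ₂ β), ← LinearMap.map_sub (contractLeft t),
      ← Γ.sum_orderSign_smul (k := k) ξ hξ.sum_eq_zero hp β, map_sum, map_sum]
    refine Finset.sum_congr rfl fun α _ => ?_
    rw [map_smul, map_smul, apply_contractLeft, smul_eq_mul]
  have h2 : ∀ e w, ξ₂ (Sum.inl e) (contractLeft t w) =
      -ξ₂ (Sum.inr e) (contractLeft t (dualAction g (γ e) w)) := fun e w => by
    rw [hξ₂.inl_eq, LinearMap.neg_apply, LinearMap.comp_apply, contractLeft_dualAction (ht _)]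
  rw [Finset.sum_comm]
  simp only [h1, Finset.sum_sub_distrib]
  rw [← LinearMap.sum_apply, hξ₂.sum_eq_zero, LinearMap.zero_apply, sub_zero, Fintype.sum_sum_type,
    ← Finset.sum_add_distrib, Finset.mul_sum]
  refine Finset.sum_congr rfl fun e _ => ?_
  have e1 : p (Γ.next (some (Sum.inl e))) = p (some (Sum.inl e)) + ξ (Sum.inl e) := hp _
  have e2 : p (Γ.next (some (Sum.inr e))) = p (some (Sum.inr e)) + ξ (Sum.inr e) := hp _
  rw [h2, e1, e2, hξ.inr_eq e]
  simp only [map_add, map_sub, map_neg]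
  ring

end EdgeForms

/-- For balanced families of forms on two models of a surface that define the same functionals on
cocycles, the symmetric part of the bracket is the same. The potential of `ξ₁` is equivariant along
the boundary circles for an affine action, and hence there is an equivariant map on the boundary
circles of the other model. As cocycles of affine functions cannot distinguish the two, the jumps of
the latter are `ξ₁'`. -/
theorem FatGraphModel.sum_orderSign_eq {k S V E E' : Type*} [Field k] [Group S] [AddCommGroup V]
    [Module k V] [Fintype E] [Fintype E'] {bdry : Set (ConjClasses S)}
    (Γ : FatGraphModel E S bdry) (Γ' : FatGraphModel E' S bdry) {g : S →* Module.End k V}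
    {t : V ⊗[k] V} (ht : ∀ s, TensorProduct.map (g s) (g s) t = t)
    {ξ₁ ξ₂ : HalfEdge E → V →ₗ[k] k} {ξ₁' ξ₂' : HalfEdge E' → V →ₗ[k] k}
    (hξ₁ : IsBalanced Γ.edge g ξ₁) (hξ₂ : IsBalanced Γ.edge g ξ₂)
    (hξ₁' : IsBalanced Γ'.edge g ξ₁') (hξ₂' : IsBalanced Γ'.edge g ξ₂')
    (h₁ : ∀ l, IsCocycle g l →
      ∑ e, ξ₁ (Sum.inr e) (l (Γ.edge e)) = ∑ e, ξ₁' (Sum.inr e) (l (Γ'.edge e)))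
    (h₂ : ∀ l, IsCocycle g l →
      ∑ e, ξ₂ (Sum.inr e) (l (Γ.edge e)) = ∑ e, ξ₂' (Sum.inr e) (l (Γ'.edge e))) :
    ∑ α, ∑ β, orderSign k Γ.order α β * ev₂ (ξ₁ α) (ξ₂ β) t =
      ∑ α, ∑ β, orderSign k Γ'.order α β * ev₂ (ξ₁' α) (ξ₂' β) t := by
  classical
  have hp := Γ.potential_next ξ₁ hξ₁.sum_eq_zero
  set p := Γ.potential ξ₁ with hpdef
  obtain ⟨A, c, hc, hA, hcb⟩ := IsCocycle.exists_affine (dualAction g) Γ.edge fun e =>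
    p (Γ.next (some (Sum.inr e))) - dualAction g (Γ.edge e) (p (some (Sum.inl e)))
  have hsec := hξ₁.boundaryStep_eq Γ.toCiliatedFatGraph hp hA hcb
  obtain ⟨p', hsec', hT⟩ := Γ.exists_section (M := k) Γ' A hsec
  have hjump : ∀ e, p' (Γ'.next (some (Sum.inr e))) = p' (some (Sum.inr e)) + ξ₁' (Sum.inr e) := by
    intro e₀
    rw [← sub_eq_iff_eq_add']
    ext v
    -- test the jump at `e₀` by a cocycle with value `v` on `e₀` and `0` on the other edges
    obtain ⟨l, θ, hl, hlv, hlθ⟩ := exists_affine_cocycle g Γ'.edge hc hA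
      fun e => if e = e₀ then v else 0
    have e1 := hT (fun s w => (A s w) (l s) + θ s) hlθ
    rw [sum_affine_cocycle Γ.toCiliatedFatGraph hsec hlθ,
      sum_affine_cocycle Γ'.toCiliatedFatGraph hsec' hlθ] at e1
    have e2 : ∀ e, p (Γ.next (some (Sum.inr e))) - p (some (Sum.inr e)) = ξ₁ (Sum.inr e) :=
      fun e => sub_eq_iff_eq_add'.mpr (hp _)
    simp only [e2, h₁ l hl, hlv, apply_ite, map_zero, Finset.sum_ite_eq', Finset.mem_univ,
      if_true] at e1
    exact e1.symm
  have hp' : ∀ h, p' (Γ'.next h) = p' h + h.elim 0 ξ₁' := by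
    rintro (_ | e | e)
    · rw [← Γ'.boundaryStep_none, hsec', CiliatedFatGraph.letter, map_one]
      exact (add_zero _).symm
    · have e1 := hsec' (some (Sum.inl e))
      have e2 := hsec' (some (Sum.inr e))
      rw [Γ'.boundaryStep_some_inl, CiliatedFatGraph.letter, hjump, hA] at e1
      rw [Γ'.boundaryStep_some_inr, CiliatedFatGraph.letter, map_inv, Equiv.Perm.eq_inv_iff_eq,
        hA] at e2
      have e3 : dualAction g (Γ'.edge e) (p' (Γ'.next (some (Sum.inl e)))) =
          dualAction g (Γ'.edge e) (p' (some (Sum.inl e)) + ξ₁' (Sum.inl e)) := by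
        rw [hξ₁'.inr_eq, ← e2] at e1
        rw [map_add]
        rw [← sub_eq_zero] at e1 ⊢
        rw [← e1]
        abel
      have e4 := congrArg (dualAction g (Γ'.edge e)⁻¹) e3
      rwa [IsCocycle.inv_apply_apply, IsCocycle.inv_apply_apply] at e4
    · exact hjump e
  have hcb' : ∀ e, c (Γ'.edge e) =
      p' (Γ'.next (some (Sum.inr e))) - dualAction g (Γ'.edge e) (p' (some (Sum.inl e))) := by
    intro e
    have e1 := hsec' (some (Sum.inl e))
    rw [Γ'.boundaryStep_some_inl, CiliatedFatGraph.letter, hA] at e1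
    rw [e1, add_sub_cancel_left]
  rw [hξ₁.sum_orderSign_eq Γ.toCiliatedFatGraph hξ₂ hp ht,
    hξ₁'.sum_orderSign_eq Γ'.toCiliatedFatGraph hξ₂' hp' ht]
  simp only [← hcb, ← hcb']
  -- the contraction of `t` with the translation parts is a cocycle, by invariance of `t`
  refine congrArg (2 * ·) (h₂ (fun s => contractLeft t (c s)) fun s s' => ?_)
  show contractLeft t (c (s * s')) = _
  rw [hc, map_add, contractLeft_dualAction (ht s)]

/-! ### Differentials of functions on the representation variety -/

theorem neg_comp_comp_eq {k V : Type*} [Field k] [AddCommGroup V] [Module k V] (u : V →ₗ[k] k)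
    {p q r : V →ₗ[k] V} (h : ∀ x, p (r x) = r (q x)) :
    (-(u ∘ₗ p)) ∘ₗ r = -((u ∘ₗ r) ∘ₗ q) :=
  LinearMap.ext fun x => congrArg (fun y => -u y) (h x)

namespace TwistedHom

variable {k G S : Type*} [Field k] [Group G] [AffineAlgebraicGroup k G] [Group S]
  {ρ : S →* AlgAut k G}

theorem regular_apply (s : S) : IsRegularMap (coordM ρ) fun φ => φ.toFun s :=
  fun f hf => Algebra.subset_adjoin ⟨s, f, hf, rfl⟩

/-- Pull-back of functions along a map to `ℳ_ρ^∘(Σ)`. -/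
def pullM {Y : Type*} {B : Subalgebra k (Y → k)} (c : Y → TwistedHom ρ)
    (hc : ∀ s, IsRegularMap B fun y => (c y).toFun s) : coordM ρ →ₐ[k] B where
  toFun F := ⟨fun y => F.1 (c y), by
    obtain ⟨F, hF⟩ := F
    induction hF using Algebra.adjoin_induction with
    | mem F h => obtain ⟨s, f, hf, rfl⟩ := h; exact hc s f hf
    | algebraMap r => exact B.algebraMap_mem r
    | add x y _ _ hx hy => exact B.add_mem hx hy
    | mul x y _ _ hx hy => exact B.mul_mem hx hy⟩
  map_one' := rfl
  map_mul' _ _ := rfl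
  map_zero' := rfl
  map_add' _ _ := rfl
  commutes' _ := rfl

theorem isPointDer_pullM {Y : Type*} {B : Subalgebra k (Y → k)} {c : Y → TwistedHom ρ}
    (hc : ∀ s, IsRegularMap B fun y => (c y).toFun s) {y : Y} {D : B →ₗ[k] k}
    (hD : IsPointDer y D) : IsPointDer (c y) (D ∘ₗ (pullM c hc).toLinearMap) where
  leibniz F F' := by
    rw [LinearMap.comp_apply, AlgHom.toLinearMap_apply, map_mul, hD.leibniz]
    rfl

theorem logDer_pullM {Y : Type*} {B : Subalgebra k (Y → k)} {c : Y → TwistedHom ρ}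
    (hc : ∀ s, IsRegularMap B fun y => (c y).toFun s) {y : Y} {D : B →ₗ[k] k}
    (hD : IsPointDer y D) (s : S) :
    logDer (isPointDer_pullM hc hD) (regular_apply s) = logDer hD (hc s) :=
  logDer_eq_of _ _ _ fun f => apply_pullTo hD (hc s) f

/-- The automorphisms `Ad(φ s) ∘ ρ s` of `G` given by a twisted homomorphism. -/
def holAut (φ : TwistedHom ρ) : S →* AlgAut k G where
  toFun s := conjAut k G (φ.toFun s) * ρ s
  map_one' := by
    rw [φ.map_one, _root_.map_one, _root_.map_one, one_mul]
  map_mul' s t := by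
    refine Subtype.ext (MulEquiv.ext fun u => ?_)
    show φ.toFun (s * t) * (ρ (s * t)).1 u * (φ.toFun (s * t))⁻¹ =
      φ.toFun s * (ρ s).1 (φ.toFun t * (ρ t).1 u * (φ.toFun t)⁻¹) * (φ.toFun s)⁻¹
    rw [φ.map_mul', _root_.map_mul]
    simp [mul_assoc]

theorem holAut_gauge (φ : TwistedHom ρ) (h : G) (s : S) :
    (φ.gauge h).holAut s * conjAut k G h = conjAut k G h * φ.holAut s := by
  refine Subtype.ext (MulEquiv.ext fun u => ?_)
  show h * φ.toFun s * (ρ s).1 h⁻¹ * (ρ s).1 (h * u * h⁻¹) * (h * φ.toFun s * (ρ s).1 h⁻¹)⁻¹ =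
    h * (φ.toFun s * (ρ s).1 u * (φ.toFun s)⁻¹) * h⁻¹
  simp [mul_assoc]

/-- The action of the fundamental group on `𝔤` given by a twisted homomorphism. -/
def holRep (φ : TwistedHom ρ) : S →* Module.End k (lieAlg k G) where
  toFun s := push (φ.holAut s)
  map_one' := LinearMap.ext fun x => by
    rw [_root_.map_one]
    exact push_one x
  map_mul' s t := LinearMap.ext fun x => by
    rw [_root_.map_mul]
    exact push_mul _ _ x

theorem holRep_apply (φ : TwistedHom ρ) (s : S) (x : lieAlg k G) :
    φ.holRep s x = push (φ.holAut s) x := rfl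

theorem holRep_gauge (φ : TwistedHom ρ) (h : G) (s : S) (x : lieAlg k G) :
    (φ.gauge h).holRep s (push (conjAut k G h) x) = push (conjAut k G h) (φ.holRep s x) := by
  rw [holRep_apply, holRep_apply, ← push_mul, ← push_mul, holAut_gauge]

/-- The tangent vectors of `ℳ_ρ^∘(Σ)` at `φ` are cocycles with values in `𝔤`, on which `s` acts by
`Ad(φ s) ∘ ρ s`. -/
theorem isCocycle_logDer {φ : TwistedHom ρ} {D : coordM ρ →ₗ[k] k} (hD : IsPointDer φ D) :
    IsCocycle φ.holRep fun s => logDer hD (regular_apply s) := fun s t => by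
  show logDer hD (regular_apply (s * t)) = _
  rw [logDer_congr hD (regular_apply (s * t))
    ((regular_apply s).mul (comp_regular (ρ s) (regular_apply t))) fun φ => φ.map_mul' s t,
    logDer_mul hD (regular_apply s) (comp_regular (ρ s) (regular_apply t)), logDer_comp, ← push_mul]
  rfl

theorem ext_coordM {φ : TwistedHom ρ} {D D' : coordM ρ →ₗ[k] k} (hD : IsPointDer φ D)
    (hD' : IsPointDer φ D') {E : Type*} (b : FreeGroupBasis E S)
    (h : ∀ e, logDer hD (regular_apply (b e)) = logDer hD' (regular_apply (b e))) : D = D' := by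
  have h' := (isCocycle_logDer hD).ext_basis (isCocycle_logDer hD') b h
  refine hD.ext_adjoin rfl hD' ?_
  rintro ⟨_, hF⟩ ⟨s, f, hf, rfl⟩
  have e1 := apply_pullTo hD (regular_apply s) ⟨f, hf⟩
  rw [show logDer hD (regular_apply s) = logDer hD' (regular_apply s) from h' s,
    ← apply_pullTo hD'] at e1
  exact e1

section Edges

variable {E : Type*} [DecidableEq E] (b : FreeGroupBasis E S)

/-- The linear forms given by the differential of a function at `φ`, for the half-edges. -/
noncomputable def edgeForm (φ : TwistedHom ρ) (F : coordM ρ) : HalfEdge E → lieAlg k G →ₗ[k] k :=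
  halfEdgeForm (fun e => ρ (b e)) ((holPullback b ρ).symm F) (hol b ρ φ)

theorem edgeForm_inl (φ : TwistedHom ρ) (F : coordM ρ) (e : E) :
    edgeForm b φ F (Sum.inl e) = -(edgeForm b φ F (Sum.inr e) ∘ₗ φ.holRep (b e)) :=
  halfEdgeForm_inl _ _ _ _

variable [Fintype E]

/-- The tangent vector of `ℳ_ρ^∘(Σ)` with the given components on the free generators. -/
noncomputable def edgeDer (φ : TwistedHom ρ) (v : E → lieAlg k G) : coordM ρ →ₗ[k] k :=
  (∑ e, evalAt (coordPow k G E) (hol b ρ φ) ∘ₗ (rightField e (v e) : coordPow k G E →ₗ[k] _)) ∘ₗ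
    (holPullback b ρ).symm.toLinearMap

theorem edgeDer_apply (φ : TwistedHom ρ) (v : E → lieAlg k G) (F : coordM ρ) :
    edgeDer b φ v F = ∑ e, (rightField e (v e) ((holPullback b ρ).symm F)).1 (hol b ρ φ) := by
  rw [edgeDer, LinearMap.comp_apply, LinearMap.sum_apply]
  rfl

theorem isPointDer_edgeDer (φ : TwistedHom ρ) (v : E → lieAlg k G) :
    IsPointDer φ (edgeDer b φ v) where
  leibniz F F' := by
    have h := IsPointDer.sum Finset.univ fun e _ =>
      isPointDer_of_derivation (hol b ρ φ) (rightField e (v e))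
    have := h.leibniz ((holPullback b ρ).symm F) ((holPullback b ρ).symm F')
    rw [edgeDer, LinearMap.comp_apply, AlgEquiv.toLinearMap_apply, _root_.map_mul]
    refine this.trans ?_
    have h1 : ∀ F : coordM ρ, ((holPullback b ρ).symm F).1 (hol b ρ φ) = F.1 φ := fun F =>
      congrArg F.1 ((hol b ρ).symm_apply_apply φ)
    rw [h1, h1]
    rfl

theorem logDer_edgeDer (φ : TwistedHom ρ) (v : E → lieAlg k G) (e : E) :
    logDer (isPointDer_edgeDer b φ v) (regular_apply (b e)) = v e := by
  refine logDer_eq_of _ _ _ fun f => ?_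
  have h1 : (holPullback b ρ).symm (pullTo _ (regular_apply (b e)) f) = gen e f :=
    (AlgEquiv.symm_apply_eq _).mpr rfl
  rw [edgeDer_apply, h1]
  refine (Finset.sum_eq_single e (fun e' _ he => ?_) fun h => absurd (Finset.mem_univ e) h).trans ?_
  · rw [rightField_gen, if_neg he.symm]
    rfl
  · rw [rightField_gen, if_pos rfl]
    rfl

/-- A tangent vector is determined by its components. -/
theorem eq_edgeDer {φ : TwistedHom ρ} {D : coordM ρ →ₗ[k] k} (hD : IsPointDer φ D) :
    D = edgeDer b φ fun e => logDer hD (regular_apply (b e)) :=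
  ext_coordM hD (isPointDer_edgeDer b φ _) b fun e =>
    (logDer_edgeDer b φ (fun e => logDer hD (regular_apply (b e))) e).symm

/-- The tangent vector with the components of a cocycle is the same for all systems of free
generators. -/
theorem edgeDer_eq_of_isCocycle {E' : Type*} [Fintype E'] [DecidableEq E']
    (b' : FreeGroupBasis E' S) (φ : TwistedHom ρ) {l : S → lieAlg k G}
    (hl : IsCocycle φ.holRep l) :
    edgeDer b φ (fun e => l (b e)) = edgeDer b' φ fun e => l (b' e) := by
  have h := (isCocycle_logDer (isPointDer_edgeDer b φ fun e => l (b e))).ext_basis hl b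
    (logDer_edgeDer b φ _)
  rw [eq_edgeDer b' (isPointDer_edgeDer b φ fun e => l (b e))]
  exact congrArg _ (funext fun e => h (b' e))

theorem sum_edgeForm_inr (φ : TwistedHom ρ) (F : coordM ρ) (v : E → lieAlg k G) :
    ∑ e, edgeForm b φ F (Sum.inr e) (v e) = -edgeDer b φ v F := by
  rw [edgeDer_apply, ← Finset.sum_neg_distrib]
  rfl

theorem edgeForm_inr (φ : TwistedHom ρ) (F : coordM ρ) (e : E) (x : lieAlg k G) :
    edgeForm b φ F (Sum.inr e) x = -edgeDer b φ (fun e' => if e' = e then x else 0) F := by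
  rw [← sum_edgeForm_inr, Finset.sum_eq_single e (fun e' _ he => ?_)
    fun h => absurd (Finset.mem_univ e) h, if_pos rfl]
  rw [if_neg he, LinearMap.map_zero]

theorem regular_gauge (φ : TwistedHom ρ) (s : S) :
    IsRegularMap (coord k G) fun h => (φ.gauge h).toFun s :=
  (IsRegularMap.id.mul (IsRegularMap.const _)).mul (comp_regular (ρ s) IsRegularMap.id.inv)

theorem gauge_regular (h : G) (s : S) :
    IsRegularMap (coordM ρ) fun φ => (φ.gauge h).toFun s :=
  ((IsRegularMap.const h).mul (regular_apply s)).mul (IsRegularMap.const _)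

theorem gauge_one (φ : TwistedHom ρ) : φ.gauge 1 = φ := by
  ext s
  simp [gauge]

/-- The tangent vectors of the gauge orbit of `φ` are coboundaries. -/
theorem logDer_gauge (φ : TwistedHom ρ) (x : lieAlg k G) (s : S) :
    logDer (isPointDer_lieAlg x) (regular_gauge φ s) = x - φ.holRep s x := by
  have h1 : logDer (isPointDer_lieAlg x)
      (IsRegularMap.id.mul (IsRegularMap.const (φ.toFun s))) = x := by
    rw [logDer_mul (isPointDer_lieAlg x) IsRegularMap.id (IsRegularMap.const (φ.toFun s)),
      logDer_const, logDer_id, LinearMap.map_zero, add_zero]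
  have h2 : logDer (isPointDer_lieAlg x) (IsRegularMap.id (k := k) (G := G)).inv = -x := by
    rw [logDer_inv (isPointDer_lieAlg x) IsRegularMap.id, logDer_id, inv_one, _root_.map_one,
      push_one]
  have h3 : logDer (isPointDer_lieAlg x)
      (comp_regular (ρ s) (IsRegularMap.id (k := k) (G := G)).inv) = push (ρ s) (-x) :=
    (logDer_comp (isPointDer_lieAlg x) _ (ρ s)).trans (congrArg _ h2)
  have h4 := logDer_mul (isPointDer_lieAlg x)
    (IsRegularMap.id.mul (IsRegularMap.const (φ.toFun s)))
    (comp_regular (ρ s) (IsRegularMap.id (k := k) (G := G)).inv)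
  have h5 : push (conjAut k G (1 * φ.toFun s)) (push (ρ s) (-x)) = -φ.holRep s x := by
    rw [one_mul, ← push_mul]
    exact LinearMap.map_neg (push (φ.holAut s)) x
  rw [h1, h3, h5, ← sub_eq_add_neg] at h4
  exact h4

/-- The differential of an invariant function vanishes along the gauge orbits. -/
theorem isBalanced_edgeForm (φ : TwistedHom ρ) {F : coordM ρ} (hF : F ∈ invariants ρ) :
    IsBalanced b φ.holRep (edgeForm b φ F) where
  inl_eq := edgeForm_inl b φ F
  sum_eq_zero := by
    refine LinearMap.ext fun x => ?_
    have h1 : (∑ α, edgeForm b φ F α) x =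
        ∑ e, edgeForm b φ F (Sum.inr e) (x - φ.holRep (b e) x) := by
      rw [Fintype.sum_sum_type, ← Finset.sum_add_distrib, LinearMap.sum_apply]
      refine Finset.sum_congr rfl fun e _ => ?_
      rw [edgeForm_inl, LinearMap.map_sub, LinearMap.add_apply, LinearMap.neg_apply,
        LinearMap.comp_apply, neg_add_eq_sub]
    have hD := isPointDer_pullM (regular_gauge φ) (isPointDer_lieAlg x)
    have h2 : ∀ (φ' : TwistedHom ρ) (hφ : φ' = φ) (D : coordM ρ →ₗ[k] k) (hD : IsPointDer φ' D),
        D = edgeDer b φ fun e => logDer hD (regular_apply (b e)) := by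
      rintro _ rfl D hD
      exact eq_edgeDer b hD
    have h5 : ∀ e, logDer hD (regular_apply (b e)) = x - φ.holRep (b e) x := fun e =>
      (logDer_pullM (regular_gauge φ) (isPointDer_lieAlg x) (b e)).trans (logDer_gauge φ x (b e))
    have h3 := (h2 _ (gauge_one φ) _ hD).trans (congrArg (edgeDer b φ) (funext h5))
    rw [h1, sum_edgeForm_inr, ← h3, LinearMap.zero_apply, neg_eq_zero]
    have h4 : pullM (fun h => φ.gauge h) (regular_gauge φ) F =
        algebraMap k (coord k G) (F.1 φ) := by
      ext h
      exact hF h φ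
    show (x.1 (pullM (fun h => φ.gauge h) (regular_gauge φ) F)).1 1 = 0
    rw [h4, Derivation.map_algebraMap]
    rfl

/-- Gauge transformations act by the adjoint action on the differential of an invariant function. -/
theorem edgeForm_gauge (φ : TwistedHom ρ) {F : coordM ρ} (hF : F ∈ invariants ρ) (h : G)
    (α : HalfEdge E) :
    edgeForm b (φ.gauge h) F α ∘ₗ push (conjAut k G h) = edgeForm b φ F α := by
  have h1 : ∀ v : E → lieAlg k G, edgeDer b (φ.gauge h) (fun e => push (conjAut k G h) (v e)) F =
      edgeDer b φ v F := fun v => by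
    have hD := isPointDer_pullM (gauge_regular h) (isPointDer_edgeDer b φ v)
    have h2 : ∀ e, logDer hD (regular_apply (b e)) = push (conjAut k G h) (v e) := fun e => by
      have h4 := logDer_mul (isPointDer_edgeDer b φ v) (IsRegularMap.const h) (regular_apply (b e))
      rw [logDer_const, logDer_edgeDer, zero_add] at h4
      have h5 := logDer_mul (isPointDer_edgeDer b φ v)
        ((IsRegularMap.const h).mul (regular_apply (b e)))
        (IsRegularMap.const ((ρ (b e)).1 h⁻¹))
      rw [h4, logDer_const, LinearMap.map_zero, add_zero] at h5
      exact (logDer_pullM (gauge_regular h) (isPointDer_edgeDer b φ v) (b e)).trans h5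
    have h3 := (eq_edgeDer b hD).trans (congrArg (edgeDer b (φ.gauge h)) (funext h2))
    rw [← h3]
    show edgeDer b φ v (pullM (fun φ => φ.gauge h) (gauge_regular h) F) = _
    congr 1
    ext φ
    exact hF h φ
  have hinr : ∀ e, edgeForm b (φ.gauge h) F (Sum.inr e) ∘ₗ push (conjAut k G h) =
      edgeForm b φ F (Sum.inr e) := fun e => by
    refine LinearMap.ext fun x => ?_
    show edgeForm b (φ.gauge h) F (Sum.inr e) (push (conjAut k G h) x) = _
    rw [edgeForm_inr, edgeForm_inr, ← h1]
    refine congrArg (fun v => -edgeDer b (φ.gauge h) v F) (funext fun e' => ?_)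
    split_ifs
    · rfl
    · exact (LinearMap.map_zero _).symm
  rcases α with e | e
  · rw [edgeForm_inl, edgeForm_inl, ← hinr]
    exact neg_comp_comp_eq _ (holRep_gauge φ h (b e))
  · exact hinr e

end Edges

end TwistedHom

/-! ### The bracket of invariant functions -/

section Invariants

variable {k L H : Type*} [Field k] [LieRing L] [LieAlgebra k L] [Fintype H]

/-- The antisymmetric part of `r` does not contribute to the bracket of invariant functions. -/
theorem sum_ev₂_orderTensor {n : ℕ} (o : H → Fin n) (r : L ⊗[k] L) {ξ ξ' : H → L →ₗ[k] k}
    (hξ : ∑ α, ξ α = 0) : ∑ α, ∑ β, ev₂ (ξ α) (ξ' β) (orderTensor o r α β) =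
      (1 / 2) * ∑ α, ∑ β, orderSign k o α β * ev₂ (ξ α) (ξ' β) (symmPart r) := by
  have h1 : ∀ β, ∑ α, ev₂ (ξ α) (ξ' β) (antisymmPart r) = 0 := fun β => by
    simp only [← apply_contractLeft]
    rw [← map_sum, ← map_sum, hξ, map_zero, map_zero]
  have h2 : ∑ α, ∑ β, ev₂ (ξ α) (ξ' β) (antisymmPart r) = 0 := by
    rw [Finset.sum_comm]
    exact Finset.sum_eq_zero fun β _ => h1 β
  simp only [orderTensor, map_add, map_smul, Finset.sum_add_distrib, h2, zero_add, Finset.mul_sum,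
    smul_eq_mul]
  refine Finset.sum_congr rfl fun α _ => Finset.sum_congr rfl fun β _ => ?_
  ring

theorem sum_orderSign_comp {n : ℕ} (o : H → Fin n) {t : L ⊗[k] L} {ξ ξ' η η' : H → L →ₗ[k] k}
    (p : L →ₗ[k] L) (ht : TensorProduct.map p p t = t) (hξ : ∀ α, ξ α ∘ₗ p = η α)
    (hξ' : ∀ α, ξ' α ∘ₗ p = η' α) :
    ∑ α, ∑ β, orderSign k o α β * ev₂ (ξ α) (ξ' β) t =
      ∑ α, ∑ β, orderSign k o α β * ev₂ (η α) (η' β) t := by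
  refine Finset.sum_congr rfl fun α _ => Finset.sum_congr rfl fun β _ => ?_
  rw [← hξ, ← hξ', ← apply_contractLeft, ← apply_contractLeft]
  conv_lhs => rw [← ht, contractLeft_map]
  rfl

theorem comm_map (p : L →ₗ[k] L) (r : L ⊗[k] L) :
    TensorProduct.comm k L L (TensorProduct.map p p r) =
      TensorProduct.map p p (TensorProduct.comm k L L r) := by
  induction r using TensorProduct.induction_on with
  | zero => simp
  | add s s' hs hs' => simp only [map_add, hs, hs']
  | tmul a b => simp

theorem map_symmPart {p : L →ₗ[k] L} {r : L ⊗[k] L} (hp : TensorProduct.map p p r = r) :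
    TensorProduct.map p p (symmPart r) = symmPart r := by
  rw [symmPart, map_add, ← comm_map, hp]

end Invariants

section Bracket

variable {k G S : Type*} [Field k] [Group G] [AffineAlgebraicGroup k G] [Group S]
  {ρ : S →* AlgAut k G} {E : Type*} [Fintype E] [DecidableEq E] {bdry : Set (ConjClasses S)}
  (Γ : FatGraphModel E S bdry)

open TwistedHom

/-- The value of the bracket at `φ` in terms of the differentials at `φ`. -/
theorem FatGraphModel.bracket_apply [CharZero k] {ι : Type*} [Fintype ι]
    (x : Module.Basis ι k (lieAlg k G)) (r : lieAlg k G ⊗[k] lieAlg k G) (F F' : coordM ρ)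
    (φ : TwistedHom ρ) : (Γ.bracket ρ x r F F').1 φ =
      ∑ α, ∑ β, ev₂ (edgeForm Γ.edge φ F α) (edgeForm Γ.edge φ F' β)
        (orderTensor Γ.order r α β) :=
  fockRosly_eval Γ.toCiliatedFatGraph (fun e => ρ (Γ.edge e)) x r ((holPullback Γ.edge ρ).symm F)
    ((holPullback Γ.edge ρ).symm F') (hol Γ.edge ρ φ)

theorem FatGraphModel.bracket_apply_of_mem_invariants [CharZero k] {ι : Type*} [Fintype ι]
    (x : Module.Basis ι k (lieAlg k G)) (r : lieAlg k G ⊗[k] lieAlg k G) {F F' : coordM ρ}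
    (hF : F ∈ invariants ρ) (φ : TwistedHom ρ) : (Γ.bracket ρ x r F F').1 φ =
      (1 / 2) * ∑ α, ∑ β, orderSign k Γ.order α β *
        ev₂ (edgeForm Γ.edge φ F α) (edgeForm Γ.edge φ F' β) (symmPart r) :=
  (Γ.bracket_apply x r F F' φ).trans
    (sum_ev₂_orderTensor Γ.order r (isBalanced_edgeForm Γ.edge φ hF).sum_eq_zero)

/-- A gauge transformation by `h` replaces `r` by `Ad(h) r` in the bracket of invariant functions,
which only sees the invariant symmetric part of `r`. -/
theorem FatGraphModel.bracket_mem_invariants [CharZero k] {ι : Type*} [Fintype ι]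
    (x : Module.Basis ι k (lieAlg k G)) {r : lieAlg k G ⊗[k] lieAlg k G}
    (hr : ∀ h : G, TensorProduct.map (push (conjAut k G h)) (push (conjAut k G h)) (symmPart r) =
      symmPart r) {F F' : coordM ρ} (hF : F ∈ invariants ρ) (hF' : F' ∈ invariants ρ) :
    Γ.bracket ρ x r F F' ∈ invariants ρ := fun h φ => by
  rw [Γ.bracket_apply_of_mem_invariants x r hF, Γ.bracket_apply_of_mem_invariants x r hF]
  exact congrArg _ (sum_orderSign_comp Γ.order (push (conjAut k G h)) (hr h)
    (edgeForm_gauge Γ.edge φ hF h) (edgeForm_gauge Γ.edge φ hF' h))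

theorem FatGraphModel.isPoissonBracket_bracket [CharZero k] {ι : Type*} [Fintype ι]
    (x : Module.Basis ι k (lieAlg k G)) {r : lieAlg k G ⊗[k] lieAlg k G}
    (hr : IsClassicalRMatrix r) (hinv : ∀ (s : S) (h : G),
      TensorProduct.map (push (conjAut k G h * ρ s)) (push (conjAut k G h * ρ s)) (symmPart r) =
        symmPart r) : IsPoissonBracket (Γ.bracket ρ x r) :=
  (isPoissonBracket_fockRosly Γ.toCiliatedFatGraph (fun e => ρ (Γ.edge e)) x hr
    fun e h => hinv (Γ.edge e) h).transport (holPullback Γ.edge ρ)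

/-- The differential of a function is a functional on the tangent cocycles that does not depend on
the fat graph. -/
theorem sum_edgeForm_inr_eq_of_isCocycle {E' : Type*} [Fintype E'] [DecidableEq E']
    (b : FreeGroupBasis E S) (b' : FreeGroupBasis E' S) (φ : TwistedHom ρ) (F : coordM ρ)
    (l : S → lieAlg k G) (hl : IsCocycle φ.holRep l) :
    ∑ e, edgeForm b φ F (Sum.inr e) (l (b e)) = ∑ e, edgeForm b' φ F (Sum.inr e) (l (b' e)) := by
  rw [sum_edgeForm_inr b φ F fun e => l (b e), sum_edgeForm_inr b' φ F fun e => l (b' e),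
    edgeDer_eq_of_isCocycle b b' φ hl]

theorem FatGraphModel.bracket_eq [CharZero k] {ι : Type*} [Fintype ι]
    (x : Module.Basis ι k (lieAlg k G)) {r : lieAlg k G ⊗[k] lieAlg k G}
    (hinv : ∀ (s : S) (h : G),
      TensorProduct.map (push (conjAut k G h * ρ s)) (push (conjAut k G h * ρ s)) (symmPart r) =
        symmPart r) {E' : Type*} [Fintype E'] [DecidableEq E'] (Γ' : FatGraphModel E' S bdry)
    {F F' : coordM ρ} (hF : F ∈ invariants ρ) (hF' : F' ∈ invariants ρ) :
    Γ.bracket ρ x r F F' = Γ'.bracket ρ x r F F' := by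
  refine Subtype.ext (funext fun φ => ?_)
  rw [Γ.bracket_apply_of_mem_invariants x r hF, Γ'.bracket_apply_of_mem_invariants x r hF]
  have ht : ∀ s, TensorProduct.map (φ.holRep s) (φ.holRep s) (symmPart r) = symmPart r :=
    fun s => hinv s (φ.toFun s)
  have h := Γ.sum_orderSign_eq Γ' ht
    (isBalanced_edgeForm Γ.edge φ hF) (isBalanced_edgeForm Γ.edge φ hF')
    (isBalanced_edgeForm Γ'.edge φ hF) (isBalanced_edgeForm Γ'.edge φ hF')
    (sum_edgeForm_inr_eq_of_isCocycle Γ.edge Γ'.edge φ F)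
    (sum_edgeForm_inr_eq_of_isCocycle Γ.edge Γ'.edge φ F')
  exact congrArg _ h

end Bracket

end TwistedFR

theorem mainTheorem3 {k : Type*} [Field k] [IsAlgClosed k] [CharZero k]
    {G : Type*} [Group G] [TwistedFR.AffineAlgebraicGroup k G]
    (hG : TwistedFR.IsConnected k G)
    -- a splitting of `Aut(G) → Out(G)`, through which `Out(G)` acts on `G`
    (σ : TwistedFR.Out k G →* TwistedFR.AlgAut k G)
    (hσ : ∀ κ : TwistedFR.Out k G, (QuotientGroup.mk (σ κ) : TwistedFR.Out k G) = κ)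
    -- a basis of `𝔤` and an `Out(G)`-invariant classical r-matrix
    {ι : Type*} [Fintype ι] (x : Module.Basis ι k (TwistedFR.lieAlg k G))
    (r : TensorProduct k (TwistedFR.lieAlg k G) (TwistedFR.lieAlg k G))
    (hr : TwistedFR.IsClassicalRMatrix r)
    (hr_inv : ∀ κ : TwistedFR.Out k G,
      TensorProduct.map (TwistedFR.push (σ κ)) (TwistedFR.push (σ κ)) r = r)
    -- the surface, through its fundamental group and boundary circles, and the `Out(G)`-bundle
    {S : Type*} [Group S] (bdry : Set (ConjClasses S)) (ρ : S →* TwistedFR.Out k G)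
    -- two fat graph models of the surface
    {E E' : Type*} [Fintype E] [DecidableEq E] [Fintype E'] [DecidableEq E']
    (Γ : TwistedFR.FatGraphModel E S bdry) (Γ' : TwistedFR.FatGraphModel E' S bdry) :
    -- the bivector of `Γ` is a Poisson structure
    TwistedFR.IsPoissonBracket (Γ.bracket (σ.comp ρ) x r) ∧
    -- it restricts to the `G`-invariant functions
    (∀ F₁ ∈ TwistedFR.TwistedHom.invariants (σ.comp ρ),
      ∀ F₂ ∈ TwistedFR.TwistedHom.invariants (σ.comp ρ),
        Γ.bracket (σ.comp ρ) x r F₁ F₂ ∈ TwistedFR.TwistedHom.invariants (σ.comp ρ)) ∧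
    -- and there it does not depend on the fat graph
    (∀ F₁ ∈ TwistedFR.TwistedHom.invariants (σ.comp ρ),
      ∀ F₂ ∈ TwistedFR.TwistedHom.invariants (σ.comp ρ),
        Γ.bracket (σ.comp ρ) x r F₁ F₂ = Γ'.bracket (σ.comp ρ) x r F₁ F₂) := by
  have : Module.Finite k (TwistedFR.lieAlg k G) := Module.Finite.of_basis x
  have hconj : ∀ h : G, TensorProduct.map (TwistedFR.push (TwistedFR.conjAut k G h))
      (TwistedFR.push (TwistedFR.conjAut k G h)) (TwistedFR.symmPart r) = TwistedFR.symmPart r :=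
    TwistedFR.map_push_conjAut_of_lie_eq_zero hG hr.symm_invariant
  have hinv : ∀ (s : S) (h : G),
      TensorProduct.map (TwistedFR.push (TwistedFR.conjAut k G h * (σ.comp ρ) s))
        (TwistedFR.push (TwistedFR.conjAut k G h * (σ.comp ρ) s)) (TwistedFR.symmPart r) =
          TwistedFR.symmPart r := fun s h =>
    (TwistedFR.map_push_mul _ _ _).trans ((congrArg _
      (TwistedFR.map_symmPart (hr_inv (ρ s)))).trans (hconj h))
  exact ⟨Γ.isPoissonBracket_bracket x hr hinv,
    fun F₁ h₁ F₂ h₂ => Γ.bracket_mem_invariants x hconj h₁ h₂,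
    fun F₁ h₁ F₂ h₂ => Γ.bracket_eq x hinv Γ' h₁ h₂⟩
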